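/- **Setting.** Let $\mathfrak{C}^C$ be the complexified Cayley algebra with its standard basis $e_0=1,e_1,\dots,e_7$ (Cayley–Dickson product $(m+ae_4)(n+be_4)=(mn-\bar b a)+(a\bar n+bm)e_4$ over the quaternions with basis $1,e_1,e_2,e_3=e_1e_2$; $e_5=e_1e_4$, $e_6=e_2e_4$, $e_7=e_3e_4$) and its $\mathbb C$-linear conjugation $x\mapsto\bar x$. Let $\mathfrak{J}^C$ be the Jordan algebra of Hermitian matrices $$X=\begin{pmatrix}\xi_1&x_3&\bar x_2\\ \bar x_3&\xi_2&x_1\\ x_2&\bar x_1&\xi_3\end{pmatrix},\qquad \xi_k\in\mathbb C,\ x_k\in\mathfrak C^C,$$ with $X\circ Y=\frac12(XY+YX)$, $\operatorname{tr}X=\xi_1+\xi_2+\xi_3$, $(X,Y)=\operatorname{tr}(X\circ Y)$ and $X\times Y=\frac12\big(2X\circ Y-\operatorname{tr}(X)Y-\operatorname{tr}(Y)X+(\operatorname{tr}(X)\operatorname{tr}(Y)-(X,Y))E\big)$, where $E$ is the unit matrix. $E_k$ is the element with $\xi_k=1$ and all other coordinates $0$; $F_1(x)$ the element with $x_1=x$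 and all other coordinates $0$. For $T\in\mathfrak J^C$ let $\widetilde T X=T\circ X$, and for $a\in\mathfrak C^C$ let $\widetilde A_1(a)X=\frac12(A_1(a)X-XA_1(a))$, where $A_1(a)$ has entries $a$ at $(2,3)$, $-\bar a$ at $(3,2)$ and $0$ elsewhere. Put $\mathfrak f_4^C=\operatorname{Der}(\mathfrak J^C)$, $\mathfrak e_6^C=\{\delta+\widetilde T\mid\delta\in\mathfrak f_4^C,\ \operatorname{tr}T=0\}$, and $X\vee W=[\widetilde X,\widetilde W]+\big(X\circ W-\frac13(X,W)E\big)^{\sim}$. Let ${}^t\varphi$ be the transpose of $\varphi$ with respect to $(X,Y)$. Let $\mathfrak P^C=\mathfrak J^C\oplus\mathfrak J^C\oplus\mathbb C\oplus\mathbb C$. For $\varphi\in\operatorname{End}(\mathfrak J^C)$, $A,B\in\mathfrak J^C$, $\nu\in\mathbb C$, define $$\Phi(\varphi,A,B,\nu)(X,Y,\xi,\eta)=\big(\varphi X-\tfrac\nu3X+2B\times Y+\eta A,\ 2A\times X-{}^t\varphi Y+\tfrac\nu3Y+\xi B,\ (A,Y)+\nu\xi,\ (B,X)-\nu\eta\big),$$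 and $\mathfrak e_7^C=\{\Phi(\varphi,A,B,\nu)\mid\varphi\in\mathfrak e_6^C,\ A,B\in\mathfrak J^C,\ \nu\in\mathbb C\}$. For $P=(X,Y,\xi,\eta)$ and $Q=(Z,W,\zeta,\omega)$ put $\{P,Q\}=(X,W)-(Z,Y)+\xi\omega-\zeta\eta$ and $P\times Q=\Phi(\varphi,A,B,\nu)$ with $\varphi=-\frac12(X\vee W+Z\vee Y)$, $A=-\frac14(2Y\times W-\xi Z-\zeta X)$, $B=\frac14(2X\times Z-\eta W-\omega Y)$, $\nu=\frac18\big((X,W)+(Z,Y)-3(\xi\omega+\zeta\eta)\big)$. Let $\mathfrak e_8^C=\mathfrak e_7^C\oplus\mathfrak P^C\oplus\mathfrak P^C\oplus\mathbb C\oplus\mathbb C\oplus\mathbb C$ with bracket $[(\Phi_1,P_1,Q_1,r_1,s_1,t_1),(\Phi_2,P_2,Q_2,r_2,s_2,t_2)]=(\Phi,P,Q,r,s,t)$, $$\begin{aligned} \Phi&=[\Phi_1,\Phi_2]+P_1\times Q_2-P_2\times Q_1,\\ P&=\Phi_1P_2-\Phi_2P_1+r_1P_2-r_2P_1+s_1Q_2-s_2Q_1,\\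 Q&=\Phi_1Q_2-\Phi_2Q_1-r_1Q_2+r_2Q_1+t_1P_2-t_2P_1,\\ r&=-\tfrac18\{P_1,Q_2\}+\tfrac18\{P_2,Q_1\}+s_1t_2-s_2t_1,\\ s&=\tfrac14\{P_1,P_2\}+2r_1s_2-2r_2s_1,\\ t&=-\tfrac14\{Q_1,Q_2\}-2r_1t_2+2r_2t_1. \end{aligned}$$ Let $\tau$ denote complex conjugation on $\mathfrak J^C$ and $\mathfrak P^C$ (of all complex coordinates), and $\lambda(X,Y,\xi,\eta)=(Y,-X,\eta,-\xi)$. Let $\sigma'_4$ act on $\mathfrak J^C$ by fixing $\xi_1,\xi_2,\xi_3$ and $x_1\mapsto-e_1x_1e_1$, $x_2\mapsto e_1x_2$, $x_3\mapsto-x_3e_1$, and on $\mathfrak P^C$ by $(X,Y,\xi,\eta)\mapsto(\sigma'_4X,\sigma'_4Y,\xi,\eta)$. On $\mathfrak e_8^C$ put $$\sigma'_4(\Phi,P,Q,r,s,t)=(\sigma'_4\Phi\sigma_4'^{-1},\sigma'_4P,\sigma'_4Q,r,s,t),\quad \lambda_\omega(\Phi,P,Q,r,s,t)=(\lambda\Phi\lambda^{-1},\lambda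 Q,-\lambda P,-r,-t,-s),$$ $\tau(\Phi,P,Q,r,s,t)=(\tau\Phi\tau,\tau P,\tau Q,\tau r,\tau s,\tau t)$, and let $\mathfrak e_8=\{R\in\mathfrak e_8^C\mid\tau\lambda_\omega R=R\}$ be the compact real form. Let $$\mathfrak{so}(6,C)=\{D\in\mathfrak f_4^C\mid DE_1=DE_2=DE_3=DF_1(1)=DF_1(e_1)=0\},\qquad \mathfrak{so}(6)=\{D\in\mathfrak{so}(6,C)\mid D\tau=\tau D\},$$ let $R_D=(\Phi(D,0,0,0),0,0,0,0,0)$, and put $$(\mathfrak e_8)^{\sigma'_4,\mathfrak{so}(6)}=\{R\in\mathfrak e_8\mid\sigma'_4R=R,\ [R,R_D]=0\ \text{for all }D\in\mathfrak{so}(6)\},$$ $$(\mathfrak e_8^C)^{\sigma'_4,\mathfrak{so}(6,C)}=\{R\in\mathfrak e_8^C\mid\sigma'_4R=R,\ [R,R_D]=0\ \text{for all }D\in\mathfrak{so}(6,C)\}.$$ For $0\le i<j\le9$ let $G_{ij}$ be the skew-symmetric $10\times10$ matrix (rows and columns numbered from $0$ to $9$) whose $(i,j)$ entry is $1$, whose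 $(j,i)$ entry is $-1$, and whose other entries are $0$. Define $R_{ij}\in\mathfrak e_8^C$ as follows, where $E_\pm=E_2\pm E_3$, $\Phi(\dots)$ alone stands for $(\Phi(\dots),0,0,0,0,0)$, and $(P;Q)$ stands for $(0,P,Q,0,0,0)$: - $R_{01}=\Phi(-i\widetilde{E_-},0,0,0)$, $R_{02}=\Phi(0,-\frac i2E_-,-\frac i2E_-,0)$, $R_{12}=\Phi(0,\frac12E_+,-\frac12E_+,0)$, $R_{03}=\Phi(0,-\frac12E_-,\frac12E_-,0)$, $R_{13}=\Phi(0,-\frac i2E_+,-\frac i2E_+,0)$, $R_{23}=\Phi(-i\,E_1\vee E_1,0,0,i)$; - $R_{04}=((-E_-,0,0,0);(0,-E_-,0,0))$, $R_{14}=((-iE_+,0,0,0);(0,iE_+,0,0))$, $R_{24}=((0,iE_1,0,-i);(iE_1,0,-i,0))$, $R_{34}=((0,E_1,0,1);(-E_1,0,-1,0))$; - $R_{05}=((-iE_-,0,0,0);(0,iE_-,0,0))$, $R_{15}=((E_+,0,0,0);(0,E_+,0,0))$, $R_{25}=((0,-E_1,0,1);(E_1,0,-1,0))$, $R_{35}=((0,iE_1,0,i);(iE_1,0,i,0))$,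 $R_{45}=(\Phi(i\,E_1\vee E_1,0,0,\frac i2),0,0,-\frac i2,0,0)$; - $R_{06}=((0,-E_-,0,0);(E_-,0,0,0))$, $R_{16}=((0,iE_+,0,0);(iE_+,0,0,0))$, $R_{26}=((iE_1,0,-i,0);(0,-iE_1,0,i))$, $R_{36}=((-E_1,0,-1,0);(0,-E_1,0,-1))$, $R_{46}=(\Phi(0,\frac12E_1,-\frac12E_1,0),0,0,0,-\frac12,\frac12)$, $R_{56}=(\Phi(0,-\frac i2E_1,-\frac i2E_1,0),0,0,0,-\frac i2,-\frac i2)$; - $R_{07}=((0,-iE_-,0,0);(-iE_-,0,0,0))$, $R_{17}=((0,-E_+,0,0);(E_+,0,0,0))$, $R_{27}=((-E_1,0,1,0);(0,-E_1,0,1))$, $R_{37}=((-iE_1,0,-i,0);(0,iE_1,0,i))$, $R_{47}=(\Phi(0,\frac i2E_1,\frac i2E_1,0),0,0,0,-\frac i2,-\frac i2)$, $R_{57}=(\Phi(0,\frac12E_1,-\frac12E_1,0),0,0,0,\frac12,-\frac12)$, $R_{67}=(\Phi(-i\,E_1\vee E_1,0,0,-\frac i2),0,0,-\frac i2,0,0)$;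 - for $(j,a)=(8,1)$ and $(j,a)=(9,e_1)$, with $F=F_1(a)$: $R_{0j}=\Phi(-\widetilde A_1(a),0,0,0)$, $R_{1j}=\Phi(-i\widetilde F,0,0,0)$, $R_{2j}=\Phi(0,-\frac i2F,-\frac i2F,0)$, $R_{3j}=\Phi(0,-\frac12F,\frac12F,0)$, $R_{4j}=((-F,0,0,0);(0,-F,0,0))$, $R_{5j}=((-iF,0,0,0);(0,iF,0,0))$, $R_{6j}=((0,-F,0,0);(F,0,0,0))$, $R_{7j}=((0,-iF,0,0);(-iF,0,0,0))$; - $R_{89}=\Phi(-[\widetilde A_1(1),\widetilde A_1(e_1)],0,0,0)$. **Proposition.** 1. There is an isomorphism of real Lie algebras $\mathfrak{so}(10)\to(\mathfrak e_8)^{\sigma'_4,\mathfrak{so}(6)}$ with $G_{ij}\mapsto R_{ij}$ for all $0\le i<j\le9$. 2. There is an isomorphism of complex Lie algebras $\mathfrak{so}(10,C)\to(\mathfrak e_8^C)^{\sigma'_4,\mathfrak{so}(6,C)}$ with $G_{ij}\mapsto R_{ij}$ for all $0\le i<j\le9$. 3. $(\mathfrak e_8^C)^{\sigma'_4,\mathfrak{so}(6,C)}$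 is the complexification of $(\mathfrak e_8)^{\sigma'_4,\mathfrak{so}(6)}$: an element of $\mathfrak e_8^C$ lies in the former if and only if it is $R'+iR''$ with $R',R''$ in the latter, and $R',R''$ are then unique. -/

import Mathlib

noncomputable section

/-- The complexified Cayley algebra `𝔠^C`, in the coordinates of the basis `e₀ = 1, e₁, …, e₇`. -/
@[ext] structure Oct where
  c0 : ℂ
  c1 : ℂ
  c2 : ℂ
  c3 : ℂ
  c4 : ℂ
  c5 : ℂ
  c6 : ℂ
  c7 : ℂ

namespace Oct

instance : Zero Oct := ⟨⟨0, 0, 0, 0, 0, 0, 0, 0⟩⟩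
instance : Add Oct := ⟨fun X Y => ⟨X.c0 + Y.c0, X.c1 + Y.c1, X.c2 + Y.c2, X.c3 + Y.c3, X.c4 + Y.c4, X.c5 + Y.c5, X.c6 + Y.c6, X.c7 + Y.c7⟩⟩
instance : Neg Oct := ⟨fun X => ⟨-X.c0, -X.c1, -X.c2, -X.c3, -X.c4, -X.c5, -X.c6, -X.c7⟩⟩
instance : SMul ℂ Oct := ⟨fun c X => ⟨c • X.c0, c • X.c1, c • X.c2, c • X.c3, c • X.c4, c • X.c5, c • X.c6, c • X.c7⟩⟩

@[simp] theorem zero_c0 : (0 : Oct).c0 = 0 := rfl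
@[simp] theorem add_c0 (X Y : Oct) : (X + Y).c0 = X.c0 + Y.c0 := rfl
@[simp] theorem neg_c0 (X : Oct) : (-X).c0 = -X.c0 := rfl
@[simp] theorem smul_c0 (c : ℂ) (X : Oct) : (c • X).c0 = c • X.c0 := rfl
@[simp] theorem zero_c1 : (0 : Oct).c1 = 0 := rfl
@[simp] theorem add_c1 (X Y : Oct) : (X + Y).c1 = X.c1 + Y.c1 := rfl
@[simp] theorem neg_c1 (X : Oct) : (-X).c1 = -X.c1 := rfl
@[simp] theorem smul_c1 (c : ℂ) (X : Oct) : (c • X).c1 = c • X.c1 := rfl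
@[simp] theorem zero_c2 : (0 : Oct).c2 = 0 := rfl
@[simp] theorem add_c2 (X Y : Oct) : (X + Y).c2 = X.c2 + Y.c2 := rfl
@[simp] theorem neg_c2 (X : Oct) : (-X).c2 = -X.c2 := rfl
@[simp] theorem smul_c2 (c : ℂ) (X : Oct) : (c • X).c2 = c • X.c2 := rfl
@[simp] theorem zero_c3 : (0 : Oct).c3 = 0 := rfl
@[simp] theorem add_c3 (X Y : Oct) : (X + Y).c3 = X.c3 + Y.c3 := rfl
@[simp] theorem neg_c3 (X : Oct) : (-X).c3 = -X.c3 := rfl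
@[simp] theorem smul_c3 (c : ℂ) (X : Oct) : (c • X).c3 = c • X.c3 := rfl
@[simp] theorem zero_c4 : (0 : Oct).c4 = 0 := rfl
@[simp] theorem add_c4 (X Y : Oct) : (X + Y).c4 = X.c4 + Y.c4 := rfl
@[simp] theorem neg_c4 (X : Oct) : (-X).c4 = -X.c4 := rfl
@[simp] theorem smul_c4 (c : ℂ) (X : Oct) : (c • X).c4 = c • X.c4 := rfl
@[simp] theorem zero_c5 : (0 : Oct).c5 = 0 := rfl
@[simp] theorem add_c5 (X Y : Oct) : (X + Y).c5 = X.c5 + Y.c5 := rfl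
@[simp] theorem neg_c5 (X : Oct) : (-X).c5 = -X.c5 := rfl
@[simp] theorem smul_c5 (c : ℂ) (X : Oct) : (c • X).c5 = c • X.c5 := rfl
@[simp] theorem zero_c6 : (0 : Oct).c6 = 0 := rfl
@[simp] theorem add_c6 (X Y : Oct) : (X + Y).c6 = X.c6 + Y.c6 := rfl
@[simp] theorem neg_c6 (X : Oct) : (-X).c6 = -X.c6 := rfl
@[simp] theorem smul_c6 (c : ℂ) (X : Oct) : (c • X).c6 = c • X.c6 := rfl
@[simp] theorem zero_c7 : (0 : Oct).c7 = 0 := rfl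
@[simp] theorem add_c7 (X Y : Oct) : (X + Y).c7 = X.c7 + Y.c7 := rfl
@[simp] theorem neg_c7 (X : Oct) : (-X).c7 = -X.c7 := rfl
@[simp] theorem smul_c7 (c : ℂ) (X : Oct) : (c • X).c7 = c • X.c7 := rfl

instance : AddCommGroup Oct where
  add_assoc X Y Z := by ext1 <;> simp only [add_c0, add_c1, add_c2, add_c3, add_c4, add_c5, add_c6, add_c7, add_assoc]
  zero_add X := by ext1 <;> simp only [add_c0, zero_c0, add_c1, zero_c1, add_c2, zero_c2, add_c3, zero_c3, add_c4, zero_c4, add_c5, zero_c5, add_c6, zero_c6, add_c7, zero_c7, zero_add]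
  add_zero X := by ext1 <;> simp only [add_c0, zero_c0, add_c1, zero_c1, add_c2, zero_c2, add_c3, zero_c3, add_c4, zero_c4, add_c5, zero_c5, add_c6, zero_c6, add_c7, zero_c7, add_zero]
  neg_add_cancel X := by
    ext1 <;> simp only [add_c0, zero_c0, neg_c0, add_c1, zero_c1, neg_c1, add_c2, zero_c2, neg_c2, add_c3, zero_c3, neg_c3, add_c4, zero_c4, neg_c4, add_c5, zero_c5, neg_c5, add_c6, zero_c6, neg_c6, add_c7, zero_c7, neg_c7, neg_add_cancel]
  add_comm X Y := by ext1 <;> simp only [add_c0, add_c1, add_c2, add_c3, add_c4, add_c5, add_c6, add_c7, add_comm]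
  nsmul := nsmulRec
  zsmul := zsmulRec

@[simp] theorem sub_c0 (X Y : Oct) : (X - Y).c0 = X.c0 - Y.c0 := by
  rw [sub_eq_add_neg, add_c0, neg_c0, ← sub_eq_add_neg]
@[simp] theorem sub_c1 (X Y : Oct) : (X - Y).c1 = X.c1 - Y.c1 := by
  rw [sub_eq_add_neg, add_c1, neg_c1, ← sub_eq_add_neg]
@[simp] theorem sub_c2 (X Y : Oct) : (X - Y).c2 = X.c2 - Y.c2 := by
  rw [sub_eq_add_neg, add_c2, neg_c2, ← sub_eq_add_neg]
@[simp] theorem sub_c3 (X Y : Oct) : (X - Y).c3 = X.c3 - Y.c3 := by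
  rw [sub_eq_add_neg, add_c3, neg_c3, ← sub_eq_add_neg]
@[simp] theorem sub_c4 (X Y : Oct) : (X - Y).c4 = X.c4 - Y.c4 := by
  rw [sub_eq_add_neg, add_c4, neg_c4, ← sub_eq_add_neg]
@[simp] theorem sub_c5 (X Y : Oct) : (X - Y).c5 = X.c5 - Y.c5 := by
  rw [sub_eq_add_neg, add_c5, neg_c5, ← sub_eq_add_neg]
@[simp] theorem sub_c6 (X Y : Oct) : (X - Y).c6 = X.c6 - Y.c6 := by
  rw [sub_eq_add_neg, add_c6, neg_c6, ← sub_eq_add_neg]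
@[simp] theorem sub_c7 (X Y : Oct) : (X - Y).c7 = X.c7 - Y.c7 := by
  rw [sub_eq_add_neg, add_c7, neg_c7, ← sub_eq_add_neg]

instance : Module ℂ Oct where
  one_smul X := by
    ext1 <;> simp only [smul_c0, smul_c1, smul_c2, smul_c3, smul_c4, smul_c5, smul_c6,
    smul_c7, one_smul]
  mul_smul c d X := by
    ext1 <;> simp only [smul_c0, smul_c1, smul_c2, smul_c3, smul_c4, smul_c5, smul_c6,
    smul_c7, mul_smul]
  smul_zero c := by
    ext1 <;> simp only [smul_c0, smul_c1, smul_c2, smul_c3, smul_c4, smul_c5, smul_c6,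
    smul_c7, zero_c0, zero_c1, zero_c2, zero_c3, zero_c4, zero_c5, zero_c6, zero_c7,
    smul_zero]
  smul_add c X Y := by
    ext1 <;> simp only [smul_c0, smul_c1, smul_c2, smul_c3, smul_c4, smul_c5, smul_c6,
    smul_c7, add_c0, add_c1, add_c2, add_c3, add_c4, add_c5, add_c6, add_c7, smul_add]
  add_smul c d X := by
    ext1 <;> simp only [smul_c0, smul_c1, smul_c2, smul_c3, smul_c4, smul_c5, smul_c6,
    smul_c7, add_c0, add_c1, add_c2, add_c3, add_c4, add_c5, add_c6, add_c7, add_smul]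
  zero_smul X := by
    ext1 <;> simp only [smul_c0, smul_c1, smul_c2, smul_c3, smul_c4, smul_c5, smul_c6,
    smul_c7, zero_c0, zero_c1, zero_c2, zero_c3, zero_c4, zero_c5, zero_c6, zero_c7,
    zero_smul]

/-- The octonion product: the `ℂ`-bilinear extension of the Cayley–Dickson product
`(m + a e₄)(n + b e₄) = (m n - b̄ a) + (a n̄ + b m) e₄` of pairs of quaternions, where `H` has the
basis `1, i = e₁, j = e₂, k = e₃` and `e₅ = e₁ e₄`, `e₆ = e₂ e₄`, `e₇ = e₃ e₄`. -/
instance : Mul Oct := ⟨fun x y =>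
  ⟨x.c0 * y.c0 - x.c1 * y.c1 - x.c2 * y.c2 - x.c3 * y.c3 - x.c4 * y.c4 - x.c5 * y.c5 - x.c6 * y.c6 - x.c7 * y.c7,
   x.c0 * y.c1 + x.c1 * y.c0 + x.c2 * y.c3 - x.c3 * y.c2 + x.c4 * y.c5 - x.c5 * y.c4 - x.c6 * y.c7 + x.c7 * y.c6,
   x.c0 * y.c2 - x.c1 * y.c3 + x.c2 * y.c0 + x.c3 * y.c1 + x.c4 * y.c6 + x.c5 * y.c7 - x.c6 * y.c4 - x.c7 * y.c5,
   x.c0 * y.c3 + x.c1 * y.c2 - x.c2 * y.c1 + x.c3 * y.c0 + x.c4 * y.c7 - x.c5 * y.c6 + x.c6 * y.c5 - x.c7 * y.c4,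
   x.c0 * y.c4 - x.c1 * y.c5 - x.c2 * y.c6 - x.c3 * y.c7 + x.c4 * y.c0 + x.c5 * y.c1 + x.c6 * y.c2 + x.c7 * y.c3,
   x.c0 * y.c5 + x.c1 * y.c4 - x.c2 * y.c7 + x.c3 * y.c6 - x.c4 * y.c1 + x.c5 * y.c0 - x.c6 * y.c3 + x.c7 * y.c2,
   x.c0 * y.c6 + x.c1 * y.c7 + x.c2 * y.c4 - x.c3 * y.c5 - x.c4 * y.c2 + x.c5 * y.c3 + x.c6 * y.c0 - x.c7 * y.c1,
   x.c0 * y.c7 - x.c1 * y.c6 + x.c2 * y.c5 + x.c3 * y.c4 - x.c4 * y.c3 - x.c5 * y.c2 + x.c6 * y.c1 + x.c7 * y.c0⟩⟩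

@[simp] theorem mul_c0 (x y : Oct) : (x * y).c0 =
  x.c0 * y.c0 - x.c1 * y.c1 - x.c2 * y.c2 - x.c3 * y.c3 - x.c4 * y.c4 - x.c5 * y.c5 - x.c6 * y.c6 - x.c7 * y.c7 := rfl
@[simp] theorem mul_c1 (x y : Oct) : (x * y).c1 =
  x.c0 * y.c1 + x.c1 * y.c0 + x.c2 * y.c3 - x.c3 * y.c2 + x.c4 * y.c5 - x.c5 * y.c4 - x.c6 * y.c7 + x.c7 * y.c6 := rfl
@[simp] theorem mul_c2 (x y : Oct) : (x * y).c2 =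
  x.c0 * y.c2 - x.c1 * y.c3 + x.c2 * y.c0 + x.c3 * y.c1 + x.c4 * y.c6 + x.c5 * y.c7 - x.c6 * y.c4 - x.c7 * y.c5 := rfl
@[simp] theorem mul_c3 (x y : Oct) : (x * y).c3 =
  x.c0 * y.c3 + x.c1 * y.c2 - x.c2 * y.c1 + x.c3 * y.c0 + x.c4 * y.c7 - x.c5 * y.c6 + x.c6 * y.c5 - x.c7 * y.c4 := rfl
@[simp] theorem mul_c4 (x y : Oct) : (x * y).c4 =
  x.c0 * y.c4 - x.c1 * y.c5 - x.c2 * y.c6 - x.c3 * y.c7 + x.c4 * y.c0 + x.c5 * y.c1 + x.c6 * y.c2 + x.c7 * y.c3 := rfl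
@[simp] theorem mul_c5 (x y : Oct) : (x * y).c5 =
  x.c0 * y.c5 + x.c1 * y.c4 - x.c2 * y.c7 + x.c3 * y.c6 - x.c4 * y.c1 + x.c5 * y.c0 - x.c6 * y.c3 + x.c7 * y.c2 := rfl
@[simp] theorem mul_c6 (x y : Oct) : (x * y).c6 =
  x.c0 * y.c6 + x.c1 * y.c7 + x.c2 * y.c4 - x.c3 * y.c5 - x.c4 * y.c2 + x.c5 * y.c3 + x.c6 * y.c0 - x.c7 * y.c1 := rfl
@[simp] theorem mul_c7 (x y : Oct) : (x * y).c7 =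
  x.c0 * y.c7 - x.c1 * y.c6 + x.c2 * y.c5 + x.c3 * y.c4 - x.c4 * y.c3 - x.c5 * y.c2 + x.c6 * y.c1 + x.c7 * y.c0 := rfl

instance : NonUnitalNonAssocRing Oct where
  left_distrib x y z := by ext1 <;> simp <;> ring
  right_distrib x y z := by ext1 <;> simp <;> ring
  zero_mul x := by ext1 <;> simp
  mul_zero x := by ext1 <;> simp

instance : IsScalarTower ℂ Oct Oct where
  smul_assoc c x y := by ext1 <;> simp <;> ring

instance : SMulCommClass ℂ Oct Oct where
  smul_comm c x y := by ext1 <;> simp <;> ring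

/-- The unit `e₀ = 1`. -/
def one : Oct := ⟨1, 0, 0, 0, 0, 0, 0, 0⟩

/-- The basis element `e₁`. -/
def e1 : Oct := ⟨0, 1, 0, 0, 0, 0, 0, 0⟩

/-- The `ℂ`-linear conjugation `x ↦ x̄` of `𝔠^C`. -/
def bar : Oct →ₗ[ℂ] Oct where
  toFun x := ⟨x.c0, -x.c1, -x.c2, -x.c3, -x.c4, -x.c5, -x.c6, -x.c7⟩
  map_add' x y := by ext1 <;> simp [add_comm]
  map_smul' c x := by ext1 <;> simp

/-- The `e₀`-coordinate. -/
def re : Oct →ₗ[ℂ] ℂ where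
  toFun x := x.c0
  map_add' _ _ := rfl
  map_smul' _ _ := rfl

/-- The complex conjugation `τ` of `𝔠^C` (conjugation of all eight coordinates). -/
def tau : Oct →ₛₗ[starRingEnd ℂ] Oct where
  toFun x := ⟨star x.c0, star x.c1, star x.c2, star x.c3, star x.c4, star x.c5, star x.c6, star x.c7⟩
  map_add' x y := by ext1 <;> simp
  map_smul' c x := by ext1 <;> simp

/-- `𝔠^C` is a composition algebra: `x x̄ = n(x) 1` with `n` the sum of squares, and `n` is
multiplicative. -/
theorem norm_mul (x y : Oct) :
    (x * y) * bar (x * y) = (re (x * bar x) * re (y * bar y)) • one := by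
  ext1 <;> simp [bar, re, one] <;> ring

end Oct

/-- The exceptional Jordan algebra `𝔍^C = 𝔍(3, 𝔠^C)` of Hermitian `3 × 3` matrices over `𝔠^C`, in the
coordinates `ξ₁, ξ₂, ξ₃, x₁, x₂, x₃`; see `J.toMat` for their places in the matrix. -/
@[ext] structure J where
  ξ₁ : ℂ
  ξ₂ : ℂ
  ξ₃ : ℂ
  x₁ : Oct
  x₂ : Oct
  x₃ : Oct

namespace J

instance : Zero J := ⟨⟨0, 0, 0, 0, 0, 0⟩⟩
instance : Add J := ⟨fun X Y => ⟨X.ξ₁ + Y.ξ₁, X.ξ₂ + Y.ξ₂, X.ξ₃ + Y.ξ₃, X.x₁ + Y.x₁, X.x₂ + Y.x₂, X.x₃ + Y.x₃⟩⟩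
instance : Neg J := ⟨fun X => ⟨-X.ξ₁, -X.ξ₂, -X.ξ₃, -X.x₁, -X.x₂, -X.x₃⟩⟩
instance : SMul ℂ J := ⟨fun c X => ⟨c • X.ξ₁, c • X.ξ₂, c • X.ξ₃, c • X.x₁, c • X.x₂, c • X.x₃⟩⟩

@[simp] theorem zero_ξ₁ : (0 : J).ξ₁ = 0 := rfl
@[simp] theorem add_ξ₁ (X Y : J) : (X + Y).ξ₁ = X.ξ₁ + Y.ξ₁ := rfl
@[simp] theorem neg_ξ₁ (X : J) : (-X).ξ₁ = -X.ξ₁ := rfl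
@[simp] theorem smul_ξ₁ (c : ℂ) (X : J) : (c • X).ξ₁ = c • X.ξ₁ := rfl
@[simp] theorem zero_ξ₂ : (0 : J).ξ₂ = 0 := rfl
@[simp] theorem add_ξ₂ (X Y : J) : (X + Y).ξ₂ = X.ξ₂ + Y.ξ₂ := rfl
@[simp] theorem neg_ξ₂ (X : J) : (-X).ξ₂ = -X.ξ₂ := rfl
@[simp] theorem smul_ξ₂ (c : ℂ) (X : J) : (c • X).ξ₂ = c • X.ξ₂ := rfl
@[simp] theorem zero_ξ₃ : (0 : J).ξ₃ = 0 := rfl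
@[simp] theorem add_ξ₃ (X Y : J) : (X + Y).ξ₃ = X.ξ₃ + Y.ξ₃ := rfl
@[simp] theorem neg_ξ₃ (X : J) : (-X).ξ₃ = -X.ξ₃ := rfl
@[simp] theorem smul_ξ₃ (c : ℂ) (X : J) : (c • X).ξ₃ = c • X.ξ₃ := rfl
@[simp] theorem zero_x₁ : (0 : J).x₁ = 0 := rfl
@[simp] theorem add_x₁ (X Y : J) : (X + Y).x₁ = X.x₁ + Y.x₁ := rfl
@[simp] theorem neg_x₁ (X : J) : (-X).x₁ = -X.x₁ := rfl
@[simp] theorem smul_x₁ (c : ℂ) (X : J) : (c • X).x₁ = c • X.x₁ := rfl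
@[simp] theorem zero_x₂ : (0 : J).x₂ = 0 := rfl
@[simp] theorem add_x₂ (X Y : J) : (X + Y).x₂ = X.x₂ + Y.x₂ := rfl
@[simp] theorem neg_x₂ (X : J) : (-X).x₂ = -X.x₂ := rfl
@[simp] theorem smul_x₂ (c : ℂ) (X : J) : (c • X).x₂ = c • X.x₂ := rfl
@[simp] theorem zero_x₃ : (0 : J).x₃ = 0 := rfl
@[simp] theorem add_x₃ (X Y : J) : (X + Y).x₃ = X.x₃ + Y.x₃ := rfl
@[simp] theorem neg_x₃ (X : J) : (-X).x₃ = -X.x₃ := rfl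
@[simp] theorem smul_x₃ (c : ℂ) (X : J) : (c • X).x₃ = c • X.x₃ := rfl

instance : AddCommGroup J where
  add_assoc X Y Z := by ext1 <;> simp only [add_ξ₁, add_ξ₂, add_ξ₃, add_x₁, add_x₂, add_x₃, add_assoc]
  zero_add X := by ext1 <;> simp only [add_ξ₁, zero_ξ₁, add_ξ₂, zero_ξ₂, add_ξ₃, zero_ξ₃, add_x₁, zero_x₁, add_x₂, zero_x₂, add_x₃, zero_x₃, zero_add]
  add_zero X := by ext1 <;> simp only [add_ξ₁, zero_ξ₁, add_ξ₂, zero_ξ₂, add_ξ₃, zero_ξ₃, add_x₁, zero_x₁, add_x₂, zero_x₂, add_x₃, zero_x₃, add_zero]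
  neg_add_cancel X := by
    ext1 <;> simp only [add_ξ₁, zero_ξ₁, neg_ξ₁, add_ξ₂, zero_ξ₂, neg_ξ₂, add_ξ₃, zero_ξ₃, neg_ξ₃, add_x₁, zero_x₁, neg_x₁, add_x₂, zero_x₂, neg_x₂, add_x₃, zero_x₃, neg_x₃, neg_add_cancel]
  add_comm X Y := by ext1 <;> simp only [add_ξ₁, add_ξ₂, add_ξ₃, add_x₁, add_x₂, add_x₃, add_comm]
  nsmul := nsmulRec
  zsmul := zsmulRec

@[simp] theorem sub_ξ₁ (X Y : J) : (X - Y).ξ₁ = X.ξ₁ - Y.ξ₁ := by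
  rw [sub_eq_add_neg, add_ξ₁, neg_ξ₁, ← sub_eq_add_neg]
@[simp] theorem sub_ξ₂ (X Y : J) : (X - Y).ξ₂ = X.ξ₂ - Y.ξ₂ := by
  rw [sub_eq_add_neg, add_ξ₂, neg_ξ₂, ← sub_eq_add_neg]
@[simp] theorem sub_ξ₃ (X Y : J) : (X - Y).ξ₃ = X.ξ₃ - Y.ξ₃ := by
  rw [sub_eq_add_neg, add_ξ₃, neg_ξ₃, ← sub_eq_add_neg]
@[simp] theorem sub_x₁ (X Y : J) : (X - Y).x₁ = X.x₁ - Y.x₁ := by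
  rw [sub_eq_add_neg, add_x₁, neg_x₁, ← sub_eq_add_neg]
@[simp] theorem sub_x₂ (X Y : J) : (X - Y).x₂ = X.x₂ - Y.x₂ := by
  rw [sub_eq_add_neg, add_x₂, neg_x₂, ← sub_eq_add_neg]
@[simp] theorem sub_x₃ (X Y : J) : (X - Y).x₃ = X.x₃ - Y.x₃ := by
  rw [sub_eq_add_neg, add_x₃, neg_x₃, ← sub_eq_add_neg]

instance : Module ℂ J where
  one_smul X := by
    ext1 <;> simp only [smul_ξ₁, smul_ξ₂, smul_ξ₃, smul_x₁, smul_x₂, smul_x₃, one_smul]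
  mul_smul c d X := by
    ext1 <;> simp only [smul_ξ₁, smul_ξ₂, smul_ξ₃, smul_x₁, smul_x₂, smul_x₃, mul_smul]
  smul_zero c := by
    ext1 <;> simp only [smul_ξ₁, smul_ξ₂, smul_ξ₃, smul_x₁, smul_x₂, smul_x₃, zero_ξ₁,
    zero_ξ₂, zero_ξ₃, zero_x₁, zero_x₂, zero_x₃, smul_zero]
  smul_add c X Y := by
    ext1 <;> simp only [smul_ξ₁, smul_ξ₂, smul_ξ₃, smul_x₁, smul_x₂, smul_x₃, add_ξ₁, add_ξ₂,
    add_ξ₃, add_x₁, add_x₂, add_x₃, smul_add]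
  add_smul c d X := by
    ext1 <;> simp only [smul_ξ₁, smul_ξ₂, smul_ξ₃, smul_x₁, smul_x₂, smul_x₃, add_ξ₁, add_ξ₂,
    add_ξ₃, add_x₁, add_x₂, add_x₃, add_smul]
  zero_smul X := by
    ext1 <;> simp only [smul_ξ₁, smul_ξ₂, smul_ξ₃, smul_x₁, smul_x₂, smul_x₃, zero_ξ₁,
    zero_ξ₂, zero_ξ₃, zero_x₁, zero_x₂, zero_x₃, zero_smul]

/-- The Hermitian matrix of an element of `𝔍^C`. -/
def toMat : J →ₗ[ℂ] Matrix (Fin 3) (Fin 3) Oct where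
  toFun X := !![X.ξ₁ • Oct.one, X.x₃, Oct.bar X.x₂;
                Oct.bar X.x₃, X.ξ₂ • Oct.one, X.x₁;
                X.x₂, Oct.bar X.x₁, X.ξ₃ • Oct.one]
  map_add' X Y := by
    refine Matrix.ext fun i j => ?_
    fin_cases i <;> fin_cases j <;> simp [add_smul]
  map_smul' c X := by
    refine Matrix.ext fun i j => ?_
    fin_cases i <;> fin_cases j <;> simp [mul_smul]

/-- Reading off the coordinates `ξ₁, ξ₂, ξ₃, x₁, x₂, x₃` of a Hermitian matrix. -/
def ofMat : Matrix (Fin 3) (Fin 3) Oct →ₗ[ℂ] J where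
  toFun M := ⟨Oct.re (M 0 0), Oct.re (M 1 1), Oct.re (M 2 2), M 1 2, M 2 0, M 0 1⟩
  map_add' M N := by ext1 <;> simp
  map_smul' c M := by ext1 <;> simp

/-- The Jordan product `X ∘ Y = (XY + YX)/2`. -/
def jordan : J →ₗ[ℂ] J →ₗ[ℂ] J :=
  LinearMap.mk₂ ℂ (fun X Y => ofMat ((1 / 2 : ℂ) • (toMat X * toMat Y + toMat Y * toMat X)))
    (fun X Y Z => by
      rw [← map_add, ← smul_add, map_add, add_mul, mul_add]; congr 2; abel)
    (fun c X Y => by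
      rw [← map_smul ofMat, smul_comm c, map_smul toMat, Matrix.smul_mul, Matrix.mul_smul, ← smul_add])
    (fun X Y Z => by
      rw [← map_add, ← smul_add, map_add, add_mul, mul_add]; congr 2; abel)
    (fun c X Y => by
      rw [← map_smul ofMat, smul_comm c, map_smul toMat, Matrix.smul_mul, Matrix.mul_smul, ← smul_add])

/-- The trace `tr X = ξ₁ + ξ₂ + ξ₃`. -/
def tr : J →ₗ[ℂ] ℂ where
  toFun X := X.ξ₁ + X.ξ₂ + X.ξ₃
  map_add' X Y := by simp; ring
  map_smul' c X := by simp; ring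

/-- The inner product `(X, Y) = tr (X ∘ Y)`. -/
def form : LinearMap.BilinForm ℂ J := jordan.compr₂ tr

/-- The unit matrix `E`. -/
def E : J := ⟨1, 1, 1, 0, 0, 0⟩

def E1 : J := ⟨1, 0, 0, 0, 0, 0⟩

def E2 : J := ⟨0, 1, 0, 0, 0, 0⟩

def E3 : J := ⟨0, 0, 1, 0, 0, 0⟩

def F1 (x : Oct) : J := ⟨0, 0, 0, x, 0, 0⟩

/-- The Freudenthal product
`X × Y = (2 X ∘ Y - tr(X) Y - tr(Y) X + (tr(X) tr(Y) - (X, Y)) E) / 2`. -/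
def cross : J →ₗ[ℂ] J →ₗ[ℂ] J :=
  LinearMap.mk₂ ℂ (fun X Y => (1 / 2 : ℂ) •
      ((2 : ℂ) • jordan X Y - tr X • Y - tr Y • X + (tr X * tr Y - form X Y) • E))
    (fun X Y Z => by simp only [map_add, LinearMap.add_apply]; module)
    (fun c X Y => by simp only [map_smul, LinearMap.smul_apply, smul_eq_mul]; module)
    (fun X Y Z => by simp only [map_add]; module)
    (fun c X Y => by simp only [map_smul, smul_eq_mul]; module)

/-- The complex conjugation `τ` of `𝔍^C`. -/
def tau : J →ₛₗ[starRingEnd ℂ] J where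
  toFun X := ⟨star X.ξ₁, star X.ξ₂, star X.ξ₃, Oct.tau X.x₁, Oct.tau X.x₂, Oct.tau X.x₃⟩
  map_add' X Y := by ext1 <;> simp
  map_smul' c X := by ext1 <;> simp

/-- The transformation `σ'₄` of `𝔍^C`. -/
def sigma : J ≃ₗ[ℂ] J where
  toFun X := ⟨X.ξ₁, X.ξ₂, X.ξ₃, -(Oct.e1 * X.x₁ * Oct.e1), Oct.e1 * X.x₂, -(X.x₃ * Oct.e1)⟩
  invFun X := ⟨X.ξ₁, X.ξ₂, X.ξ₃, -(Oct.e1 * X.x₁ * Oct.e1), -(Oct.e1 * X.x₂), X.x₃ * Oct.e1⟩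
  map_add' X Y := by
    ext1 <;> simp only [add_ξ₁, add_ξ₂, add_ξ₃, add_x₁, add_x₂, add_x₃, mul_add, add_mul, neg_add]
  map_smul' c X := by
    ext1 <;> simp [mul_smul_comm, smul_mul_assoc]
  left_inv X := by
    ext1 <;> try rfl
    all_goals ext1 <;> simp [Oct.e1]
  right_inv X := by
    ext1 <;> try rfl
    all_goals ext1 <;> simp [Oct.e1]

theorem form_apply (X Y : J) : form X Y =
    X.ξ₁ * Y.ξ₁ + X.ξ₂ * Y.ξ₂ + X.ξ₃ * Y.ξ₃ + 2 * (Oct.re (X.x₁ * Oct.bar Y.x₁) +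
      Oct.re (X.x₂ * Oct.bar Y.x₂) + Oct.re (X.x₃ * Oct.bar Y.x₃)) := by
  simp [form, jordan, tr, ofMat, toMat, Oct.re, Oct.bar, Oct.one]
  ring

theorem form_nondegenerate : form.Nondegenerate := by
  have key : ∀ X : J, (∀ Y, form X Y = 0) → X = 0 := by
    intro X h
    have h₁ := h ⟨1, 0, 0, 0, 0, 0⟩
    have h₂ := h ⟨0, 1, 0, 0, 0, 0⟩
    have h₃ := h ⟨0, 0, 1, 0, 0, 0⟩
    have a₁ := fun y => h ⟨0, 0, 0, y, 0, 0⟩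
    have a₂ := fun y => h ⟨0, 0, 0, 0, y, 0⟩
    have a₃ := fun y => h ⟨0, 0, 0, 0, 0, y⟩
    simp only [form_apply] at h₁ h₂ h₃ a₁ a₂ a₃
    have oz : ∀ x : Oct, (∀ y, Oct.re (x * Oct.bar y) = 0) → x = 0 := by
      intro x hx
      ext1
      · simpa [Oct.re, Oct.bar] using hx ⟨1, 0, 0, 0, 0, 0, 0, 0⟩
      · simpa [Oct.re, Oct.bar] using hx ⟨0, 1, 0, 0, 0, 0, 0, 0⟩
      · simpa [Oct.re, Oct.bar] using hx ⟨0, 0, 1, 0, 0, 0, 0, 0⟩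
      · simpa [Oct.re, Oct.bar] using hx ⟨0, 0, 0, 1, 0, 0, 0, 0⟩
      · simpa [Oct.re, Oct.bar] using hx ⟨0, 0, 0, 0, 1, 0, 0, 0⟩
      · simpa [Oct.re, Oct.bar] using hx ⟨0, 0, 0, 0, 0, 1, 0, 0⟩
      · simpa [Oct.re, Oct.bar] using hx ⟨0, 0, 0, 0, 0, 0, 1, 0⟩
      · simpa [Oct.re, Oct.bar] using hx ⟨0, 0, 0, 0, 0, 0, 0, 1⟩
    ext1
    · simpa using h₁
    · simpa using h₂
    · simpa using h₃
    · exact oz _ fun y => by simpa using a₁ y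
    · exact oz _ fun y => by simpa using a₂ y
    · exact oz _ fun y => by simpa using a₃ y
  have symm : ∀ X Y, form X Y = form Y X := by
    intro X Y
    simp only [form, jordan, LinearMap.compr₂_apply, LinearMap.mk₂_apply, add_comm]
  exact ⟨key, fun X h => key X fun Y => by rw [symm]; exact h Y⟩

instance : FiniteDimensional ℂ J := by
  have ho : FiniteDimensional ℂ Oct := by
    let f : Oct →ₗ[ℂ] (Fin 8 → ℂ) :=
      { toFun := fun x => ![x.c0, x.c1, x.c2, x.c3, x.c4, x.c5, x.c6, x.c7]
        map_add' := fun x y => by ext i; fin_cases i <;> rfl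
        map_smul' := fun c x => by ext i; fin_cases i <;> rfl }
    refine FiniteDimensional.of_injective f fun x y h => ?_
    ext1
    exacts [congrFun h 0, congrFun h 1, congrFun h 2, congrFun h 3, congrFun h 4, congrFun h 5,
      congrFun h 6, congrFun h 7]
  let g : J →ₗ[ℂ] (ℂ × ℂ × ℂ × Oct × Oct × Oct) :=
    { toFun := fun X => (X.ξ₁, X.ξ₂, X.ξ₃, X.x₁, X.x₂, X.x₃)
      map_add' := fun _ _ => rfl
      map_smul' := fun _ _ => rfl }
  refine FiniteDimensional.of_injective g fun X Y h => ?_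
  simp only [g, LinearMap.coe_mk, AddHom.coe_mk, Prod.mk.injEq] at h
  obtain ⟨h₁, h₂, h₃, h₄, h₅, h₆⟩ := h
  ext1 <;> assumption

/-- The transpose `ᵗφ` of an endomorphism of `𝔍^C` with respect to `(X, Y)`. -/
def transpose (φ : Module.End ℂ J) : Module.End ℂ J :=
  form.leftAdjointOfNondegenerate form_nondegenerate φ

theorem transpose_unique {φ ψ : Module.End ℂ J} (h : ∀ X Y, form (ψ X) Y = form X (φ Y)) :
    transpose φ = ψ :=
  ((form.isAdjointPair_iff_eq_of_nondegenerate form_nondegenerate ψ φ).1 h).symm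

theorem form_transpose (φ : Module.End ℂ J) (X Y : J) :
    form (transpose φ X) Y = form X (φ Y) :=
  form.isAdjointPairLeftAdjointOfNondegenerate form_nondegenerate φ X Y

theorem transpose_add (φ ψ : Module.End ℂ J) :
    transpose (φ + ψ) = transpose φ + transpose ψ :=
  transpose_unique fun X Y => by
    simp only [LinearMap.add_apply, map_add, form_transpose]

theorem transpose_smul (c : ℂ) (φ : Module.End ℂ J) : transpose (c • φ) = c • transpose φ :=
  transpose_unique fun X Y => by
    simp only [LinearMap.smul_apply, map_smul, form_transpose]

/-- The derivation algebra of the Jordan algebra `𝔍^C`, that is, the Lie algebra `𝔣₄^C`. -/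
def f4 : Submodule ℂ (Module.End ℂ J) where
  carrier := {δ | ∀ X Y, δ (jordan X Y) = jordan (δ X) Y + jordan X (δ Y)}
  zero_mem' X Y := by simp
  add_mem' {δ ε} hδ hε X Y := by
    simp only [LinearMap.add_apply, hδ X Y, hε X Y, map_add]; abel
  smul_mem' c δ hδ X Y := by
    simp only [LinearMap.smul_apply, hδ X Y, map_smul, smul_add]

/-- `𝔢₆^C = {δ + T̃ | δ ∈ 𝔣₄^C, T ∈ 𝔍^C, tr T = 0}`, where `T̃ X = T ∘ X`. -/
def e6 : Submodule ℂ (Module.End ℂ J) := f4 ⊔ (LinearMap.ker tr).map jordan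

/-- `X ∨ W = [X̃, W̃] + (X ∘ W - (1/3)(X, W) E)^~`. -/
def vee (X W : J) : Module.End ℂ J :=
  (jordan X * jordan W - jordan W * jordan X) + jordan (jordan X W - (1 / 3 * form X W) • E)

/-- The mapping `Ã₁(a) X = (1/2)(A₁(a) X - X A₁(a))`, where `A₁(a)` is the skew-Hermitian matrix
with `a` at the place `(2, 3)`, `-ā` at the place `(3, 2)`, and all other entries `0`. -/
def tildeA1 (a : Oct) : Module.End ℂ J where
  toFun X := ofMat ((1 / 2 : ℂ) • (!![0, 0, 0; 0, 0, a; 0, -Oct.bar a, 0] * toMat X -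
    toMat X * !![0, 0, 0; 0, 0, a; 0, -Oct.bar a, 0]))
  map_add' X Y := by
    rw [← map_add, ← smul_add, map_add, add_mul, mul_add]; congr 2; abel
  map_smul' c X := by
    rw [RingHom.id_apply, ← map_smul ofMat, smul_comm c, map_smul toMat, Matrix.smul_mul,
      Matrix.mul_smul, ← smul_sub]

/-- The complex Lie algebra `𝔰𝔬(6, C) ≅ (𝔣₄^C)_{E₁, E₂, E₃, F₁(e_k), k = 0, 1}`. -/
def so6C : Set (Module.End ℂ J) :=
  {D | D ∈ f4 ∧ D E1 = 0 ∧ D E2 = 0 ∧ D E3 = 0 ∧ D (F1 Oct.one) = 0 ∧ D (F1 Oct.e1) = 0}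

/-- The compact real form `𝔰𝔬(6)` of `so6C`: its elements that commute with `τ`. -/
def so6 : Set (Module.End ℂ J) := {D | D ∈ so6C ∧ ∀ X, D (tau X) = tau (D X)}

end J

/-- The Freudenthal vector space `𝔓^C = 𝔍^C ⊕ 𝔍^C ⊕ C ⊕ C`. -/
@[ext] structure FP where
  X : J
  Y : J
  ξ : ℂ
  η : ℂ

namespace FP

open J

instance : Zero FP := ⟨⟨0, 0, 0, 0⟩⟩
instance : Add FP := ⟨fun X Y => ⟨X.X + Y.X, X.Y + Y.Y, X.ξ + Y.ξ, X.η + Y.η⟩⟩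
instance : Neg FP := ⟨fun X => ⟨-X.X, -X.Y, -X.ξ, -X.η⟩⟩
instance : SMul ℂ FP := ⟨fun c X => ⟨c • X.X, c • X.Y, c • X.ξ, c • X.η⟩⟩

@[simp] theorem zero_X : (0 : FP).X = 0 := rfl
@[simp] theorem add_X (X Y : FP) : (X + Y).X = X.X + Y.X := rfl
@[simp] theorem neg_X (X : FP) : (-X).X = -X.X := rfl
@[simp] theorem smul_X (c : ℂ) (X : FP) : (c • X).X = c • X.X := rfl
@[simp] theorem zero_Y : (0 : FP).Y = 0 := rfl
@[simp] theorem add_Y (X Y : FP) : (X + Y).Y = X.Y + Y.Y := rfl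
@[simp] theorem neg_Y (X : FP) : (-X).Y = -X.Y := rfl
@[simp] theorem smul_Y (c : ℂ) (X : FP) : (c • X).Y = c • X.Y := rfl
@[simp] theorem zero_ξ : (0 : FP).ξ = 0 := rfl
@[simp] theorem add_ξ (X Y : FP) : (X + Y).ξ = X.ξ + Y.ξ := rfl
@[simp] theorem neg_ξ (X : FP) : (-X).ξ = -X.ξ := rfl
@[simp] theorem smul_ξ (c : ℂ) (X : FP) : (c • X).ξ = c • X.ξ := rfl
@[simp] theorem zero_η : (0 : FP).η = 0 := rfl
@[simp] theorem add_η (X Y : FP) : (X + Y).η = X.η + Y.η := rfl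
@[simp] theorem neg_η (X : FP) : (-X).η = -X.η := rfl
@[simp] theorem smul_η (c : ℂ) (X : FP) : (c • X).η = c • X.η := rfl

instance : AddCommGroup FP where
  add_assoc X Y Z := by ext1 <;> simp only [add_X, add_Y, add_ξ, add_η, add_assoc]
  zero_add X := by ext1 <;> simp only [add_X, zero_X, add_Y, zero_Y, add_ξ, zero_ξ, add_η, zero_η, zero_add]
  add_zero X := by ext1 <;> simp only [add_X, zero_X, add_Y, zero_Y, add_ξ, zero_ξ, add_η, zero_η, add_zero]
  neg_add_cancel X := by
    ext1 <;> simp only [add_X, zero_X, neg_X, add_Y, zero_Y, neg_Y, add_ξ, zero_ξ, neg_ξ, add_η, zero_η, neg_η, neg_add_cancel]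
  add_comm X Y := by ext1 <;> simp only [add_X, add_Y, add_ξ, add_η, add_comm]
  nsmul := nsmulRec
  zsmul := zsmulRec

@[simp] theorem sub_X (X Y : FP) : (X - Y).X = X.X - Y.X := by
  rw [sub_eq_add_neg, add_X, neg_X, ← sub_eq_add_neg]
@[simp] theorem sub_Y (X Y : FP) : (X - Y).Y = X.Y - Y.Y := by
  rw [sub_eq_add_neg, add_Y, neg_Y, ← sub_eq_add_neg]
@[simp] theorem sub_ξ (X Y : FP) : (X - Y).ξ = X.ξ - Y.ξ := by
  rw [sub_eq_add_neg, add_ξ, neg_ξ, ← sub_eq_add_neg]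
@[simp] theorem sub_η (X Y : FP) : (X - Y).η = X.η - Y.η := by
  rw [sub_eq_add_neg, add_η, neg_η, ← sub_eq_add_neg]

instance : Module ℂ FP where
  one_smul X := by
    ext1 <;> simp only [smul_X, smul_Y, smul_ξ, smul_η, one_smul]
  mul_smul c d X := by
    ext1 <;> simp only [smul_X, smul_Y, smul_ξ, smul_η, mul_smul]
  smul_zero c := by
    ext1 <;> simp only [smul_X, smul_Y, smul_ξ, smul_η, zero_X, zero_Y, zero_ξ, zero_η,
    smul_zero]
  smul_add c X Y := by
    ext1 <;> simp only [smul_X, smul_Y, smul_ξ, smul_η, add_X, add_Y, add_ξ, add_η, smul_add]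
  add_smul c d X := by
    ext1 <;> simp only [smul_X, smul_Y, smul_ξ, smul_η, add_X, add_Y, add_ξ, add_η, add_smul]
  zero_smul X := by
    ext1 <;> simp only [smul_X, smul_Y, smul_ξ, smul_η, zero_X, zero_Y, zero_ξ, zero_η,
    zero_smul]

/-- The alternating inner product `{P, Q} = (X, W) - (Z, Y) + ξ ω - ζ η` of `P = (X, Y, ξ, η)` and
`Q = (Z, W, ζ, ω)`. -/
def skew (R S : FP) : ℂ := form R.X S.Y - form S.X R.Y + R.ξ * S.η - S.ξ * R.η

/-- The complex conjugation `τ` of `𝔓^C`. -/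
def tau : FP →ₛₗ[starRingEnd ℂ] FP where
  toFun R := ⟨J.tau R.X, J.tau R.Y, star R.ξ, star R.η⟩
  map_add' R S := by ext1 <;> simp
  map_smul' c R := by
    ext1
    · exact map_smulₛₗ J.tau c R.X
    · exact map_smulₛₗ J.tau c R.Y
    · simp
    · simp

/-- `λ(X, Y, ξ, η) = (Y, -X, η, -ξ)`. -/
def lam : FP ≃ₗ[ℂ] FP where
  toFun R := ⟨R.Y, -R.X, R.η, -R.ξ⟩
  invFun R := ⟨-R.Y, R.X, -R.η, R.ξ⟩
  map_add' R S := by ext1 <;> simp [add_comm]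
  map_smul' c R := by ext1 <;> simp
  left_inv R := by ext1 <;> simp
  right_inv R := by ext1 <;> simp

/-- `σ'₄(X, Y, ξ, η) = (σ'₄ X, σ'₄ Y, ξ, η)`. -/
def sigma : FP ≃ₗ[ℂ] FP where
  toFun R := ⟨J.sigma R.X, J.sigma R.Y, R.ξ, R.η⟩
  invFun R := ⟨J.sigma.symm R.X, J.sigma.symm R.Y, R.ξ, R.η⟩
  map_add' R S := by ext1 <;> simp
  map_smul' c R := by
    ext1
    · exact map_smul J.sigma c R.X
    · exact map_smul J.sigma c R.Y
    · rfl
    · rfl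
  left_inv R := by ext1 <;> simp
  right_inv R := by ext1 <;> simp

/-- The endomorphism `Φ(φ, A, B, ν)` of `𝔓^C`. -/
def Phi (φ : Module.End ℂ J) (A B : J) (ν : ℂ) : Module.End ℂ FP where
  toFun R :=
    ⟨φ R.X - (1 / 3 * ν) • R.X + (2 : ℂ) • cross B R.Y + R.η • A,
      (2 : ℂ) • cross A R.X - transpose φ R.Y + (1 / 3 * ν) • R.Y + R.ξ • B,
      form A R.Y + ν * R.ξ,
      form B R.X - ν * R.η⟩
  map_add' R S := by
    ext1
    · simp only [add_X, add_Y, add_η, map_add]; module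
    · simp only [add_X, add_Y, add_ξ, map_add]; module
    · simp only [add_Y, add_ξ, map_add]; ring
    · simp only [add_X, add_η, map_add]; ring
  map_smul' c R := by
    ext1
    · simp only [smul_X, smul_Y, smul_η, map_smul, RingHom.id_apply, smul_eq_mul]; module
    · simp only [smul_X, smul_Y, smul_ξ, map_smul, RingHom.id_apply, smul_eq_mul]; module
    · simp only [smul_Y, smul_ξ, map_smul, RingHom.id_apply, smul_eq_mul]; ring
    · simp only [smul_X, smul_η, map_smul, RingHom.id_apply, smul_eq_mul]; ring

/-- The Freudenthal cross operation `P × Q = Φ(φ, A, B, ν)`. -/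
def cr (R S : FP) : Module.End ℂ FP :=
  Phi (-(1 / 2 : ℂ) • (vee R.X S.Y + vee S.X R.Y))
    (-(1 / 4 : ℂ) • ((2 : ℂ) • cross R.Y S.Y - R.ξ • S.X - S.ξ • R.X))
    ((1 / 4 : ℂ) • ((2 : ℂ) • cross R.X S.X - R.η • S.Y - S.η • R.Y))
    (1 / 8 * (form R.X S.Y + form S.X R.Y - 3 * (R.ξ * S.η + S.ξ * R.η)))

theorem Phi_add (φ φ' : Module.End ℂ J) (A A' B B' : J) (ν ν' : ℂ) :
    Phi (φ + φ') (A + A') (B + B') (ν + ν') = Phi φ A B ν + Phi φ' A' B' ν' := by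
  refine LinearMap.ext fun R => ?_
  ext1
  · simp only [Phi, LinearMap.coe_mk, AddHom.coe_mk, LinearMap.add_apply, add_X, map_add]; module
  · simp only [Phi, LinearMap.coe_mk, AddHom.coe_mk, LinearMap.add_apply, add_Y, map_add,
      transpose_add]; module
  · simp only [Phi, LinearMap.coe_mk, AddHom.coe_mk, LinearMap.add_apply, add_ξ, map_add]; ring
  · simp only [Phi, LinearMap.coe_mk, AddHom.coe_mk, LinearMap.add_apply, add_η, map_add]; ring

theorem Phi_smul (c : ℂ) (φ : Module.End ℂ J) (A B : J) (ν : ℂ) :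
    Phi (c • φ) (c • A) (c • B) (c * ν) = c • Phi φ A B ν := by
  refine LinearMap.ext fun R => ?_
  ext1
  · simp only [Phi, LinearMap.coe_mk, AddHom.coe_mk, LinearMap.smul_apply, smul_X, map_smul]; module
  · simp only [Phi, LinearMap.coe_mk, AddHom.coe_mk, LinearMap.smul_apply, smul_Y, map_smul,
      transpose_smul]; module
  · simp only [Phi, LinearMap.coe_mk, AddHom.coe_mk, LinearMap.smul_apply, smul_ξ, map_smul,
      smul_eq_mul]; ring
  · simp only [Phi, LinearMap.coe_mk, AddHom.coe_mk, LinearMap.smul_apply, smul_η, map_smul,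
      smul_eq_mul]; ring

/-- `𝔢₇^C = {Φ(φ, A, B, ν) | φ ∈ 𝔢₆^C, A, B ∈ 𝔍^C, ν ∈ C}`. -/
def e7 : Submodule ℂ (Module.End ℂ FP) where
  carrier := {Φ | ∃ φ ∈ e6, ∃ A B ν, Φ = Phi φ A B ν}
  zero_mem' := ⟨0, zero_mem _, 0, 0, 0, by
    have h := Phi_smul 0 0 0 0 0
    rw [zero_smul, zero_smul, zero_smul, zero_mul] at h
    exact h.symm⟩
  add_mem' := by
    rintro _ _ ⟨φ, hφ, A, B, ν, rfl⟩ ⟨φ', hφ', A', B', ν', rfl⟩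
    exact ⟨_, add_mem hφ hφ', _, _, _, (Phi_add φ φ' A A' B B' ν ν').symm⟩
  smul_mem' := by
    rintro c _ ⟨φ, hφ, A, B, ν, rfl⟩
    exact ⟨_, Submodule.smul_mem _ c hφ, _, _, _, (Phi_smul c φ A B ν).symm⟩

end FP

/-- Tuples `(Φ, P, Q, r, s, t)` with `Φ` any endomorphism of `𝔓^C`; those with `Φ ∈ 𝔢₇^C` form
`𝔢₈^C`, see `E8.e8C`. -/
@[ext] structure E8 where
  Φ : Module.End ℂ FP
  P : FP
  Q : FP
  r : ℂ
  s : ℂ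
  t : ℂ

namespace E8

open J FP

instance : Zero E8 := ⟨⟨0, 0, 0, 0, 0, 0⟩⟩
instance : Add E8 := ⟨fun X Y => ⟨X.Φ + Y.Φ, X.P + Y.P, X.Q + Y.Q, X.r + Y.r, X.s + Y.s, X.t + Y.t⟩⟩
instance : Neg E8 := ⟨fun X => ⟨-X.Φ, -X.P, -X.Q, -X.r, -X.s, -X.t⟩⟩
instance : SMul ℂ E8 := ⟨fun c X => ⟨c • X.Φ, c • X.P, c • X.Q, c • X.r, c • X.s, c • X.t⟩⟩

@[simp] theorem zero_Φ : (0 : E8).Φ = 0 := rfl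
@[simp] theorem add_Φ (X Y : E8) : (X + Y).Φ = X.Φ + Y.Φ := rfl
@[simp] theorem neg_Φ (X : E8) : (-X).Φ = -X.Φ := rfl
@[simp] theorem smul_Φ (c : ℂ) (X : E8) : (c • X).Φ = c • X.Φ := rfl
@[simp] theorem zero_P : (0 : E8).P = 0 := rfl
@[simp] theorem add_P (X Y : E8) : (X + Y).P = X.P + Y.P := rfl
@[simp] theorem neg_P (X : E8) : (-X).P = -X.P := rfl
@[simp] theorem smul_P (c : ℂ) (X : E8) : (c • X).P = c • X.P := rfl
@[simp] theorem zero_Q : (0 : E8).Q = 0 := rfl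
@[simp] theorem add_Q (X Y : E8) : (X + Y).Q = X.Q + Y.Q := rfl
@[simp] theorem neg_Q (X : E8) : (-X).Q = -X.Q := rfl
@[simp] theorem smul_Q (c : ℂ) (X : E8) : (c • X).Q = c • X.Q := rfl
@[simp] theorem zero_r : (0 : E8).r = 0 := rfl
@[simp] theorem add_r (X Y : E8) : (X + Y).r = X.r + Y.r := rfl
@[simp] theorem neg_r (X : E8) : (-X).r = -X.r := rfl
@[simp] theorem smul_r (c : ℂ) (X : E8) : (c • X).r = c • X.r := rfl
@[simp] theorem zero_s : (0 : E8).s = 0 := rfl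
@[simp] theorem add_s (X Y : E8) : (X + Y).s = X.s + Y.s := rfl
@[simp] theorem neg_s (X : E8) : (-X).s = -X.s := rfl
@[simp] theorem smul_s (c : ℂ) (X : E8) : (c • X).s = c • X.s := rfl
@[simp] theorem zero_t : (0 : E8).t = 0 := rfl
@[simp] theorem add_t (X Y : E8) : (X + Y).t = X.t + Y.t := rfl
@[simp] theorem neg_t (X : E8) : (-X).t = -X.t := rfl
@[simp] theorem smul_t (c : ℂ) (X : E8) : (c • X).t = c • X.t := rfl

instance : AddCommGroup E8 where
  add_assoc X Y Z := by ext1 <;> simp only [add_Φ, add_P, add_Q, add_r, add_s, add_t, add_assoc]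
  zero_add X := by ext1 <;> simp only [add_Φ, zero_Φ, add_P, zero_P, add_Q, zero_Q, add_r, zero_r, add_s, zero_s, add_t, zero_t, zero_add]
  add_zero X := by ext1 <;> simp only [add_Φ, zero_Φ, add_P, zero_P, add_Q, zero_Q, add_r, zero_r, add_s, zero_s, add_t, zero_t, add_zero]
  neg_add_cancel X := by
    ext1 <;> simp only [add_Φ, zero_Φ, neg_Φ, add_P, zero_P, neg_P, add_Q, zero_Q, neg_Q, add_r, zero_r, neg_r, add_s, zero_s, neg_s, add_t, zero_t, neg_t, neg_add_cancel]
  add_comm X Y := by ext1 <;> simp only [add_Φ, add_P, add_Q, add_r, add_s, add_t, add_comm]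
  nsmul := nsmulRec
  zsmul := zsmulRec

@[simp] theorem sub_Φ (X Y : E8) : (X - Y).Φ = X.Φ - Y.Φ := by
  rw [sub_eq_add_neg, add_Φ, neg_Φ, ← sub_eq_add_neg]
@[simp] theorem sub_P (X Y : E8) : (X - Y).P = X.P - Y.P := by
  rw [sub_eq_add_neg, add_P, neg_P, ← sub_eq_add_neg]
@[simp] theorem sub_Q (X Y : E8) : (X - Y).Q = X.Q - Y.Q := by
  rw [sub_eq_add_neg, add_Q, neg_Q, ← sub_eq_add_neg]
@[simp] theorem sub_r (X Y : E8) : (X - Y).r = X.r - Y.r := by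
  rw [sub_eq_add_neg, add_r, neg_r, ← sub_eq_add_neg]
@[simp] theorem sub_s (X Y : E8) : (X - Y).s = X.s - Y.s := by
  rw [sub_eq_add_neg, add_s, neg_s, ← sub_eq_add_neg]
@[simp] theorem sub_t (X Y : E8) : (X - Y).t = X.t - Y.t := by
  rw [sub_eq_add_neg, add_t, neg_t, ← sub_eq_add_neg]

instance : Module ℂ E8 where
  one_smul X := by
    ext1 <;> simp only [smul_Φ, smul_P, smul_Q, smul_r, smul_s, smul_t, one_smul]
  mul_smul c d X := by
    ext1 <;> simp only [smul_Φ, smul_P, smul_Q, smul_r, smul_s, smul_t, mul_smul]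
  smul_zero c := by
    ext1 <;> simp only [smul_Φ, smul_P, smul_Q, smul_r, smul_s, smul_t, zero_Φ, zero_P,
    zero_Q, zero_r, zero_s, zero_t, smul_zero]
  smul_add c X Y := by
    ext1 <;> simp only [smul_Φ, smul_P, smul_Q, smul_r, smul_s, smul_t, add_Φ, add_P, add_Q,
    add_r, add_s, add_t, smul_add]
  add_smul c d X := by
    ext1 <;> simp only [smul_Φ, smul_P, smul_Q, smul_r, smul_s, smul_t, add_Φ, add_P, add_Q,
    add_r, add_s, add_t, add_smul]
  zero_smul X := by
    ext1 <;> simp only [smul_Φ, smul_P, smul_Q, smul_r, smul_s, smul_t, zero_Φ, zero_P,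
    zero_Q, zero_r, zero_s, zero_t, zero_smul]

/-- The vector space `𝔢₈^C = 𝔢₇^C ⊕ 𝔓^C ⊕ 𝔓^C ⊕ C ⊕ C ⊕ C`. -/
def e8C : Submodule ℂ E8 where
  carrier := {R | R.Φ ∈ e7}
  zero_mem' := zero_mem e7
  add_mem' h h' := e7.add_mem h h'
  smul_mem' c _ h := e7.smul_mem c h

/-- The Lie bracket of `𝔢₈^C`. -/
def bracket (R₁ R₂ : E8) : E8 where
  Φ := R₁.Φ * R₂.Φ - R₂.Φ * R₁.Φ + cr R₁.P R₂.Q - cr R₂.P R₁.Q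
  P := R₁.Φ R₂.P - R₂.Φ R₁.P + R₁.r • R₂.P - R₂.r • R₁.P + R₁.s • R₂.Q - R₂.s • R₁.Q
  Q := R₁.Φ R₂.Q - R₂.Φ R₁.Q - R₁.r • R₂.Q + R₂.r • R₁.Q + R₁.t • R₂.P - R₂.t • R₁.P
  r := -(1 / 8) * skew R₁.P R₂.Q + 1 / 8 * skew R₂.P R₁.Q + R₁.s * R₂.t - R₂.s * R₁.t
  s := 1 / 4 * skew R₁.P R₂.P + 2 * R₁.r * R₂.s - 2 * R₂.r * R₁.s
  t := -(1 / 4) * skew R₁.Q R₂.Q - 2 * R₁.r * R₂.t + 2 * R₂.r * R₁.t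

/-- `σ'₄(Φ, P, Q, r, s, t) = (σ'₄ Φ σ'₄⁻¹, σ'₄ P, σ'₄ Q, r, s, t)`. -/
def sigma (R : E8) : E8 :=
  ⟨FP.sigma.conj R.Φ, FP.sigma R.P, FP.sigma R.Q, R.r, R.s, R.t⟩

/-- `λ_ω(Φ, P, Q, r, s, t) = (λ Φ λ⁻¹, λ Q, -λ P, -r, -t, -s)`. -/
def lamOmega (R : E8) : E8 := ⟨lam.conj R.Φ, lam R.Q, -lam R.P, -R.r, -R.t, -R.s⟩

/-- `τ(Φ, P, Q, r, s, t) = (τ Φ τ, τ P, τ Q, τ r, τ s, τ t)`. -/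
def tau (R : E8) : E8 :=
  ⟨FP.tau.comp (R.Φ.comp FP.tau), FP.tau R.P, FP.tau R.Q, star R.r, star R.s, star R.t⟩

/-- The element `R_D = (Φ(D, 0, 0, 0), 0, 0, 0, 0, 0)`. -/
def RD (D : Module.End ℂ J) : E8 := ⟨Phi D 0 0 0, 0, 0, 0, 0, 0⟩

theorem bracket_RD (R : E8) (D : Module.End ℂ J) :
    bracket R (RD D) = ⟨R.Φ * Phi D 0 0 0 - Phi D 0 0 0 * R.Φ,
      -Phi D 0 0 0 R.P, -Phi D 0 0 0 R.Q, 0, 0, 0⟩ := by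
  have z : Phi 0 0 0 0 = 0 := by
    have h := Phi_smul 0 0 0 0 0
    rw [zero_smul, zero_smul, zero_mul, zero_smul] at h
    exact h
  ext1 <;> simp [bracket, RD, skew, cr, vee, z]

theorem bracket_RD_add (R S : E8) (D : Module.End ℂ J) :
    bracket (R + S) (RD D) = bracket R (RD D) + bracket S (RD D) := by
  simp only [bracket_RD]
  ext1 <;> simp [add_comm, add_mul, mul_add]
  abel

theorem bracket_RD_smul (c : ℂ) (R : E8) (D : Module.End ℂ J) :
    bracket (c • R) (RD D) = c • bracket R (RD D) := by
  simp only [bracket_RD]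
  ext1 <;> simp [smul_sub]

theorem sigma_add (R S : E8) : sigma (R + S) = sigma R + sigma S := by
  ext1 <;> simp [sigma]

theorem sigma_smul (c : ℂ) (R : E8) : sigma (c • R) = c • sigma R := by
  ext1 <;> simp [sigma]

theorem tau_lamOmega_add (R S : E8) :
    tau (lamOmega (R + S)) = tau (lamOmega R) + tau (lamOmega S) := by
  ext1 <;> simp [tau, lamOmega, add_comm, LinearMap.comp_add, LinearMap.add_comp]

theorem tau_lamOmega_smulC (c : ℂ) (R : E8) :
    tau (lamOmega (c • R)) = star c • tau (lamOmega R) := by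
  ext1
  · refine LinearMap.ext fun S => ?_
    simp [tau, lamOmega]
  all_goals simp [tau, lamOmega]

theorem tau_lamOmega_smul (c : ℝ) (R : E8) :
    tau (lamOmega (c • R)) = c • tau (lamOmega R) :=
  (tau_lamOmega_smulC (c : ℂ) R).trans (by rw [Complex.star_def, Complex.conj_ofReal]; rfl)

/-- `(𝔢₈^C)^{σ'₄, 𝔰𝔬(6, C)}`: the `R ∈ 𝔢₈^C` with `σ'₄ R = R` and `[R, R_D] = 0` for all
`D ∈ 𝔰𝔬(6, C)`. -/
def e8CFixed : Submodule ℂ E8 where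
  carrier := {R | R ∈ e8C ∧ sigma R = R ∧ ∀ D ∈ so6C, bracket R (RD D) = 0}
  zero_mem' := by
    refine ⟨zero_mem _, ?_, fun D _ => ?_⟩
    · ext1 <;> simp [sigma]
    · rw [bracket_RD]; ext1 <;> simp
  add_mem' := by
    rintro R S ⟨h₁, h₂, h₃⟩ ⟨k₁, k₂, k₃⟩
    refine ⟨add_mem h₁ k₁, ?_, fun D hD => ?_⟩
    · rw [sigma_add, h₂, k₂]
    · rw [bracket_RD_add, h₃ D hD, k₃ D hD, add_zero]
  smul_mem' := by
    rintro c R ⟨h₁, h₂, h₃⟩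
    refine ⟨e8C.smul_mem c h₁, ?_, fun D hD => ?_⟩
    · rw [sigma_smul, h₂]
    · rw [bracket_RD_smul, h₃ D hD, smul_zero]

/-- The compact real form `𝔢₈ = {R ∈ 𝔢₈^C | τ λ_ω R = R}` of `𝔢₈^C`. -/
def e8 : Submodule ℝ E8 where
  carrier := {R | R ∈ e8C ∧ tau (lamOmega R) = R}
  zero_mem' := ⟨zero_mem _, by
    have h := tau_lamOmega_smul 0 0
    rwa [zero_smul, zero_smul] at h⟩
  add_mem' := by
    rintro R S ⟨h₁, h₂⟩ ⟨k₁, k₂⟩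
    exact ⟨add_mem h₁ k₁, by rw [tau_lamOmega_add, h₂, k₂]⟩
  smul_mem' := by
    rintro c R ⟨h₁, h₂⟩
    exact ⟨e8C.smul_mem (c : ℂ) h₁, by rw [tau_lamOmega_smul, h₂]⟩

/-- `(𝔢₈)^{σ'₄, 𝔰𝔬(6)}`: the `R ∈ 𝔢₈` with `σ'₄ R = R` and `[R, R_D] = 0` for all `D ∈ 𝔰𝔬(6)`. -/
def e8Fixed : Submodule ℝ E8 where
  carrier := {R | R ∈ e8 ∧ sigma R = R ∧ ∀ D ∈ so6, bracket R (RD D) = 0}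
  zero_mem' := by
    refine ⟨zero_mem _, ?_, fun D _ => ?_⟩
    · ext1 <;> simp [sigma]
    · rw [bracket_RD]; ext1 <;> simp
  add_mem' := by
    rintro R S ⟨h₁, h₂, h₃⟩ ⟨k₁, k₂, k₃⟩
    refine ⟨add_mem h₁ k₁, ?_, fun D hD => ?_⟩
    · rw [sigma_add, h₂, k₂]
    · rw [bracket_RD_add, h₃ D hD, k₃ D hD, add_zero]
  smul_mem' := by
    rintro c R ⟨h₁, h₂, h₃⟩
    refine ⟨e8.smul_mem c h₁, ?_, fun D hD => ?_⟩
    · exact (sigma_smul (c : ℂ) R).trans (congrArg _ h₂)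
    · exact (bracket_RD_smul (c : ℂ) R D).trans (by rw [h₃ D hD, smul_zero])

open Complex in
/-- The elements `R_{ij}`, `0 ≤ i < j ≤ 9`. -/
def R : ℕ → ℕ → E8
  | 0, 1 => ⟨Phi (jordan (-I • (E2 - E3))) 0 0 0, 0, 0, 0, 0, 0⟩
  | 0, 2 => ⟨Phi 0 ((-I / 2) • (E2 - E3)) ((-I / 2) • (E2 - E3)) 0, 0, 0, 0, 0, 0⟩
  | 1, 2 => ⟨Phi 0 ((1 / 2 : ℂ) • (E2 + E3)) ((-1 / 2 : ℂ) • (E2 + E3)) 0, 0, 0, 0, 0, 0⟩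
  | 0, 3 => ⟨Phi 0 ((-1 / 2 : ℂ) • (E2 - E3)) ((1 / 2 : ℂ) • (E2 - E3)) 0, 0, 0, 0, 0, 0⟩
  | 1, 3 => ⟨Phi 0 ((-I / 2) • (E2 + E3)) ((-I / 2) • (E2 + E3)) 0, 0, 0, 0, 0, 0⟩
  | 2, 3 => ⟨Phi (-I • vee E1 E1) 0 0 (I), 0, 0, 0, 0, 0⟩
  | 0, 4 => ⟨0, ⟨-(E2 - E3), 0, 0, 0⟩, ⟨0, -(E2 - E3), 0, 0⟩, 0, 0, 0⟩
  | 1, 4 => ⟨0, ⟨-I • (E2 + E3), 0, 0, 0⟩, ⟨0, I • (E2 + E3), 0, 0⟩, 0, 0, 0⟩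
  | 2, 4 => ⟨0, ⟨0, I • E1, 0, -I⟩, ⟨I • E1, 0, -I, 0⟩, 0, 0, 0⟩
  | 3, 4 => ⟨0, ⟨0, E1, 0, 1⟩, ⟨-E1, 0, -1, 0⟩, 0, 0, 0⟩
  | 0, 5 => ⟨0, ⟨-I • (E2 - E3), 0, 0, 0⟩, ⟨0, I • (E2 - E3), 0, 0⟩, 0, 0, 0⟩
  | 1, 5 => ⟨0, ⟨E2 + E3, 0, 0, 0⟩, ⟨0, E2 + E3, 0, 0⟩, 0, 0, 0⟩
  | 2, 5 => ⟨0, ⟨0, -E1, 0, 1⟩, ⟨E1, 0, -1, 0⟩, 0, 0, 0⟩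
  | 3, 5 => ⟨0, ⟨0, I • E1, 0, I⟩, ⟨I • E1, 0, I, 0⟩, 0, 0, 0⟩
  | 4, 5 => ⟨Phi (I • vee E1 E1) 0 0 (I / 2), 0, 0, -I / 2, 0, 0⟩
  | 0, 6 => ⟨0, ⟨0, -(E2 - E3), 0, 0⟩, ⟨E2 - E3, 0, 0, 0⟩, 0, 0, 0⟩
  | 1, 6 => ⟨0, ⟨0, I • (E2 + E3), 0, 0⟩, ⟨I • (E2 + E3), 0, 0, 0⟩, 0, 0, 0⟩
  | 2, 6 => ⟨0, ⟨I • E1, 0, -I, 0⟩, ⟨0, -I • E1, 0, I⟩, 0, 0, 0⟩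
  | 3, 6 => ⟨0, ⟨-E1, 0, -1, 0⟩, ⟨0, -E1, 0, -1⟩, 0, 0, 0⟩
  | 4, 6 => ⟨Phi 0 ((1 / 2 : ℂ) • E1) ((-1 / 2 : ℂ) • E1) 0, 0, 0, 0, -1 / 2, 1 / 2⟩
  | 5, 6 => ⟨Phi 0 ((-I / 2) • E1) ((-I / 2) • E1) 0, 0, 0, 0, -I / 2, -I / 2⟩
  | 0, 7 => ⟨0, ⟨0, -I • (E2 - E3), 0, 0⟩, ⟨-I • (E2 - E3), 0, 0, 0⟩, 0, 0, 0⟩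
  | 1, 7 => ⟨0, ⟨0, -(E2 + E3), 0, 0⟩, ⟨E2 + E3, 0, 0, 0⟩, 0, 0, 0⟩
  | 2, 7 => ⟨0, ⟨-E1, 0, 1, 0⟩, ⟨0, -E1, 0, 1⟩, 0, 0, 0⟩
  | 3, 7 => ⟨0, ⟨-I • E1, 0, -I, 0⟩, ⟨0, I • E1, 0, I⟩, 0, 0, 0⟩
  | 4, 7 => ⟨Phi 0 ((I / 2) • E1) ((I / 2) • E1) 0, 0, 0, 0, -I / 2, -I / 2⟩
  | 5, 7 => ⟨Phi 0 ((1 / 2 : ℂ) • E1) ((-1 / 2 : ℂ) • E1) 0, 0, 0, 0, 1 / 2, -1 / 2⟩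
  | 6, 7 => ⟨Phi (-I • vee E1 E1) 0 0 (-I / 2), 0, 0, -I / 2, 0, 0⟩
  | 0, 8 => ⟨Phi (-tildeA1 Oct.one) 0 0 0, 0, 0, 0, 0, 0⟩
  | 1, 8 => ⟨Phi (jordan (-I • F1 Oct.one)) 0 0 0, 0, 0, 0, 0, 0⟩
  | 2, 8 => ⟨Phi 0 ((-I / 2) • F1 Oct.one) ((-I / 2) • F1 Oct.one) 0, 0, 0, 0, 0, 0⟩
  | 3, 8 => ⟨Phi 0 ((-1 / 2 : ℂ) • F1 Oct.one) ((1 / 2 : ℂ) • F1 Oct.one) 0, 0, 0, 0, 0, 0⟩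
  | 4, 8 => ⟨0, ⟨-F1 Oct.one, 0, 0, 0⟩, ⟨0, -F1 Oct.one, 0, 0⟩, 0, 0, 0⟩
  | 5, 8 => ⟨0, ⟨-I • F1 Oct.one, 0, 0, 0⟩, ⟨0, I • F1 Oct.one, 0, 0⟩, 0, 0, 0⟩
  | 6, 8 => ⟨0, ⟨0, -F1 Oct.one, 0, 0⟩, ⟨F1 Oct.one, 0, 0, 0⟩, 0, 0, 0⟩
  | 7, 8 => ⟨0, ⟨0, -I • F1 Oct.one, 0, 0⟩, ⟨-I • F1 Oct.one, 0, 0, 0⟩, 0, 0, 0⟩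
  | 0, 9 => ⟨Phi (-tildeA1 Oct.e1) 0 0 0, 0, 0, 0, 0, 0⟩
  | 1, 9 => ⟨Phi (jordan (-I • F1 Oct.e1)) 0 0 0, 0, 0, 0, 0, 0⟩
  | 2, 9 => ⟨Phi 0 ((-I / 2) • F1 Oct.e1) ((-I / 2) • F1 Oct.e1) 0, 0, 0, 0, 0, 0⟩
  | 3, 9 => ⟨Phi 0 ((-1 / 2 : ℂ) • F1 Oct.e1) ((1 / 2 : ℂ) • F1 Oct.e1) 0, 0, 0, 0, 0, 0⟩
  | 4, 9 => ⟨0, ⟨-F1 Oct.e1, 0, 0, 0⟩, ⟨0, -F1 Oct.e1, 0, 0⟩, 0, 0, 0⟩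
  | 5, 9 => ⟨0, ⟨-I • F1 Oct.e1, 0, 0, 0⟩, ⟨0, I • F1 Oct.e1, 0, 0⟩, 0, 0, 0⟩
  | 6, 9 => ⟨0, ⟨0, -F1 Oct.e1, 0, 0⟩, ⟨F1 Oct.e1, 0, 0, 0⟩, 0, 0, 0⟩
  | 7, 9 => ⟨0, ⟨0, -I • F1 Oct.e1, 0, 0⟩, ⟨-I • F1 Oct.e1, 0, 0, 0⟩, 0, 0, 0⟩
  | 8, 9 => ⟨Phi (-(tildeA1 Oct.one * tildeA1 Oct.e1 - tildeA1 Oct.e1 * tildeA1 Oct.one)) 0 0 0, 0, 0, 0, 0, 0⟩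
  | _, _ => 0

end E8

/-- The matrix `G_{ij} ∈ 𝔰𝔬(10)` whose `(i, j)` entry is `1`, whose `(j, i)` entry is `-1`, and whose
other entries vanish (rows and columns are numbered from `0` to `9`). -/
def soG (k : Type) [CommRing k] (i j : Fin 10) : LieAlgebra.Orthogonal.so (Fin 10) k :=
  ⟨Matrix.single i j 1 - Matrix.single j i 1, by
    rw [LieAlgebra.Orthogonal.mem_so]
    simp [Matrix.transpose_sub, Matrix.transpose_single]⟩

end

/-! The subalgebra sought is the centralizer of `𝔰𝔬(6)` in `𝔢₈^C`, and this centralizer can be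
written down by coordinates. Inside `𝔍^C` the vectors killed by `𝔰𝔬(6)` form the five-dimensional
Jordan subalgebra of the `kap a b c p q` (`eq_kap_of_so6`). Among the operators on `𝔍^C`, only the
`opK`, built from multiplications by such vectors and from three derivations, are needed. Feeding
these into `𝔢₇^C` and `𝔢₈^C` leaves a family with 45 parameters, which is closed under the bracket.

`toE8` parametrizes this family by the upper triangle of a `10 × 10` matrix. The elements `R_{ij}`
contain factors `i`; these are exactly the factors `wᵢ wⱼ` for the weights `wt`, so `toE8` itself
has only rational coefficients. With `W = diag(w)` and `S = diag(w²)`, the computation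
`bracket_toE8` shows that `toE8` turns `N S N' - N' S N` into the bracket. It is an identity of
polynomials over `ℚ`, where `i² = -1` plays no role. Since `W S W = 1`, the substitution `N = W M W`
converts this product into the ordinary matrix commutator (`bracket_ofMatrix`), and `G_{ij}` goes to
`R_{ij}` (`toE8_soG`).

That the image lies in the fixed subalgebra follows since `σ'₄` and all `D ∈ 𝔰𝔬(6, C)` commute with
the invariant operators (`sigma_toE8`, `bracket_toE8_RD`). Conversely, an element commuting with the
real `𝔰𝔬(6)` already comes from a matrix. The essential point is the centralizer of `𝔰𝔬(6)` in
`𝔣₄^C` (`f4_centralizer`): such a derivation preserves the subalgebra of the `kap`, acts there like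
some `opK x y z 0 0 0 0 0`, and the difference is an element of `𝔰𝔬(6, C)` that centralizes `𝔰𝔬(6)`.
It vanishes by skew-symmetry on `x₁` and by triality on `x₂`, `x₃` (`so6C_centralizer`).

Finally `τ λ_ω` becomes entrywise conjugation of `M` (`tau_lamOmega_ofMatrix`), so the compact form
corresponds to real matrices, and the complexification statement is the splitting of `M` into real
and imaginary parts. -/

noncomputable section

/-! ### Octonion conjugation and inner product -/

namespace Oct

@[simp] theorem bar_c0 (x : Oct) : (bar x).c0 = x.c0 := rfl
@[simp] theorem bar_c1 (x : Oct) : (bar x).c1 = -x.c1 := rfl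
@[simp] theorem bar_c2 (x : Oct) : (bar x).c2 = -x.c2 := rfl
@[simp] theorem bar_c3 (x : Oct) : (bar x).c3 = -x.c3 := rfl
@[simp] theorem bar_c4 (x : Oct) : (bar x).c4 = -x.c4 := rfl
@[simp] theorem bar_c5 (x : Oct) : (bar x).c5 = -x.c5 := rfl
@[simp] theorem bar_c6 (x : Oct) : (bar x).c6 = -x.c6 := rfl
@[simp] theorem bar_c7 (x : Oct) : (bar x).c7 = -x.c7 := rfl

theorem one_mul (x : Oct) : one * x = x := by
  ext1 <;> simp [one]

theorem mul_one (x : Oct) : x * one = x := by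
  ext1 <;> simp [one]

theorem bar_bar (x : Oct) : bar (bar x) = x := by
  ext1 <;> simp

theorem bar_mul (x y : Oct) : bar (x * y) = bar y * bar x := by
  ext1 <;> simp only [bar_c0, bar_c1, bar_c2, bar_c3, bar_c4, bar_c5, bar_c6, bar_c7, mul_c0,
    mul_c1, mul_c2, mul_c3, mul_c4, mul_c5, mul_c6, mul_c7] <;> ring

theorem re_one : re one = 1 := rfl

theorem re_apply (x : Oct) : re x = x.c0 := rfl

theorem re_mul_bar (x y : Oct) : re (x * bar y) = x.c0 * y.c0 + x.c1 * y.c1 + x.c2 * y.c2 +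
    x.c3 * y.c3 + x.c4 * y.c4 + x.c5 * y.c5 + x.c6 * y.c6 + x.c7 * y.c7 := by
  simp only [re_apply, mul_c0, bar_c0, bar_c1, bar_c2, bar_c3, bar_c4, bar_c5, bar_c6, bar_c7]
  ring

theorem re_mul_bar_comm (x y : Oct) : re (x * bar y) = re (y * bar x) := by
  simp only [re_mul_bar]; ring

theorem re_bar_mul (x y : Oct) : re (bar x * y) = re (x * bar y) := by
  rw [re_mul_bar]
  simp only [re_apply, mul_c0, bar_c0, bar_c1, bar_c2, bar_c3, bar_c4, bar_c5, bar_c6, bar_c7]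
  ring

end Oct

/-! ### Coordinate formulas for the operations of `𝔍^C` -/

namespace J

theorem toMat_apply (X : J) : toMat X = !![X.ξ₁ • Oct.one, X.x₃, Oct.bar X.x₂;
    Oct.bar X.x₃, X.ξ₂ • Oct.one, X.x₁; X.x₂, Oct.bar X.x₁, X.ξ₃ • Oct.one] := rfl

theorem ofMat_apply (a b c d e f g h i : Oct) :
    ofMat !![a, b, c; d, e, f; g, h, i] = ⟨Oct.re a, Oct.re e, Oct.re i, f, g, b⟩ := rfl

theorem mul_fin_three (a b c d e f g h i a' b' c' d' e' f' g' h' i' : Oct) :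
    !![a, b, c; d, e, f; g, h, i] * !![a', b', c'; d', e', f'; g', h', i'] =
      !![a * a' + b * d' + c * g', a * b' + b * e' + c * h', a * c' + b * f' + c * i';
        d * a' + e * d' + f * g', d * b' + e * e' + f * h', d * c' + e * f' + f * i';
        g * a' + h * d' + i * g', g * b' + h * e' + i * h', g * c' + h * f' + i * i'] := by
  refine Matrix.ext fun r s => ?_
  rw [Matrix.mul_apply, Fin.sum_univ_three]
  fin_cases r <;> fin_cases s <;> rfl

open Oct in
theorem jordan_apply (X Y : J) : jordan X Y =
    ⟨X.ξ₁ * Y.ξ₁ + (Oct.re (X.x₂ * Oct.bar Y.x₂) + Oct.re (X.x₃ * Oct.bar Y.x₃)),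
     X.ξ₂ * Y.ξ₂ + (Oct.re (X.x₁ * Oct.bar Y.x₁) + Oct.re (X.x₃ * Oct.bar Y.x₃)),
     X.ξ₃ * Y.ξ₃ + (Oct.re (X.x₁ * Oct.bar Y.x₁) + Oct.re (X.x₂ * Oct.bar Y.x₂)),
     (1 / 2 : ℂ) • ((X.ξ₂ + X.ξ₃) • Y.x₁ + (Y.ξ₂ + Y.ξ₃) • X.x₁ +
        Oct.bar (X.x₂ * Y.x₃) + Oct.bar (Y.x₂ * X.x₃)),
     (1 / 2 : ℂ) • ((X.ξ₃ + X.ξ₁) • Y.x₂ + (Y.ξ₃ + Y.ξ₁) • X.x₂ +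
        Oct.bar (X.x₃ * Y.x₁) + Oct.bar (Y.x₃ * X.x₁)),
     (1 / 2 : ℂ) • ((X.ξ₁ + X.ξ₂) • Y.x₃ + (Y.ξ₁ + Y.ξ₂) • X.x₃ +
        Oct.bar (X.x₁ * Y.x₂) + Oct.bar (Y.x₁ * X.x₂))⟩ := by
  have h : jordan X Y = (1 / 2 : ℂ) • (ofMat (toMat X * toMat Y) + ofMat (toMat Y * toMat X)) := by
    rw [← map_add, ← map_smul]; rfl
  rw [h, toMat_apply, toMat_apply, mul_fin_three, mul_fin_three, ofMat_apply, ofMat_apply]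
  clear h
  rcases X with ⟨a, b, c, x, y, z⟩
  rcases Y with ⟨a', b', c', x', y', z'⟩
  ext1
  · simp only [smul_ξ₁, add_ξ₁, smul_mul_assoc, Oct.one_mul, map_add, map_smul, Oct.re_one,
      re_bar_mul, smul_eq_mul, re_mul_bar_comm y' y, re_mul_bar_comm z' z]
    ring
  · simp only [smul_ξ₂, add_ξ₂, smul_mul_assoc, Oct.one_mul, map_add, map_smul, Oct.re_one,
      re_bar_mul, smul_eq_mul, re_mul_bar_comm x' x, re_mul_bar_comm z' z]
    ring
  · simp only [smul_ξ₃, add_ξ₃, smul_mul_assoc, Oct.one_mul, map_add, map_smul, Oct.re_one,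
      re_bar_mul, smul_eq_mul, re_mul_bar_comm x' x, re_mul_bar_comm y' y]
    ring
  · simp only [smul_x₁, add_x₁, smul_mul_assoc, mul_smul_comm, Oct.one_mul, Oct.mul_one, bar_mul]
    module
  · simp only [smul_x₂, add_x₂, smul_mul_assoc, mul_smul_comm, Oct.one_mul, Oct.mul_one, bar_mul]
    module
  · simp only [smul_x₃, add_x₃, smul_mul_assoc, mul_smul_comm, Oct.one_mul, Oct.mul_one, bar_mul]
    module

open Oct in
theorem tildeA1_apply (a : Oct) (X : J) : tildeA1 a X =
    ⟨0, Oct.re (a * Oct.bar X.x₁), -Oct.re (a * Oct.bar X.x₁),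
     ((1 / 2 : ℂ) * (X.ξ₃ - X.ξ₂)) • a,
     -(1 / 2 : ℂ) • Oct.bar (X.x₃ * a),
     (1 / 2 : ℂ) • Oct.bar (a * X.x₂)⟩ := by
  have h : tildeA1 a X = (1 / 2 : ℂ) • (ofMat (!![0, 0, 0; 0, 0, a; 0, -Oct.bar a, 0] * toMat X) -
      ofMat (toMat X * !![0, 0, 0; 0, 0, a; 0, -Oct.bar a, 0])) := by
    rw [← map_sub, ← map_smul]; rfl
  rw [h, toMat_apply, mul_fin_three, mul_fin_three, ofMat_apply, ofMat_apply]
  clear h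
  rcases X with ⟨r, s, t, x, y, z⟩
  simp only [zero_mul, mul_zero, add_zero, zero_add, neg_mul, mul_neg]
  ext1
  · simp only [smul_ξ₁, sub_ξ₁, map_zero, sub_zero, smul_zero]
  · simp only [smul_ξ₂, sub_ξ₂, map_neg, re_mul_bar_comm x a, smul_eq_mul]
    ring
  · simp only [smul_ξ₃, sub_ξ₃, map_neg, re_bar_mul, re_mul_bar_comm x a, smul_eq_mul]
    ring
  · simp only [smul_x₁, sub_x₁, smul_mul_assoc, mul_smul_comm, Oct.one_mul, Oct.mul_one]
    module
  · simp only [smul_x₂, sub_x₂, bar_mul]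
    module
  · simp only [smul_x₃, sub_x₃, bar_mul]
    module

theorem cross_apply (X Y : J) : cross X Y =
    ⟨1 / 2 * (X.ξ₂ * Y.ξ₃ + X.ξ₃ * Y.ξ₂) - Oct.re (X.x₁ * Oct.bar Y.x₁),
     1 / 2 * (X.ξ₃ * Y.ξ₁ + X.ξ₁ * Y.ξ₃) - Oct.re (X.x₂ * Oct.bar Y.x₂),
     1 / 2 * (X.ξ₁ * Y.ξ₂ + X.ξ₂ * Y.ξ₁) - Oct.re (X.x₃ * Oct.bar Y.x₃),
     (1 / 2 : ℂ) • (Oct.bar (X.x₂ * Y.x₃) + Oct.bar (Y.x₂ * X.x₃) - X.ξ₁ • Y.x₁ - Y.ξ₁ • X.x₁),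
     (1 / 2 : ℂ) • (Oct.bar (X.x₃ * Y.x₁) + Oct.bar (Y.x₃ * X.x₁) - X.ξ₂ • Y.x₂ - Y.ξ₂ • X.x₂),
     (1 / 2 : ℂ) • (Oct.bar (X.x₁ * Y.x₂) + Oct.bar (Y.x₁ * X.x₂) - X.ξ₃ • Y.x₃ - Y.ξ₃ • X.x₃)⟩ :=
         by
  simp only [cross, LinearMap.mk₂_apply, jordan_apply, form_apply, tr, LinearMap.coe_mk,
    AddHom.coe_mk, E]
  ext1 <;> simp only [smul_ξ₁, smul_ξ₂, smul_ξ₃, smul_x₁, smul_x₂, smul_x₃, add_ξ₁, add_ξ₂, add_ξ₃,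
    add_x₁, add_x₂, add_x₃, sub_ξ₁, sub_ξ₂, sub_ξ₃, sub_x₁, sub_x₂, sub_x₃, smul_eq_mul]
  case x₁ | x₂ | x₃ => module
  all_goals ring

/-- The element of `𝔍^C` with diagonal `a, b, c` and `x₁ = p + q e₁`. -/
def kap (a b c p q : ℂ) : J := ⟨a, b, c, ⟨p, q, 0, 0, 0, 0, 0, 0⟩, 0, 0⟩

/-- The operator `x Ã₁(1) + y Ã₁(e₁) + z [Ã₁(1), Ã₁(e₁)] + T̃` with `T = kap a b c p q`. -/
def opK (x y z a b c p q : ℂ) : Module.End ℂ J :=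
  x • tildeA1 Oct.one + y • tildeA1 Oct.e1 +
    z • (tildeA1 Oct.one * tildeA1 Oct.e1 - tildeA1 Oct.e1 * tildeA1 Oct.one) +
    jordan (kap a b c p q)

end J

/-! ### The `𝔰𝔬(6)`-invariant vectors `kap` and operators `opK` -/

namespace Oct

/-- An instance of left alternativity. The formulas below record `x₃` through its conjugate, so that
right multiplication by `e₁` becomes left multiplication as well; this identity is then all that is
needed to compose the operators on the coordinates `x₂` and `x₃`. -/
theorem e1_mul_e1_mul (x : Oct) : e1 * (e1 * x) = -x := by
  ext1 <;> simp only [e1, mul_c0, mul_c1, mul_c2, mul_c3, mul_c4, mul_c5, mul_c6, mul_c7, neg_c0,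
    neg_c1, neg_c2, neg_c3, neg_c4, neg_c5, neg_c6, neg_c7] <;> ring

theorem bar_e1 : bar e1 = -e1 := by
  ext1 <;> simp [e1]

theorem bar_mul_e1 (x : Oct) : bar (x * e1) = -(e1 * bar x) := by
  rw [bar_mul, bar_e1, neg_mul]

theorem mk_eq (p q : ℂ) : (⟨p, q, 0, 0, 0, 0, 0, 0⟩ : Oct) = p • one + q • e1 := by
  ext1 <;> simp [one, e1]

theorem mk_mul (p q : ℂ) (x : Oct) :
    (⟨p, q, 0, 0, 0, 0, 0, 0⟩ : Oct) * x = p • x + q • (e1 * x) := by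
  rw [mk_eq, add_mul, smul_mul_assoc, smul_mul_assoc, one_mul]

theorem mul_mk (p q : ℂ) (x : Oct) :
    x * (⟨p, q, 0, 0, 0, 0, 0, 0⟩ : Oct) = p • x + q • (x * e1) := by
  rw [mk_eq, mul_add, mul_smul_comm, mul_smul_comm, mul_one]

theorem re_mk_mul_bar (p q : ℂ) (x : Oct) :
    re ((⟨p, q, 0, 0, 0, 0, 0, 0⟩ : Oct) * bar x) = p * x.c0 + q * x.c1 := by
  simp only [re_mul_bar]; ring

theorem re_one_mul_bar (x : Oct) : re (one * bar x) = x.c0 := by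
  rw [one_mul]; rfl

theorem re_e1_mul_bar (x : Oct) : re (e1 * bar x) = x.c1 := by
  simp only [re_mul_bar, e1]; ring

theorem re_bar (x : Oct) : re (bar x) = x.c0 := rfl

theorem re_zero_mul_bar (x : Oct) : re (0 * bar x) = 0 := by
  rw [zero_mul, map_zero]

end Oct

namespace J

open Oct in
theorem cross_kap (a b c p q : ℂ) (X : J) : cross (kap a b c p q) X =
    ⟨1 / 2 * (b * X.ξ₃ + c * X.ξ₂) - (p * X.x₁.c0 + q * X.x₁.c1),
     1 / 2 * (c * X.ξ₁ + a * X.ξ₃), 1 / 2 * (a * X.ξ₂ + b * X.ξ₁),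
     ⟨1 / 2 * (-a * X.x₁.c0 - X.ξ₁ * p), 1 / 2 * (-a * X.x₁.c1 - X.ξ₁ * q), -(1 / 2) * a * X.x₁.c2,
      -(1 / 2) * a * X.x₁.c3, -(1 / 2) * a * X.x₁.c4, -(1 / 2) * a * X.x₁.c5,
      -(1 / 2) * a * X.x₁.c6, -(1 / 2) * a * X.x₁.c7⟩,
     (1 / 2 : ℂ) • (p • bar X.x₃ - q • (e1 * bar X.x₃) - b • X.x₂),
     bar ((1 / 2 : ℂ) • (p • X.x₂ + q • (e1 * X.x₂) - c • bar X.x₃))⟩ := by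
  rw [cross_apply]
  simp only [kap, re_bar, re_e1_mul_bar, smul_eq_mul, zero_mul, mul_zero, map_zero, zero_add,
      add_zero,
    mk_mul, mul_mk, map_add, map_smul, bar_mul_e1, sub_zero, map_sub, bar_bar, smul_zero]
  ext1 <;> try simp only
  case x₁ =>
    ext1 <;> simp only [smul_c0, smul_c1, smul_c2, smul_c3, smul_c4, smul_c5, smul_c6, smul_c7,
      sub_c0, sub_c1, sub_c2, sub_c3, sub_c4, sub_c5, sub_c6, sub_c7, zero_c0, zero_c1, zero_c2,
      zero_c3, zero_c4, zero_c5, zero_c6, zero_c7, smul_eq_mul] <;> ring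
  case x₂ => module

theorem form_kap (a b c p q : ℂ) (X : J) : form (kap a b c p q) X =
    a * X.ξ₁ + b * X.ξ₂ + c * X.ξ₃ + 2 * (p * X.x₁.c0 + q * X.x₁.c1) := by
  rw [form_apply]
  simp only [kap, Oct.re_mk_mul_bar, Oct.re_zero_mul_bar, add_zero]

open Oct in
theorem jordan_kap (a b c p q : ℂ) (X : J) : jordan (kap a b c p q) X =
    ⟨a * X.ξ₁, b * X.ξ₂ + (p * X.x₁.c0 + q * X.x₁.c1), c * X.ξ₃ + (p * X.x₁.c0 + q * X.x₁.c1),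
     (1 / 2 : ℂ) • ((b + c) • X.x₁ + (X.ξ₂ + X.ξ₃) • ⟨p, q, 0, 0, 0, 0, 0, 0⟩),
     (1 / 2 : ℂ) • ((c + a) • X.x₂ + p • bar X.x₃ - q • (e1 * bar X.x₃)),
     bar ((1 / 2 : ℂ) • ((a + b) • bar X.x₃ + p • X.x₂ + q • (e1 * X.x₂)))⟩ := by
  rw [jordan_apply]
  simp only [kap, re_bar, re_e1_mul_bar, smul_eq_mul, zero_mul, mul_zero, map_zero, add_zero,
    mk_mul, mul_mk, map_add, map_smul, bar_mul_e1, bar_bar, smul_zero]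
  ext1 <;> try simp only
  case x₂ | x₃ => module

open Oct in
theorem opK_apply (x y z a b c p q : ℂ) (X : J) : opK x y z a b c p q X =
    ⟨a * X.ξ₁, b * X.ξ₂ + (x + p) * X.x₁.c0 + (y + q) * X.x₁.c1,
     c * X.ξ₃ + (p - x) * X.x₁.c0 + (q - y) * X.x₁.c1,
     ⟨1 / 2 * ((p - x) * X.ξ₂ + (p + x) * X.ξ₃ + (b + c) * X.x₁.c0) - z * X.x₁.c1,
       1 / 2 * ((q - y) * X.ξ₂ + (q + y) * X.ξ₃ + (b + c) * X.x₁.c1) + z * X.x₁.c0,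
       1 / 2 * (b + c) * X.x₁.c2, 1 / 2 * (b + c) * X.x₁.c3, 1 / 2 * (b + c) * X.x₁.c4,
       1 / 2 * (b + c) * X.x₁.c5, 1 / 2 * (b + c) * X.x₁.c6, 1 / 2 * (b + c) * X.x₁.c7⟩,
     (1 / 2 : ℂ) • ((c + a) • X.x₂ + (p - x) • bar X.x₃ - (q - y) • (e1 * bar X.x₃)
       - z • (e1 * X.x₂)),
     bar ((1 / 2 : ℂ) • ((a + b) • bar X.x₃ + (p + x) • X.x₂ + (q + y) • (e1 * X.x₂)
       + z • (e1 * bar X.x₃)))⟩ := by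
  simp only [opK, LinearMap.add_apply, LinearMap.smul_apply, LinearMap.sub_apply,
    Module.End.mul_apply, jordan_kap, tildeA1_apply, re_bar, re_e1_mul_bar, Oct.one_mul,
    Oct.mul_one]
  ext1 <;> simp only [smul_ξ₁, smul_ξ₂, smul_ξ₃, smul_x₁, smul_x₂, smul_x₃, add_ξ₁, add_ξ₂, add_ξ₃,
    add_x₁, add_x₂, add_x₃, sub_ξ₁, sub_ξ₂, sub_ξ₃, sub_x₁, sub_x₂, sub_x₃, smul_eq_mul]
  case x₁ =>
    ext1 <;> simp only [smul_c0, smul_c1, smul_c2, smul_c3, smul_c4, smul_c5, smul_c6, smul_c7,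
      sub_c0, sub_c1, sub_c2, sub_c3, sub_c4, sub_c5, sub_c6, sub_c7, add_c0, add_c1, add_c2,
      add_c3, add_c4, add_c5, add_c6, add_c7, one, e1, smul_eq_mul] <;> ring
  case x₂ =>
    simp only [map_smul, bar_bar, bar_mul_e1, smul_mul_assoc]
    module
  case x₃ =>
    simp only [map_smul, map_add, bar_bar, mul_smul_comm, bar_mul, bar_e1, mul_neg,
      map_neg, neg_neg]
    module
  case ξ₁ => ring
  all_goals simp only [smul_c0, smul_c1, one, e1, smul_eq_mul]; ring

/-- Multiplications `T̃` are symmetric for the trace form and the derivation part is skew, so only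
the signs of `x`, `y`, `z` change. -/
theorem transpose_opK (x y z a b c p q : ℂ) :
    transpose (opK x y z a b c p q) = opK (-x) (-y) (-z) a b c p q := by
  refine transpose_unique fun X Y => ?_
  simp only [form_apply, opK_apply, Oct.re_mul_bar, Oct.e1, Oct.bar_c0, Oct.bar_c1, Oct.bar_c2,
    Oct.bar_c3, Oct.bar_c4, Oct.bar_c5, Oct.bar_c6, Oct.bar_c7, Oct.smul_c0, Oct.smul_c1,
    Oct.smul_c2, Oct.smul_c3, Oct.smul_c4, Oct.smul_c5, Oct.smul_c6, Oct.smul_c7, Oct.add_c0,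
    Oct.add_c1, Oct.add_c2, Oct.add_c3, Oct.add_c4, Oct.add_c5, Oct.add_c6, Oct.add_c7,
    Oct.sub_c0, Oct.sub_c1, Oct.sub_c2, Oct.sub_c3, Oct.sub_c4, Oct.sub_c5, Oct.sub_c6,
    Oct.sub_c7, Oct.mul_c0, Oct.mul_c1, Oct.mul_c2, Oct.mul_c3, Oct.mul_c4, Oct.mul_c5,
    Oct.mul_c6, Oct.mul_c7, smul_eq_mul]
  ring

end J

namespace J

open Oct

theorem opK_add (x y z a b c p q x' y' z' a' b' c' p' q' : ℂ) :
    opK x y z a b c p q + opK x' y' z' a' b' c' p' q' =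
      opK (x + x') (y + y') (z + z') (a + a') (b + b') (c + c') (p + p') (q + q') := by
  have h : kap (a + a') (b + b') (c + c') (p + p') (q + q') = kap a b c p q + kap a' b' c' p' q' :=
      by
    ext1 <;> simp [kap]
    ext1 <;> simp
  simp only [opK, h, map_add]
  module

theorem opK_smul (r x y z a b c p q : ℂ) :
    r • opK x y z a b c p q =
      opK (r * x) (r * y) (r * z) (r * a) (r * b) (r * c) (r * p) (r * q) := by
  have h : kap (r * a) (r * b) (r * c) (r * p) (r * q) = r • kap a b c p q := by
    ext1 <;> simp [kap]
    ext1 <;> simp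
  simp only [opK, h, map_smul]
  module

theorem opK_kap (x y z a b c p q a' b' c' p' q' : ℂ) :
    opK x y z a b c p q (kap a' b' c' p' q') =
      kap (a * a') (b * b' + (x + p) * p' + (y + q) * q') (c * c' + (p - x) * p' + (q - y) * q')
        (1 / 2 * ((p - x) * b' + (p + x) * c' + (b + c) * p') - z * q')
        (1 / 2 * ((q - y) * b' + (q + y) * c' + (b + c) * q') + z * p') := by
  rw [opK_apply]
  simp only [kap, mul_zero, map_zero, smul_zero, add_zero, sub_zero]

theorem cross_kap_kap (a b c p q a' b' c' p' q' : ℂ) :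
    cross (kap a b c p q) (kap a' b' c' p' q') =
      kap (1 / 2 * (b * c' + c * b') - (p * p' + q * q')) (1 / 2 * (c * a' + a * c'))
        (1 / 2 * (a * b' + b * a')) (1 / 2 * (-a * p' - a' * p)) (1 / 2 * (-a * q' - a' * q)) := by
  rw [cross_kap]
  simp only [kap, mul_zero, map_zero, smul_zero, add_zero, sub_zero]

/-- The pattern is `[δ, T̃] = (δT)~`, while `[T̃, S̃]` is again a derivation; the family is
therefore closed under commutators. The entries `a`, `a'` drop out because `E₁` is Peirce-orthogonal
to the rest of the subalgebra. -/
theorem opK_commutator (x y z a b c p q x' y' z' a' b' c' p' q' : ℂ) :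
    opK x y z a b c p q * opK x' y' z' a' b' c' p' q' -
      opK x' y' z' a' b' c' p' q' * opK x y z a b c p q =
    opK (1 / 2 * ((b - c) * p' - (b' - c') * p) - z * y' + z' * y)
      (1 / 2 * ((b - c) * q' - (b' - c') * q) + z * x' - z' * x)
      (x * y' - x' * y + q * p' - p * q') 0
      (x * p' + y * q' - x' * p - y' * q) (x' * p + y' * q - x * p' - y * q')
      (1 / 2 * (x * (c' - b') - x' * (c - b)) - z * q' + z' * q)
      (1 / 2 * (y * (c' - b') - y' * (c - b)) + z * p' - z' * p) := by
  refine LinearMap.ext fun X => ?_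
  simp only [LinearMap.sub_apply, Module.End.mul_apply, opK_apply]
  ext1 <;> simp only [sub_ξ₁, sub_ξ₂, sub_ξ₃, sub_x₁, sub_x₂, sub_x₃]
  case x₁ =>
    ext1 <;> simp only [sub_c0, sub_c1, sub_c2, sub_c3, sub_c4, sub_c5, sub_c6, sub_c7] <;> ring
  case x₂ =>
    simp only [bar_bar, mul_add, mul_sub, mul_smul_comm, e1_mul_e1_mul]
    module
  case x₃ =>
    rw [← map_sub]
    congr 1
    simp only [bar_bar, mul_add, mul_sub, mul_smul_comm, e1_mul_e1_mul]
    module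
  all_goals ring

theorem vee_kap (a b c p q a' b' c' p' q' : ℂ) :
    vee (kap a b c p q) (kap a' b' c' p' q') =
      opK (1 / 2 * ((b - c) * p' - (b' - c') * p)) (1 / 2 * ((b - c) * q' - (b' - c') * q))
        (q * p' - p * q')
        (1 / 3 * (2 * (a * a') - b * b' - c * c' - 2 * (p * p' + q * q')))
        (1 / 3 * (2 * (b * b') - a * a' - c * c' + p * p' + q * q'))
        (1 / 3 * (2 * (c * c') - a * a' - b * b' + p * p' + q * q'))
        (1 / 2 * ((b + c) * p' + (b' + c') * p)) (1 / 2 * ((b + c) * q' + (b' + c') * q)) := by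
  have h : ∀ a b c p q, jordan (kap a b c p q) = opK 0 0 0 a b c p q := fun a b c p q => by
    simp only [opK, zero_smul, zero_add]
  have k : jordan (kap a b c p q) (kap a' b' c' p' q') -
      (1 / 3 * form (kap a b c p q) (kap a' b' c' p' q')) • E =
      kap (1 / 3 * (2 * (a * a') - b * b' - c * c' - 2 * (p * p' + q * q')))
        (1 / 3 * (2 * (b * b') - a * a' - c * c' + p * p' + q * q'))
        (1 / 3 * (2 * (c * c') - a * a' - b * b' + p * p' + q * q'))
        (1 / 2 * ((b + c) * p' + (b' + c') * p)) (1 / 2 * ((b + c) * q' + (b' + c') * q)) := by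
    rw [h, opK_kap, form_kap]
    ext1 <;> simp only [kap, E, sub_ξ₁, sub_ξ₂, sub_ξ₃, sub_x₁, sub_x₂, sub_x₃, smul_ξ₁, smul_ξ₂,
      smul_ξ₃, smul_x₁, smul_x₂, smul_x₃, smul_eq_mul, smul_zero, sub_zero]
    case x₁ => ext1 <;> simp only <;> ring
    all_goals ring
  rw [vee, k, h, h, h, opK_commutator, opK_add]
  congr 1 <;> ring

end J

/-! ### The invariant part of `𝔢₇^C` -/

namespace FP

open J Oct

theorem Phi_apply (φ : Module.End ℂ J) (A B : J) (ν : ℂ) (R : FP) : Phi φ A B ν R =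
    ⟨φ R.X - (1 / 3 * ν) • R.X + (2 : ℂ) • cross B R.Y + R.η • A,
      (2 : ℂ) • cross A R.X - transpose φ R.Y + (1 / 3 * ν) • R.Y + R.ξ • B,
      form A R.Y + ν * R.ξ,
      form B R.X - ν * R.η⟩ := rfl

set_option maxHeartbeats 1000000 in
-- The first diagonal entry `-b - c` encodes the condition `tr T = 0` in `𝔢₆^C`. The coordinates
-- `c2, …, c7` of `x₁` do not mix with each other or with the remaining ones: only their `X` and `Y`
-- copies are combined, by scalars.
theorem PhiK_apply (x y z b c p q a₁ b₁ c₁ p₁ q₁ a₂ b₂ c₂ p₂ q₂ ν : ℂ) (R : FP) :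
    Phi (opK x y z (-b - c) b c p q) (kap a₁ b₁ c₁ p₁ q₁) (kap a₂ b₂ c₂ p₂ q₂) ν R =
    ⟨⟨(-b - c - 1 / 3 * ν) * R.X.ξ₁ + b₂ * R.Y.ξ₃ + c₂ * R.Y.ξ₂ -
        2 * (p₂ * R.Y.x₁.c0 + q₂ * R.Y.x₁.c1) + R.η * a₁,
      (b - 1 / 3 * ν) * R.X.ξ₂ + (x + p) * R.X.x₁.c0 + (y + q) * R.X.x₁.c1 +
        c₂ * R.Y.ξ₁ + a₂ * R.Y.ξ₃ + R.η * b₁,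
      (c - 1 / 3 * ν) * R.X.ξ₃ + (p - x) * R.X.x₁.c0 + (q - y) * R.X.x₁.c1 +
        a₂ * R.Y.ξ₂ + b₂ * R.Y.ξ₁ + R.η * c₁,
      ⟨1 / 2 * ((p - x) * R.X.ξ₂ + (p + x) * R.X.ξ₃ + (b + c - 2 / 3 * ν) * R.X.x₁.c0) -
          z * R.X.x₁.c1 - a₂ * R.Y.x₁.c0 - R.Y.ξ₁ * p₂ + R.η * p₁,
        1 / 2 * ((q - y) * R.X.ξ₂ + (q + y) * R.X.ξ₃ + (b + c - 2 / 3 * ν) * R.X.x₁.c1) +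
          z * R.X.x₁.c0 - a₂ * R.Y.x₁.c1 - R.Y.ξ₁ * q₂ + R.η * q₁,
        1 / 2 * (b + c - 2 / 3 * ν) * R.X.x₁.c2 - a₂ * R.Y.x₁.c2,
        1 / 2 * (b + c - 2 / 3 * ν) * R.X.x₁.c3 - a₂ * R.Y.x₁.c3,
        1 / 2 * (b + c - 2 / 3 * ν) * R.X.x₁.c4 - a₂ * R.Y.x₁.c4,
        1 / 2 * (b + c - 2 / 3 * ν) * R.X.x₁.c5 - a₂ * R.Y.x₁.c5,
        1 / 2 * (b + c - 2 / 3 * ν) * R.X.x₁.c6 - a₂ * R.Y.x₁.c6,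
        1 / 2 * (b + c - 2 / 3 * ν) * R.X.x₁.c7 - a₂ * R.Y.x₁.c7⟩,
      (1 / 2 : ℂ) • ((-b - 2 / 3 * ν) • R.X.x₂ + (p - x) • bar R.X.x₃ -
        (q - y) • (e1 * bar R.X.x₃) - z • (e1 * R.X.x₂)) +
        p₂ • bar R.Y.x₃ - q₂ • (e1 * bar R.Y.x₃) - b₂ • R.Y.x₂,
      bar ((1 / 2 : ℂ) • ((-c - 2 / 3 * ν) • bar R.X.x₃ + (p + x) • R.X.x₂ +
        (q + y) • (e1 * R.X.x₂) + z • (e1 * bar R.X.x₃)) +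
        p₂ • R.Y.x₂ + q₂ • (e1 * R.Y.x₂) - c₂ • bar R.Y.x₃)⟩,
     ⟨(b + c + 1 / 3 * ν) * R.Y.ξ₁ + b₁ * R.X.ξ₃ + c₁ * R.X.ξ₂ -
        2 * (p₁ * R.X.x₁.c0 + q₁ * R.X.x₁.c1) + R.ξ * a₂,
      (-b + 1 / 3 * ν) * R.Y.ξ₂ + (x - p) * R.Y.x₁.c0 + (y - q) * R.Y.x₁.c1 +
        c₁ * R.X.ξ₁ + a₁ * R.X.ξ₃ + R.ξ * b₂,
      (-c + 1 / 3 * ν) * R.Y.ξ₃ + (-p - x) * R.Y.x₁.c0 + (-q - y) * R.Y.x₁.c1 +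
        a₁ * R.X.ξ₂ + b₁ * R.X.ξ₁ + R.ξ * c₂,
      ⟨1 / 2 * ((-p - x) * R.Y.ξ₂ + (-p + x) * R.Y.ξ₃ + (-b - c + 2 / 3 * ν) * R.Y.x₁.c0) -
          z * R.Y.x₁.c1 - a₁ * R.X.x₁.c0 - R.X.ξ₁ * p₁ + R.ξ * p₂,
        1 / 2 * ((-q - y) * R.Y.ξ₂ + (-q + y) * R.Y.ξ₃ + (-b - c + 2 / 3 * ν) * R.Y.x₁.c1) +
          z * R.Y.x₁.c0 - a₁ * R.X.x₁.c1 - R.X.ξ₁ * q₁ + R.ξ * q₂,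
        1 / 2 * (-b - c + 2 / 3 * ν) * R.Y.x₁.c2 - a₁ * R.X.x₁.c2,
        1 / 2 * (-b - c + 2 / 3 * ν) * R.Y.x₁.c3 - a₁ * R.X.x₁.c3,
        1 / 2 * (-b - c + 2 / 3 * ν) * R.Y.x₁.c4 - a₁ * R.X.x₁.c4,
        1 / 2 * (-b - c + 2 / 3 * ν) * R.Y.x₁.c5 - a₁ * R.X.x₁.c5,
        1 / 2 * (-b - c + 2 / 3 * ν) * R.Y.x₁.c6 - a₁ * R.X.x₁.c6,
        1 / 2 * (-b - c + 2 / 3 * ν) * R.Y.x₁.c7 - a₁ * R.X.x₁.c7⟩,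
      (1 / 2 : ℂ) • ((b + 2 / 3 * ν) • R.Y.x₂ + (-p - x) • bar R.Y.x₃ -
        (-q - y) • (e1 * bar R.Y.x₃) - z • (e1 * R.Y.x₂)) +
        p₁ • bar R.X.x₃ - q₁ • (e1 * bar R.X.x₃) - b₁ • R.X.x₂,
      bar ((1 / 2 : ℂ) • ((c + 2 / 3 * ν) • bar R.Y.x₃ + (-p + x) • R.Y.x₂ +
        (-q + y) • (e1 * R.Y.x₂) + z • (e1 * bar R.Y.x₃)) +
        p₁ • R.X.x₂ + q₁ • (e1 * R.X.x₂) - c₁ • bar R.X.x₃)⟩,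
     a₁ * R.Y.ξ₁ + b₁ * R.Y.ξ₂ + c₁ * R.Y.ξ₃ + 2 * (p₁ * R.Y.x₁.c0 + q₁ * R.Y.x₁.c1) + ν * R.ξ,
     a₂ * R.X.ξ₁ + b₂ * R.X.ξ₂ + c₂ * R.X.ξ₃ + 2 * (p₂ * R.X.x₁.c0 + q₂ * R.X.x₁.c1) - ν * R.η⟩ :=
         by
  rw [Phi_apply, transpose_opK]
  simp only [opK_apply, cross_kap, form_kap]
  ext1
  · ext1 <;> simp only [sub_ξ₁, sub_ξ₂, sub_ξ₃, sub_x₁, sub_x₂, sub_x₃, smul_ξ₁, smul_ξ₂,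
      smul_ξ₃, smul_x₁, smul_x₂, smul_x₃, add_ξ₁, add_ξ₂, add_ξ₃, add_x₁, add_x₂, add_x₃, kap,
      smul_eq_mul]
    case x₁ =>
      ext1 <;> simp only [smul_c0, smul_c1, smul_c2, smul_c3, smul_c4, smul_c5, smul_c6, smul_c7,
        sub_c0, sub_c1, sub_c2, sub_c3, sub_c4, sub_c5, sub_c6, sub_c7, add_c0, add_c1, add_c2,
        add_c3, add_c4, add_c5, add_c6, add_c7, smul_eq_mul] <;> ring
    case x₂ => module
    case x₃ =>
      simp only [map_add, map_sub, map_smul, bar_bar]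
      module
    all_goals ring
  · ext1 <;> simp only [sub_ξ₁, sub_ξ₂, sub_ξ₃, sub_x₁, sub_x₂, sub_x₃, smul_ξ₁, smul_ξ₂,
      smul_ξ₃, smul_x₁, smul_x₂, smul_x₃, add_ξ₁, add_ξ₂, add_ξ₃, add_x₁, add_x₂, add_x₃, kap,
      smul_eq_mul]
    case x₁ =>
      ext1 <;> simp only [smul_c0, smul_c1, smul_c2, smul_c3, smul_c4, smul_c5, smul_c6, smul_c7,
        sub_c0, sub_c1, sub_c2, sub_c3, sub_c4, sub_c5, sub_c6, sub_c7, add_c0, add_c1, add_c2,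
        add_c3, add_c4, add_c5, add_c6, add_c7, smul_eq_mul] <;> ring
    case x₂ => module
    case x₃ =>
      simp only [map_add, map_sub, map_smul, bar_bar]
      module
    all_goals ring
  all_goals ring

end FP

namespace FP

open J Oct

set_option maxHeartbeats 2000000 in
-- The right-hand side is the invariant case of the bracket of `𝔢₇^C`: `φ`-part `[φ, φ'] + 2 A ∨ B'
-- - 2 A' ∨ B`, `A`-part `(φ + (2/3)ν) A' - (φ' + (2/3)ν') A`, `B`-part `-(ᵗφ + (2/3)ν) B' + (ᵗφ' +
-- (2/3)ν') B`, and scalar `(A, B') - (A', B)`. The first diagonal entry is spelled as minus the sum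
-- of the other two, so that the result has again the shape of the factors.
theorem PhiK_commutator (x y z b c p q a₁ b₁ c₁ p₁ q₁ a₂ b₂ c₂ p₂ q₂ ν
    x' y' z' b' c' p' q' a₁' b₁' c₁' p₁' q₁' a₂' b₂' c₂' p₂' q₂' ν' : ℂ) :
    Phi (opK x y z (-b - c) b c p q) (kap a₁ b₁ c₁ p₁ q₁) (kap a₂ b₂ c₂ p₂ q₂) ν *
      Phi (opK x' y' z' (-b' - c') b' c' p' q') (kap a₁' b₁' c₁' p₁' q₁')
        (kap a₂' b₂' c₂' p₂' q₂') ν' -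
      Phi (opK x' y' z' (-b' - c') b' c' p' q') (kap a₁' b₁' c₁' p₁' q₁')
        (kap a₂' b₂' c₂' p₂' q₂') ν' *
      Phi (opK x y z (-b - c) b c p q) (kap a₁ b₁ c₁ p₁ q₁) (kap a₂ b₂ c₂ p₂ q₂) ν =
    Phi
      (opK
        (1 / 2 * ((b - c) * p' - (b' - c') * p) - z * y' + z' * y +
          ((b₁ - c₁) * p₂' - (b₂' - c₂') * p₁) - ((b₁' - c₁') * p₂ - (b₂ - c₂) * p₁'))
        (1 / 2 * ((b - c) * q' - (b' - c') * q) + z * x' - z' * x +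
          ((b₁ - c₁) * q₂' - (b₂' - c₂') * q₁) - ((b₁' - c₁') * q₂ - (b₂ - c₂) * q₁'))
        (x * y' - x' * y + q * p' - p * q' + 2 * (q₁ * p₂' - p₁ * q₂') -
          2 * (q₁' * p₂ - p₁' * q₂))
        (-(x * p' + y * q' - x' * p - y' * q +
          2 / 3 * (2 * (b₁ * b₂') - a₁ * a₂' - c₁ * c₂' + p₁ * p₂' + q₁ * q₂') -
          2 / 3 * (2 * (b₁' * b₂) - a₁' * a₂ - c₁' * c₂ + p₁' * p₂ + q₁' * q₂)) -
        (x' * p + y' * q - x * p' - y * q' +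
          2 / 3 * (2 * (c₁ * c₂') - a₁ * a₂' - b₁ * b₂' + p₁ * p₂' + q₁ * q₂') -
          2 / 3 * (2 * (c₁' * c₂) - a₁' * a₂ - b₁' * b₂ + p₁' * p₂ + q₁' * q₂)))
        (x * p' + y * q' - x' * p - y' * q +
          2 / 3 * (2 * (b₁ * b₂') - a₁ * a₂' - c₁ * c₂' + p₁ * p₂' + q₁ * q₂') -
          2 / 3 * (2 * (b₁' * b₂) - a₁' * a₂ - c₁' * c₂ + p₁' * p₂ + q₁' * q₂))
        (x' * p + y' * q - x * p' - y * q' +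
          2 / 3 * (2 * (c₁ * c₂') - a₁ * a₂' - b₁ * b₂' + p₁ * p₂' + q₁ * q₂') -
          2 / 3 * (2 * (c₁' * c₂) - a₁' * a₂ - b₁' * b₂ + p₁' * p₂ + q₁' * q₂))
        (1 / 2 * (x * (c' - b') - x' * (c - b)) - z * q' + z' * q +
          ((b₁ + c₁) * p₂' + (b₂' + c₂') * p₁) - ((b₁' + c₁') * p₂ + (b₂ + c₂) * p₁'))
        (1 / 2 * (y * (c' - b') - y' * (c - b)) + z * p' - z' * p +
          ((b₁ + c₁) * q₂' + (b₂' + c₂') * q₁) - ((b₁' + c₁') * q₂ + (b₂ + c₂) * q₁')))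
      (kap
        ((-b - c + 2 / 3 * ν) * a₁' - (-b' - c' + 2 / 3 * ν') * a₁)
        ((b + 2 / 3 * ν) * b₁' + (x + p) * p₁' + (y + q) * q₁' -
          ((b' + 2 / 3 * ν') * b₁ + (x' + p') * p₁ + (y' + q') * q₁))
        ((c + 2 / 3 * ν) * c₁' + (p - x) * p₁' + (q - y) * q₁' -
          ((c' + 2 / 3 * ν') * c₁ + (p' - x') * p₁ + (q' - y') * q₁))
        (1 / 2 * ((p - x) * b₁' + (p + x) * c₁' + (b + c + 4 / 3 * ν) * p₁') - z * q₁' -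
          (1 / 2 * ((p' - x') * b₁ + (p' + x') * c₁ + (b' + c' + 4 / 3 * ν') * p₁) - z' * q₁))
        (1 / 2 * ((q - y) * b₁' + (q + y) * c₁' + (b + c + 4 / 3 * ν) * q₁') + z * p₁' -
          (1 / 2 * ((q' - y') * b₁ + (q' + y') * c₁ + (b' + c' + 4 / 3 * ν') * q₁) + z' * p₁)))
      (kap
        ((b + c - 2 / 3 * ν) * a₂' - (b' + c' - 2 / 3 * ν') * a₂)
        ((-b - 2 / 3 * ν) * b₂' + (x - p) * p₂' + (y - q) * q₂' -
          ((-b' - 2 / 3 * ν') * b₂ + (x' - p') * p₂ + (y' - q') * q₂))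
        ((-c - 2 / 3 * ν) * c₂' + (-p - x) * p₂' + (-q - y) * q₂' -
          ((-c' - 2 / 3 * ν') * c₂ + (-p' - x') * p₂ + (-q' - y') * q₂))
        (1 / 2 * ((-p - x) * b₂' + (-p + x) * c₂' + (-b - c - 4 / 3 * ν) * p₂') - z * q₂' -
          (1 / 2 * ((-p' - x') * b₂ + (-p' + x') * c₂ + (-b' - c' - 4 / 3 * ν') * p₂) - z' * q₂))
        (1 / 2 * ((-q - y) * b₂' + (-q + y) * c₂' + (-b - c - 4 / 3 * ν) * q₂') + z * p₂' -
          (1 / 2 * ((-q' - y') * b₂ + (-q' + y') * c₂ + (-b' - c' - 4 / 3 * ν') * q₂) + z' * p₂)))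
      (a₁ * a₂' + b₁ * b₂' + c₁ * c₂' + 2 * (p₁ * p₂' + q₁ * q₂') -
        (a₁' * a₂ + b₁' * b₂ + c₁' * c₂ + 2 * (p₁' * p₂ + q₁' * q₂))) := by
  refine LinearMap.ext fun R => ?_
  rw [LinearMap.sub_apply, Module.End.mul_apply, Module.End.mul_apply]
  simp only [PhiK_apply]
  ext1 <;> simp only [sub_X, sub_Y, sub_ξ, sub_η]
  case X | Y =>
    ext1 <;> simp only [sub_ξ₁, sub_ξ₂, sub_ξ₃, sub_x₁, sub_x₂, sub_x₃]
    case x₁ =>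
      ext1 <;> simp only [sub_c0, sub_c1, sub_c2, sub_c3, sub_c4, sub_c5, sub_c6, sub_c7] <;> ring
    case x₂ =>
      simp only [bar_bar, mul_add, mul_sub, mul_smul_comm, e1_mul_e1_mul]
      ext1 <;> simp only [add_c0, add_c1, add_c2, add_c3, add_c4, add_c5, add_c6, add_c7, sub_c0,
          sub_c1, sub_c2,
        sub_c3, sub_c4, sub_c5, sub_c6, sub_c7, neg_c0, neg_c1, neg_c2, neg_c3, neg_c4,
        neg_c5, neg_c6, neg_c7, smul_c0, smul_c1, smul_c2, smul_c3, smul_c4, smul_c5,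
        smul_c6, smul_c7, smul_eq_mul] <;> ring
    case x₃ =>
      rw [← map_sub]
      congr 1
      simp only [bar_bar, mul_add, mul_sub, mul_smul_comm, e1_mul_e1_mul]
      ext1 <;> simp only [add_c0, add_c1, add_c2, add_c3, add_c4, add_c5, add_c6, add_c7, sub_c0,
          sub_c1, sub_c2,
        sub_c3, sub_c4, sub_c5, sub_c6, sub_c7, neg_c0, neg_c1, neg_c2, neg_c3, neg_c4,
        neg_c5, neg_c6, neg_c7, smul_c0, smul_c1, smul_c2, smul_c3, smul_c4, smul_c5,
        smul_c6, smul_c7, smul_eq_mul] <;> ring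
    all_goals ring
  all_goals ring

end FP

/-! ### Linear arithmetic and the operations of `𝔓^C` on invariant vectors -/

namespace J

theorem kap_ξ₁ (a b c p q : ℂ) : (kap a b c p q).ξ₁ = a := rfl
theorem kap_ξ₂ (a b c p q : ℂ) : (kap a b c p q).ξ₂ = b := rfl
theorem kap_ξ₃ (a b c p q : ℂ) : (kap a b c p q).ξ₃ = c := rfl
theorem kap_x₁ (a b c p q : ℂ) : (kap a b c p q).x₁ = ⟨p, q, 0, 0, 0, 0, 0, 0⟩ := rfl

theorem kap_add (a b c p q a' b' c' p' q' : ℂ) : kap a b c p q + kap a' b' c' p' q' =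
    kap (a + a') (b + b') (c + c') (p + p') (q + q') := by
  ext1 <;> simp [kap]
  ext1 <;> simp

theorem kap_sub (a b c p q a' b' c' p' q' : ℂ) : kap a b c p q - kap a' b' c' p' q' =
    kap (a - a') (b - b') (c - c') (p - p') (q - q') := by
  ext1 <;> simp [kap]
  ext1 <;> simp

theorem kap_smul (r a b c p q : ℂ) :
    r • kap a b c p q = kap (r * a) (r * b) (r * c) (r * p) (r * q) := by
  ext1 <;> simp [kap]
  ext1 <;> simp

theorem kap_zero : kap 0 0 0 0 0 = 0 := rfl

theorem opK_sub (x y z a b c p q x' y' z' a' b' c' p' q' : ℂ) :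
    opK x y z a b c p q - opK x' y' z' a' b' c' p' q' =
      opK (x - x') (y - y') (z - z') (a - a') (b - b') (c - c') (p - p') (q - q') := by
  simp only [opK, ← kap_sub, map_sub]
  module

end J

namespace FP

open J Oct

theorem Phi_sub (φ φ' : Module.End ℂ J) (A A' B B' : J) (ν ν' : ℂ) :
    Phi (φ - φ') (A - A') (B - B') (ν - ν') = Phi φ A B ν - Phi φ' A' B' ν' := by
  rw [eq_sub_iff_add_eq, ← Phi_add]
  simp only [sub_add_cancel]

set_option maxHeartbeats 1000000 in
theorem cr_kap (a₁ b₁ c₁ p₁ q₁ a₂ b₂ c₂ p₂ q₂ ξ η a₁' b₁' c₁' p₁' q₁' a₂' b₂' c₂' p₂' q₂' ξ' η' :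
    ℂ) :
    cr ⟨kap a₁ b₁ c₁ p₁ q₁, kap a₂ b₂ c₂ p₂ q₂, ξ, η⟩
      ⟨kap a₁' b₁' c₁' p₁' q₁', kap a₂' b₂' c₂' p₂' q₂', ξ', η'⟩ =
    Phi
      (opK
        (-1 / 4 * ((b₁ - c₁) * p₂' - (b₂' - c₂') * p₁ + (b₁' - c₁') * p₂ - (b₂ - c₂) * p₁'))
        (-1 / 4 * ((b₁ - c₁) * q₂' - (b₂' - c₂') * q₁ + (b₁' - c₁') * q₂ - (b₂ - c₂) * q₁'))
        (-1 / 2 * (q₁ * p₂' - p₁ * q₂' + q₁' * p₂ - p₁' * q₂))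
        (-1 / 6 * (2 * (a₁ * a₂') - b₁ * b₂' - c₁ * c₂' - 2 * (p₁ * p₂' + q₁ * q₂') +
          (2 * (a₁' * a₂) - b₁' * b₂ - c₁' * c₂ - 2 * (p₁' * p₂ + q₁' * q₂))))
        (-1 / 6 * (2 * (b₁ * b₂') - a₁ * a₂' - c₁ * c₂' + p₁ * p₂' + q₁ * q₂' +
          (2 * (b₁' * b₂) - a₁' * a₂ - c₁' * c₂ + p₁' * p₂ + q₁' * q₂)))
        (-1 / 6 * (2 * (c₁ * c₂') - a₁ * a₂' - b₁ * b₂' + p₁ * p₂' + q₁ * q₂' +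
          (2 * (c₁' * c₂) - a₁' * a₂ - b₁' * b₂ + p₁' * p₂ + q₁' * q₂)))
        (-1 / 4 * ((b₁ + c₁) * p₂' + (b₂' + c₂') * p₁ + (b₁' + c₁') * p₂ + (b₂ + c₂) * p₁'))
        (-1 / 4 * ((b₁ + c₁) * q₂' + (b₂' + c₂') * q₁ + (b₁' + c₁') * q₂ + (b₂ + c₂) * q₁')))
      (kap
        (-1 / 4 * (b₂ * c₂' + c₂ * b₂' - 2 * (p₂ * p₂' + q₂ * q₂') - ξ * a₁' - ξ' * a₁))
        (-1 / 4 * (c₂ * a₂' + a₂ * c₂' - ξ * b₁' - ξ' * b₁))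
        (-1 / 4 * (a₂ * b₂' + b₂ * a₂' - ξ * c₁' - ξ' * c₁))
        (-1 / 4 * (-a₂ * p₂' - a₂' * p₂ - ξ * p₁' - ξ' * p₁))
        (-1 / 4 * (-a₂ * q₂' - a₂' * q₂ - ξ * q₁' - ξ' * q₁)))
      (kap
        (1 / 4 * (b₁ * c₁' + c₁ * b₁' - 2 * (p₁ * p₁' + q₁ * q₁') - η * a₂' - η' * a₂))
        (1 / 4 * (c₁ * a₁' + a₁ * c₁' - η * b₂' - η' * b₂))
        (1 / 4 * (a₁ * b₁' + b₁ * a₁' - η * c₂' - η' * c₂))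
        (1 / 4 * (-a₁ * p₁' - a₁' * p₁ - η * p₂' - η' * p₂))
        (1 / 4 * (-a₁ * q₁' - a₁' * q₁ - η * q₂' - η' * q₂)))
      (1 / 8 * (a₁ * a₂' + b₁ * b₂' + c₁ * c₂' + 2 * (p₁ * p₂' + q₁ * q₂') +
        (a₁' * a₂ + b₁' * b₂ + c₁' * c₂ + 2 * (p₁' * p₂ + q₁' * q₂)) -
        3 * (ξ * η' + ξ' * η))) := by
  simp only [cr, vee_kap, cross_kap_kap, form_kap, kap_ξ₁, kap_ξ₂, kap_ξ₃, kap_x₁, kap_smul,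
    opK_smul, opK_add, kap_sub]
  congr 1
  · congr 1 <;> ring
  · congr 1 <;> ring
  · congr 1 <;> ring

theorem skew_kap (a₁ b₁ c₁ p₁ q₁ a₂ b₂ c₂ p₂ q₂ ξ η a₁' b₁' c₁' p₁' q₁' a₂' b₂' c₂' p₂' q₂' ξ' η' :
    ℂ) :
    skew ⟨kap a₁ b₁ c₁ p₁ q₁, kap a₂ b₂ c₂ p₂ q₂, ξ, η⟩
      ⟨kap a₁' b₁' c₁' p₁' q₁', kap a₂' b₂' c₂' p₂' q₂', ξ', η'⟩ =
    a₁ * a₂' + b₁ * b₂' + c₁ * c₂' + 2 * (p₁ * p₂' + q₁ * q₂') -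
      (a₁' * a₂ + b₁' * b₂ + c₁' * c₂ + 2 * (p₁' * p₂ + q₁' * q₂)) + ξ * η' - ξ' * η := by
  simp only [skew, form_kap, kap_ξ₁, kap_ξ₂, kap_ξ₃, kap_x₁]

theorem PhiK_kap (x y z b c p q a₁ b₁ c₁ p₁ q₁ a₂ b₂ c₂ p₂ q₂ ν
    a₁' b₁' c₁' p₁' q₁' a₂' b₂' c₂' p₂' q₂' ξ' η' : ℂ) :
    Phi (opK x y z (-b - c) b c p q) (kap a₁ b₁ c₁ p₁ q₁) (kap a₂ b₂ c₂ p₂ q₂) ν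
      ⟨kap a₁' b₁' c₁' p₁' q₁', kap a₂' b₂' c₂' p₂' q₂', ξ', η'⟩ =
    ⟨kap
      ((-b - c - 1 / 3 * ν) * a₁' + b₂ * c₂' + c₂ * b₂' - 2 * (p₂ * p₂' + q₂ * q₂') + η' * a₁)
      ((b - 1 / 3 * ν) * b₁' + (x + p) * p₁' + (y + q) * q₁' + c₂ * a₂' + a₂ * c₂' + η' * b₁)
      ((c - 1 / 3 * ν) * c₁' + (p - x) * p₁' + (q - y) * q₁' + a₂ * b₂' + b₂ * a₂' + η' * c₁)
      (1 / 2 * ((p - x) * b₁' + (p + x) * c₁' + (b + c - 2 / 3 * ν) * p₁') -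
          z * q₁' - a₂ * p₂' - a₂' * p₂ + η' * p₁)
      (1 / 2 * ((q - y) * b₁' + (q + y) * c₁' + (b + c - 2 / 3 * ν) * q₁') +
          z * p₁' - a₂ * q₂' - a₂' * q₂ + η' * q₁),
     kap
      ((b + c + 1 / 3 * ν) * a₂' + b₁ * c₁' + c₁ * b₁' - 2 * (p₁ * p₁' + q₁ * q₁') + ξ' * a₂)
      ((-b + 1 / 3 * ν) * b₂' + (x - p) * p₂' + (y - q) * q₂' + c₁ * a₁' + a₁ * c₁' + ξ' * b₂)
      ((-c + 1 / 3 * ν) * c₂' + (-p - x) * p₂' + (-q - y) * q₂' + a₁ * b₁' + b₁ * a₁' + ξ' * c₂)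
      (1 / 2 * ((-p - x) * b₂' + (-p + x) * c₂' + (-b - c + 2 / 3 * ν) * p₂') -
          z * q₂' - a₁ * p₁' - a₁' * p₁ + ξ' * p₂)
      (1 / 2 * ((-q - y) * b₂' + (-q + y) * c₂' + (-b - c + 2 / 3 * ν) * q₂') +
          z * p₂' - a₁ * q₁' - a₁' * q₁ + ξ' * q₂),
     a₁ * a₂' + b₁ * b₂' + c₁ * c₂' + 2 * (p₁ * p₂' + q₁ * q₂') + ν * ξ',
     a₂ * a₁' + b₂ * b₁' + c₂ * c₁' + 2 * (p₂ * p₁' + q₂ * q₁') - ν * η'⟩ := by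
  rw [PhiK_apply]
  simp only [kap, mul_zero, map_zero, smul_zero, add_zero, sub_zero]

end FP

/-! ### Matrix coordinates and the bracket of `𝔢₈^C` -/

namespace E8

open J FP Oct

/-- The element of `𝔢₈^C` with entries the coordinates of the strictly upper triangular part of a
`10 × 10` matrix. -/
def toE8 (N : Matrix (Fin 10) (Fin 10) ℂ) : E8 where
  Φ := Phi
    (opK (-N 0 8) (-N 0 9) (-N 8 9)
      (-(-N 0 1 - 1 / 3 * (N 4 5 - N 2 3 - N 6 7)) - (N 0 1 - 1 / 3 * (N 4 5 - N 2 3 - N 6 7)))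
      (-N 0 1 - 1 / 3 * (N 4 5 - N 2 3 - N 6 7))
      (N 0 1 - 1 / 3 * (N 4 5 - N 2 3 - N 6 7)) (-N 1 8) (-N 1 9))
    (kap (1 / 2 * (N 4 6 - N 5 6 + N 4 7 - N 5 7)) (1 / 2 * (-N 0 2 - N 1 2 - N 0 3 - N 1 3))
      (1 / 2 * (N 0 2 - N 1 2 + N 0 3 - N 1 3)) (1 / 2 * (-N 2 8 - N 3 8))
      (1 / 2 * (-N 2 9 - N 3 9)))
    (kap (1 / 2 * (-N 4 6 - N 5 6 + N 4 7 + N 5 7)) (1 / 2 * (-N 0 2 + N 1 2 + N 0 3 - N 1 3))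
      (1 / 2 * (N 0 2 + N 1 2 - N 0 3 - N 1 3)) (1 / 2 * (-N 2 8 + N 3 8))
      (1 / 2 * (-N 2 9 + N 3 9)))
    (N 2 3 + 1 / 2 * (N 4 5 - N 6 7))
  P := ⟨kap (N 2 6 - N 3 6 + N 2 7 - N 3 7) (-N 0 4 - N 1 4 - N 0 5 - N 1 5)
      (N 0 4 - N 1 4 + N 0 5 - N 1 5) (-N 4 8 - N 5 8) (-N 4 9 - N 5 9),
    kap (N 2 4 + N 3 4 + N 2 5 + N 3 5) (-N 0 6 + N 1 6 - N 0 7 + N 1 7)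
      (N 0 6 + N 1 6 + N 0 7 + N 1 7) (-N 6 8 - N 7 8) (-N 6 9 - N 7 9),
    -N 2 6 - N 3 6 - N 2 7 - N 3 7, -N 2 4 + N 3 4 - N 2 5 + N 3 5⟩
  Q := ⟨kap (N 2 4 - N 3 4 - N 2 5 + N 3 5) (N 0 6 + N 1 6 - N 0 7 - N 1 7)
      (-N 0 6 + N 1 6 + N 0 7 - N 1 7) (N 6 8 - N 7 8) (N 6 9 - N 7 9),
    kap (-N 2 6 - N 3 6 + N 2 7 + N 3 7) (-N 0 4 + N 1 4 + N 0 5 - N 1 5)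
      (N 0 4 + N 1 4 - N 0 5 - N 1 5) (-N 4 8 + N 5 8) (-N 4 9 + N 5 9),
    -N 2 4 - N 3 4 + N 2 5 + N 3 5, N 2 6 - N 3 6 - N 2 7 + N 3 7⟩
  r := 1 / 2 * (-N 4 5 - N 6 7)
  s := 1 / 2 * (-N 4 6 - N 5 6 - N 4 7 - N 5 7)
  t := 1 / 2 * (N 4 6 - N 5 6 - N 4 7 + N 5 7)

/-- The signs `wᵢ²` of the weights `wᵢ`. -/
def sgn : Fin 10 → ℂ := ![1, -1, -1, 1, 1, -1, 1, -1, 1, 1]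

theorem mul_sgn_mul_apply (N N' : Matrix (Fin 10) (Fin 10) ℂ) (i j : Fin 10) :
    (N * Matrix.diagonal sgn * N') i j = N i 0 * N' 0 j - N i 1 * N' 1 j - N i 2 * N' 2 j +
      N i 3 * N' 3 j + N i 4 * N' 4 j - N i 5 * N' 5 j + N i 6 * N' 6 j - N i 7 * N' 7 j +
      N i 8 * N' 8 j + N i 9 * N' 9 j := by
  simp only [Matrix.mul_apply]
  simp [Fin.sum_univ_succ, sgn]
  ring

set_option maxHeartbeats 4000000 in
-- The signs in the middle of the product are what remains after the factors `i` have been moved out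
-- of the coordinates. All components become polynomial identities with rational coefficients in the
-- entries above the diagonal.
theorem bracket_toE8 (N N' : Matrix (Fin 10) (Fin 10) ℂ) (h : ∀ i j, j < i → N i j = -N j i)
    (h' : ∀ i j, j < i → N' i j = -N' j i) (d : ∀ i, N i i = 0) (d' : ∀ i, N' i i = 0) :
    bracket (toE8 N) (toE8 N') =
      toE8 (N * Matrix.diagonal sgn * N' - N' * Matrix.diagonal sgn * N) := by
  set M := N * Matrix.diagonal sgn * N' - N' * Matrix.diagonal sgn * N with hM
  have hm : ∀ i j, M i j = N i 0 * N' 0 j - N i 1 * N' 1 j - N i 2 * N' 2 j +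
      N i 3 * N' 3 j + N i 4 * N' 4 j - N i 5 * N' 5 j + N i 6 * N' 6 j - N i 7 * N' 7 j +
      N i 8 * N' 8 j + N i 9 * N' 9 j -
      (N' i 0 * N 0 j - N' i 1 * N 1 j - N' i 2 * N 2 j +
      N' i 3 * N 3 j + N' i 4 * N 4 j - N' i 5 * N 5 j + N' i 6 * N 6 j - N' i 7 * N 7 j +
      N' i 8 * N 8 j + N' i 9 * N 9 j) := fun i j => by
    rw [hM, Matrix.sub_apply, mul_sgn_mul_apply, mul_sgn_mul_apply]
  clear_value M
  ext1
  · simp only [bracket, toE8, PhiK_commutator, cr_kap]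
    rw [← Phi_add, ← Phi_sub]
    -- The side condition `j < i`, decided by `Fin.reduceLT`, lets `h` and `h'` rewrite only from
    -- the lower triangle to the upper one, so skew-symmetry cannot loop.
    simp only [opK_add, opK_sub, kap_add, kap_sub, hm, h, h', d, d', Fin.reduceLT]
    congr 1
    · congr 1
      all_goals ring
    · congr 1 <;> ring
    · congr 1 <;> ring
    · ring
  · simp only [bracket, toE8, PhiK_kap, hm, h, h', d, d', Fin.reduceLT]
    ext1 <;> simp only [add_X, sub_X, smul_X, add_Y, sub_Y, smul_Y, add_ξ, sub_ξ, smul_ξ, add_η,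
        sub_η, smul_η, kap_smul, kap_add, kap_sub, smul_eq_mul]
    · congr 1 <;> ring
    · congr 1 <;> ring
    all_goals ring
  · simp only [bracket, toE8, PhiK_kap, hm, h, h', d, d', Fin.reduceLT]
    ext1 <;> simp only [add_X, sub_X, smul_X, add_Y, sub_Y, smul_Y, add_ξ, sub_ξ, smul_ξ, add_η,
        sub_η, smul_η, kap_smul, kap_add, kap_sub, smul_eq_mul]
    · congr 1 <;> ring
    · congr 1 <;> ring
    all_goals ring
  all_goals simp only [bracket, toE8, skew_kap, hm, h, h', d, d', Fin.reduceLT]; ring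

end E8

/-! ### The maps `σ'₄`, `λ` and `τ` on the invariant family -/

namespace Oct

theorem tau_bar (x : Oct) : tau (bar x) = bar (tau x) := by
  ext1 <;> simp [tau]

theorem tau_mul (x y : Oct) : tau (x * y) = tau x * tau y := by
  ext1 <;> simp [tau]

theorem tau_e1 : tau e1 = e1 := by
  ext1 <;> simp [tau, e1]

theorem tau_tau (x : Oct) : tau (tau x) = x := by
  ext1 <;> simp [tau]

end Oct

namespace J

open Oct

theorem sigma_apply (X : J) : J.sigma X =
    ⟨X.ξ₁, X.ξ₂, X.ξ₃, ⟨X.x₁.c0, X.x₁.c1, -X.x₁.c2, -X.x₁.c3, -X.x₁.c4, -X.x₁.c5, -X.x₁.c6,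
      -X.x₁.c7⟩, e1 * X.x₂, bar (e1 * bar X.x₃)⟩ := by
  have h : -(e1 * X.x₁ * e1) = ⟨X.x₁.c0, X.x₁.c1, -X.x₁.c2, -X.x₁.c3, -X.x₁.c4, -X.x₁.c5,
      -X.x₁.c6, -X.x₁.c7⟩ := by
    ext1 <;> simp [e1]
  rw [← h, bar_mul, bar_bar, bar_e1, mul_neg]
  rfl

theorem tau_apply (X : J) : J.tau X =
    ⟨star X.ξ₁, star X.ξ₂, star X.ξ₃, Oct.tau X.x₁, Oct.tau X.x₂, Oct.tau X.x₃⟩ := rfl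

theorem form_symm (X Y : J) : form X Y = form Y X := by
  rw [form_apply, form_apply, re_mul_bar_comm Y.x₁, re_mul_bar_comm Y.x₂, re_mul_bar_comm Y.x₃]
  ring

/-- Transposing twice is the identity because the form is symmetric. -/
theorem transpose_neg_transpose (φ : Module.End ℂ J) : transpose (-transpose φ) = -φ :=
  transpose_unique fun X Y => by
    rw [LinearMap.neg_apply, LinearMap.neg_apply, map_neg, map_neg, LinearMap.neg_apply,
      form_symm X, form_transpose, form_symm]

end J

namespace FP

open J Oct

theorem lam_conj_Phi (φ : Module.End ℂ J) (A B : J) (ν : ℂ) :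
    lam.conj (Phi φ A B ν) = Phi (-transpose φ) (-B) (-A) (-ν) := by
  refine LinearMap.ext fun R => ?_
  rw [LinearEquiv.conj_apply_apply, Phi_apply, Phi_apply, transpose_neg_transpose]
  ext1 <;> simp [lam]
  · module
  · module
  · ring
  · ring

theorem sigma_apply (R : FP) : FP.sigma R = ⟨J.sigma R.X, J.sigma R.Y, R.ξ, R.η⟩ := rfl

theorem tau_apply (R : FP) : FP.tau R = ⟨J.tau R.X, J.tau R.Y, star R.ξ, star R.η⟩ := rfl

/-- On `x₂` and on the conjugate of `x₃`, `σ'₄` is left multiplication by `e₁`, and the operator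
involves no other octonion products there. On `x₁`, `σ'₄` fixes the span of `1, e₁` and changes the
sign of `e₂, …, e₇`, a splitting that the operator respects. -/
theorem sigma_conj_PhiK (x y z b c p q a₁ b₁ c₁ p₁ q₁ a₂ b₂ c₂ p₂ q₂ ν : ℂ) :
    FP.sigma.conj
      (Phi (opK x y z (-b - c) b c p q) (kap a₁ b₁ c₁ p₁ q₁) (kap a₂ b₂ c₂ p₂ q₂) ν) =
    Phi (opK x y z (-b - c) b c p q) (kap a₁ b₁ c₁ p₁ q₁) (kap a₂ b₂ c₂ p₂ q₂) ν := by
  refine LinearMap.ext fun R => ?_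
  -- Writing the argument as an image of `σ'₄` turns the claim into a commutation relation, without
  -- the inverse of `σ'₄`.
  obtain ⟨S, rfl⟩ := FP.sigma.surjective R
  rw [LinearEquiv.conj_apply_apply, LinearEquiv.symm_apply_apply, PhiK_apply, PhiK_apply]
  simp only [FP.sigma_apply, J.sigma_apply]
  ext1
  case X | Y =>
    ext1 <;> simp only
    case x₁ => ext1 <;> simp only <;> ring
    case x₂ =>
      simp only [bar_bar, mul_add, mul_sub, mul_smul_comm, e1_mul_e1_mul]
    case x₃ =>
      simp only [bar_bar, mul_add, mul_sub, mul_smul_comm, e1_mul_e1_mul]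
  all_goals rfl

theorem tau_PhiK_tau (x y z b c p q a₁ b₁ c₁ p₁ q₁ a₂ b₂ c₂ p₂ q₂ ν : ℂ) :
    FP.tau.comp (LinearMap.comp
      (Phi (opK x y z (-b - c) b c p q) (kap a₁ b₁ c₁ p₁ q₁) (kap a₂ b₂ c₂ p₂ q₂) ν) FP.tau) =
    Phi (opK (star x) (star y) (star z) (-star b - star c) (star b) (star c) (star p) (star q))
      (kap (star a₁) (star b₁) (star c₁) (star p₁) (star q₁))
      (kap (star a₂) (star b₂) (star c₂) (star p₂) (star q₂)) (star ν) := by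
  refine LinearMap.ext fun R => ?_
  rw [LinearMap.comp_apply, LinearMap.comp_apply, PhiK_apply, PhiK_apply]
  simp only [FP.tau_apply, J.tau_apply]
  ext1
  case X | Y =>
    ext1 <;> simp only
    case x₁ => ext1 <;> simp [Oct.tau, map_ofNat]
    case x₂ | x₃ => simp [tau_bar, tau_mul, tau_e1, tau_tau, map_ofNat]
    all_goals simp [Oct.tau]
  all_goals simp [Oct.tau]

end FP

/-! ### Linearity, the real structure and the elements `R_{ij}` in matrix coordinates -/

namespace E8

open J FP Oct
theorem toE8_add (N N' : Matrix (Fin 10) (Fin 10) ℂ) : toE8 (N + N') = toE8 N + toE8 N' := by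
  ext1 <;> simp only [toE8, add_Φ, add_P, add_Q, add_r, add_s, add_t, ← Phi_add, opK_add, kap_add,
    Matrix.add_apply]
  · congr 1
    · congr 1 <;> ring
    · congr 1 <;> ring
    · congr 1 <;> ring
    · ring
  · ext1 <;> simp only [add_X, add_Y, add_ξ, add_η, kap_add]
    · congr 1 <;> ring
    · congr 1 <;> ring
    all_goals ring
  · ext1 <;> simp only [add_X, add_Y, add_ξ, add_η, kap_add]
    · congr 1 <;> ring
    · congr 1 <;> ring
    all_goals ring
  all_goals ring

theorem toE8_smul (r : ℂ) (N : Matrix (Fin 10) (Fin 10) ℂ) : toE8 (r • N) = r • toE8 N := by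
  ext1 <;> simp only [toE8, smul_Φ, smul_P, smul_Q, smul_r, smul_s, smul_t, ← Phi_smul, opK_smul,
    kap_smul, Matrix.smul_apply, smul_eq_mul]
  · congr 1
    · congr 1 <;> ring
    · congr 1 <;> ring
    · congr 1 <;> ring
    · ring
  · ext1 <;> simp only [smul_X, smul_Y, smul_ξ, smul_η, kap_smul, smul_eq_mul]
    · congr 1 <;> ring
    · congr 1 <;> ring
    all_goals ring
  · ext1 <;> simp only [smul_X, smul_Y, smul_ξ, smul_η, kap_smul, smul_eq_mul]
    · congr 1 <;> ring
    · congr 1 <;> ring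
    all_goals ring
  all_goals ring

end E8

namespace J

open Oct
theorem E1_eq : E1 = kap 1 0 0 0 0 := rfl
theorem E2_eq : E2 = kap 0 1 0 0 0 := rfl
theorem E3_eq : E3 = kap 0 0 1 0 0 := rfl
theorem F1_one_eq : F1 one = kap 0 0 0 1 0 := rfl
theorem F1_e1_eq : F1 e1 = kap 0 0 0 0 1 := rfl

theorem jordan_kap_eq (a b c p q : ℂ) : jordan (kap a b c p q) = opK 0 0 0 a b c p q := by
  simp only [opK, zero_smul, zero_add]

theorem tildeA1_one_eq : tildeA1 one = opK 1 0 0 0 0 0 0 0 := by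
  simp only [opK, zero_smul, one_smul, add_zero, kap_zero, map_zero]

theorem tildeA1_e1_eq : tildeA1 e1 = opK 0 1 0 0 0 0 0 0 := by
  simp only [opK, zero_smul, one_smul, add_zero, zero_add, kap_zero, map_zero]

theorem opK_zero : opK 0 0 0 0 0 0 0 0 = 0 := by
  simp only [opK, zero_smul, add_zero, kap_zero, map_zero]

theorem kap_neg (a b c p q : ℂ) : -kap a b c p q = kap (-a) (-b) (-c) (-p) (-q) := by
  rw [← neg_one_smul ℂ, kap_smul]
  simp only [neg_one_mul]

theorem opK_neg (x y z a b c p q : ℂ) :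
    -opK x y z a b c p q = opK (-x) (-y) (-z) (-a) (-b) (-c) (-p) (-q) := by
  rw [← neg_one_smul ℂ, opK_smul]
  simp only [neg_one_mul]

end J

namespace E8

open J FP Oct

theorem sigma_toE8 (N : Matrix (Fin 10) (Fin 10) ℂ) : sigma (toE8 N) = toE8 N := by
  ext1 <;> simp only [sigma, toE8, sigma_conj_PhiK]
  all_goals
    simp only [FP.sigma_apply, J.sigma_apply, kap, neg_zero, mul_zero, map_zero]

theorem tau_kap (a b c p q : ℂ) :
    J.tau (kap a b c p q) = kap (star a) (star b) (star c) (star p) (star q) := by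
  simp only [J.tau_apply, kap]
  congr 1
  · ext1 <;> simp [Oct.tau]
  all_goals exact map_zero _

/-- The entries above the diagonal are fixed exactly when each `N i j` is a real multiple of `wᵢ
wⱼ`; this is how the weights single out the compact form. -/
theorem tau_lamOmega_toE8 (N : Matrix (Fin 10) (Fin 10) ℂ) :
    tau (lamOmega (toE8 N)) = toE8 (Matrix.of fun i j => sgn i * sgn j * star (N i j)) := by
  ext1
  · simp only [tau, lamOmega, toE8, lam_conj_Phi, transpose_opK, opK_neg, kap_neg, Matrix.of_apply]
    rw [show ∀ b c : ℂ, -(-b - c) = - -b - -c from fun _ _ => by ring, tau_PhiK_tau]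
    congr 1
    · congr 1 <;> simp [sgn] <;> ring
    · congr 1 <;> simp [sgn] <;> ring
    · congr 1 <;> simp [sgn] <;> ring
    · simp [sgn]; ring
  · simp only [tau, lamOmega, toE8, FP.tau_apply, lam, tau_kap, kap_neg, LinearEquiv.coe_mk,
      LinearMap.coe_mk, AddHom.coe_mk, Matrix.of_apply]
    congr 1
    · congr 1 <;> simp [sgn] <;> ring
    · congr 1 <;> simp [sgn] <;> ring
    · simp [sgn]
    · simp [sgn]; ring
  · simp only [tau, lamOmega, toE8, FP.tau_apply, FP.neg_X, FP.neg_Y, FP.neg_ξ, FP.neg_η, lam,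
      tau_kap, kap_neg, LinearEquiv.coe_mk, LinearMap.coe_mk, AddHom.coe_mk, Matrix.of_apply]
    congr 1
    · congr 1 <;> simp [sgn] <;> ring
    · congr 1 <;> simp [sgn] <;> ring
    · simp [sgn]; ring
    · simp [sgn]; ring
  all_goals simp [tau, lamOmega, toE8, sgn]; ring

open Complex in
/-- The weights `wᵢ`. -/
def wt : Fin 10 → ℂ := ![1, I, I, 1, 1, I, 1, I, 1, 1]

theorem fp_zero_eq : (0 : FP) = ⟨kap 0 0 0 0 0, kap 0 0 0 0 0, 0, 0⟩ := rfl

theorem end_zero_eq : (0 : Module.End ℂ FP) =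
    Phi (opK 0 0 0 0 0 0 0 0) (kap 0 0 0 0 0) (kap 0 0 0 0 0) 0 := by
  have h := Phi_smul 0 0 0 0 0
  rw [zero_smul, zero_smul, zero_mul, zero_smul] at h
  rw [opK_zero, kap_zero, h]

open Complex in
set_option maxHeartbeats 4000000 in
theorem toE8_soG (i j : Fin 10) (h : i < j) :
    toE8 (Matrix.of fun a b => wt a * wt b * (soG ℂ i j).1 a b) = R i j := by
  have hw : wt 0 = 1 ∧ wt 1 = I ∧ wt 2 = I ∧ wt 3 = 1 ∧ wt 4 = 1 ∧ wt 5 = I ∧ wt 6 = 1 ∧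
      wt 7 = I ∧ wt 8 = 1 ∧ wt 9 = 1 := ⟨rfl, rfl, rfl, rfl, rfl, rfl, rfl, rfl, rfl, rfl⟩
  obtain ⟨w0, w1, w2, w3, w4, w5, w6, w7, w8, w9⟩ := hw
  fin_cases i <;> fin_cases j <;> first
    | exact absurd h (by decide)
    | (clear h
       simp only [Fin.reduceFinMk, Fin.zero_eta, Fin.mk_one, toE8, soG, Matrix.of_apply,
        Matrix.sub_apply, Matrix.single_apply, Fin.reduceEq, Fin.isValue, zero_ne_one, one_ne_zero,
        and_true, and_false, and_self, if_true, if_false, sub_zero, sub_self,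
        mul_zero, _root_.mul_one, neg_zero, add_zero, zero_sub, neg_neg, zero_add, w0, w1, w2, w3,
            w4, w5,
        w6, w7, w8, w9, _root_.one_mul, I_mul_I]
       -- Every constituent, including the zero vectors and the zero operator, is brought to the
       -- form `kap`, `opK` or `Phi`, so that the two sides can be compared argument by argument.
       simp only [R, E1_eq, E2_eq, E3_eq, F1_one_eq, F1_e1_eq, kap_sub, kap_smul, kap_add,
        opK_commutator, tildeA1_e1_eq, tildeA1_one_eq, jordan_kap_eq, kap_neg, opK_neg,
        vee_kap, opK_smul, ← kap_zero, ← opK_zero, fp_zero_eq, end_zero_eq]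
       ext1 <;> dsimp only
       all_goals first | ring1 | (congr 1 <;> first | ring1 | (congr 1 <;> ring1)))

end E8

/-! ### Commutation of `𝔰𝔬(6, C)` with the invariant family -/

namespace J

open Oct

set_option maxHeartbeats 4000000 in
theorem tildeA1_mem_f4 (a : Oct) : tildeA1 a ∈ f4 := by
  intro X Y
  rcases X with ⟨r, s, t, x, y, z⟩
  rcases Y with ⟨r', s', t', x', y', z'⟩
  simp only [jordan_apply, tildeA1_apply]
  ext1 <;> simp only [add_ξ₁, add_ξ₂, add_ξ₃, add_x₁, add_x₂, add_x₃]
  case x₁ | x₂ | x₃ =>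
    ext1 <;> simp only [re_mul_bar, bar_c0, bar_c1, bar_c2, bar_c3, bar_c4, bar_c5, bar_c6,
        bar_c7, smul_c0, smul_c1, smul_c2, smul_c3, smul_c4, smul_c5, smul_c6, smul_c7,
      add_c0, add_c1, add_c2, add_c3, add_c4, add_c5, add_c6, add_c7, mul_c0, mul_c1, mul_c2,
          mul_c3, mul_c4, mul_c5, mul_c6, mul_c7, smul_eq_mul] <;> ring
  all_goals
   simp only [re_mul_bar, bar_c0, bar_c1, bar_c2, bar_c3, bar_c4, bar_c5, bar_c6, bar_c7, smul_c0,
       smul_c1, smul_c2, smul_c3, smul_c4, smul_c5, smul_c6, smul_c7,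
      add_c0, add_c1, add_c2, add_c3, add_c4, add_c5, add_c6, add_c7, mul_c0, mul_c1, mul_c2,
          mul_c3, mul_c4, mul_c5, mul_c6, mul_c7, smul_eq_mul]
   ring
end J

namespace Oct

theorem mk_zero : (⟨0, 0, 0, 0, 0, 0, 0, 0⟩ : Oct) = 0 := rfl

end Oct

namespace J

open Oct

theorem jordan_comm (X Y : J) : jordan X Y = jordan Y X := by
  simp only [jordan, LinearMap.mk₂_apply, add_comm]

theorem jordan_E (X : J) : jordan X E = X := by
  rw [jordan_comm, show E = kap 1 1 1 0 0 from rfl, jordan_kap]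
  ext1 <;> simp only
  case x₂ => module
  case x₃ =>
    simp only [map_add, map_smul, bar_bar]
    module
  case x₁ =>
    rw [mk_zero]
    module
  all_goals ring

theorem f4_apply_E {D : Module.End ℂ J} (h : D ∈ f4) : D E = 0 := by
  have := h E E
  rw [jordan_E, jordan_E, jordan_comm, jordan_E] at this
  exact left_eq_add.1 this

theorem commutator_mem_f4 {D D' : Module.End ℂ J} (h : D ∈ f4) (h' : D' ∈ f4) :
    D * D' - D' * D ∈ f4 := fun X Y => by
  simp only [LinearMap.sub_apply, Module.End.mul_apply, h' X Y, h X Y, map_add, map_sub,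
    h _ _, h' _ _]
  abel

/-- This is `[D, T̃] = (DT)~` in the case `D T = 0`. -/
theorem f4_mul_jordan {D : Module.End ℂ J} (h : D ∈ f4) {T : J} (hT : D T = 0) :
    D * jordan T = jordan T * D := LinearMap.ext fun X => by
  rw [Module.End.mul_apply, Module.End.mul_apply, h, hT, map_zero, LinearMap.zero_apply, zero_add]

theorem opK_mem_e6 (x y z b c p q : ℂ) : opK x y z (-b - c) b c p q ∈ e6 := by
  refine Submodule.add_mem_sup (add_mem (add_mem (f4.smul_mem _ (tildeA1_mem_f4 _))
    (f4.smul_mem _ (tildeA1_mem_f4 _))) (f4.smul_mem _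
      (commutator_mem_f4 (tildeA1_mem_f4 _) (tildeA1_mem_f4 _)))) ⟨_, ?_, rfl⟩
  change -b - c + b + c = 0
  ring

variable {D : Module.End ℂ J}

theorem so6C_apply_kap (h : D ∈ so6C) (a b c p q : ℂ) : D (kap a b c p q) = 0 := by
  obtain ⟨-, h1, h2, h3, h4, h5⟩ := h
  have : kap a b c p q = a • E1 + b • E2 + c • E3 + p • F1 one + q • F1 e1 := by
    simp only [E1_eq, E2_eq, E3_eq, F1_one_eq, F1_e1_eq, kap_smul, kap_add]
    congr 1 <;> ring
  simp only [this, map_add, map_smul, h1, h2, h3, h4, h5, smul_zero, add_zero]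

/-- `D` commutes with multiplication by every `kap`, since it kills these vectors; the derivations
in `opK` are commutators of such multiplications, so `D` commutes with them too. -/
theorem so6C_mul_opK (h : D ∈ so6C) (x y z a b c p q : ℂ) :
    D * opK x y z a b c p q = opK x y z a b c p q * D := by
  have k : ∀ a b c p q, Commute D (opK 0 0 0 a b c p q) := fun a b c p q => by
    rw [← jordan_kap_eq]
    exact f4_mul_jordan h.1 (so6C_apply_kap h ..)
  have m : ∀ a b c p q a' b' c' p' q', Commute D (opK 0 0 0 a b c p q * opK 0 0 0 a' b' c' p' q' -
      opK 0 0 0 a' b' c' p' q' * opK 0 0 0 a b c p q) := fun a b c p q a' b' c' p' q' =>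
    ((k ..).mul_right (k ..)).sub_right ((k ..).mul_right (k ..))
  -- The factor `2` cancels the `1/2` in `opK_commutator`: bracketing with `Ẽ₂` produces the `x`,
  -- `y` part, and bracketing multiplications by `F₁(e₁)` and `F₁(1)` the `z` part.
  have e : opK x y z a b c p q =
      (opK 0 0 0 0 1 0 0 0 * opK 0 0 0 0 0 0 (2 * x) (2 * y) -
        opK 0 0 0 0 0 0 (2 * x) (2 * y) * opK 0 0 0 0 1 0 0 0) +
      (opK 0 0 0 0 0 0 0 z * opK 0 0 0 0 0 0 1 0 - opK 0 0 0 0 0 0 1 0 * opK 0 0 0 0 0 0 0 z) +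
      opK 0 0 0 a b c p q := by
    simp only [opK_commutator, opK_add]
    congr 1 <;> ring
  rw [e]
  exact ((m ..).add_right (m ..)).add_right (k ..)

/-- For `L = Ẽₖ` the eigenvalues are `0, 1/2, 1`, so `2L² - L` is the projection onto `ℂ Eₖ`. It
commutes with `D`, and `D` kills its image. -/
theorem so6C_diag (h : D ∈ so6C) (X : J) : (D X).ξ₁ = 0 ∧ (D X).ξ₂ = 0 ∧ (D X).ξ₃ = 0 := by
  have k : ∀ a b c, D (jordan (kap a b c 0 0) X) = jordan (kap a b c 0 0) (D X) := fun a b c => by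
    rw [h.1, so6C_apply_kap h, map_zero, LinearMap.zero_apply, zero_add]
  have l : ∀ a b c, D (jordan (kap a b c 0 0) (jordan (kap a b c 0 0) X)) =
      jordan (kap a b c 0 0) (jordan (kap a b c 0 0) (D X)) := fun a b c => by
    rw [h.1, so6C_apply_kap h, map_zero, LinearMap.zero_apply, zero_add, k]
  have e : ∀ Y : J, (2 : ℂ) • jordan (kap 1 0 0 0 0) (jordan (kap 1 0 0 0 0) Y) -
      jordan (kap 1 0 0 0 0) Y = kap Y.ξ₁ 0 0 0 0 ∧
      (2 : ℂ) • jordan (kap 0 1 0 0 0) (jordan (kap 0 1 0 0 0) Y) -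
      jordan (kap 0 1 0 0 0) Y = kap 0 Y.ξ₂ 0 0 0 ∧
      (2 : ℂ) • jordan (kap 0 0 1 0 0) (jordan (kap 0 0 1 0 0) Y) -
      jordan (kap 0 0 1 0 0) Y = kap 0 0 Y.ξ₃ 0 0 := fun Y => by
    simp only [jordan_kap]
    refine ⟨?_, ?_, ?_⟩ <;> ext1 <;> simp [kap, bar_bar]
    all_goals first | ring1 | simp only [mk_zero, smul_zero, neg_zero]
  obtain ⟨a, b, c⟩ := e X
  obtain ⟨a', b', c'⟩ := e (D X)
  have a2 := congrArg D a
  have b2 := congrArg D b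
  have c2 := congrArg D c
  rw [map_sub, map_smul, l, k, so6C_apply_kap h] at a2 b2 c2
  rw [a2] at a'
  rw [b2] at b'
  rw [c2] at c'
  exact ⟨(congrArg J.ξ₁ a').symm, (congrArg J.ξ₂ b').symm, (congrArg J.ξ₃ c').symm⟩

theorem so6C_tr (h : D ∈ so6C) (X : J) : tr (D X) = 0 := by
  obtain ⟨a, b, c⟩ := so6C_diag h X
  change (D X).ξ₁ + (D X).ξ₂ + (D X).ξ₃ = 0
  rw [a, b, c, add_zero, add_zero]

/-- The form is the trace of the Jordan product, and the derivation `D` takes values of trace zero.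
-/
theorem so6C_form (h : D ∈ so6C) (X Y : J) : form (D X) Y = -form X (D Y) := by
  have := so6C_tr h (jordan X Y)
  rw [h.1, map_add] at this
  exact eq_neg_of_add_eq_zero_left this

theorem so6C_transpose (h : D ∈ so6C) : transpose D = -D :=
  transpose_unique fun X Y => by
    rw [LinearMap.neg_apply, map_neg, LinearMap.neg_apply, so6C_form h, neg_neg]

/-- The Freudenthal product is built from the Jordan product, the trace, the form and `E`, all
compatible with `D`; the terms in which `D` hits `A` disappear. -/
theorem so6C_cross (h : D ∈ so6C) {A : J} (hA : D A = 0) (X : J) :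
    D (cross A X) = cross A (D X) := by
  simp only [cross, LinearMap.mk₂_apply, map_smul, map_add, map_sub, h.1 A X, hA, map_zero,
    LinearMap.zero_apply, f4_apply_E h.1, so6C_tr h]
  have : form A (D X) = 0 := by
    rw [← neg_eq_zero, ← so6C_form h, hA, map_zero, LinearMap.zero_apply]
  rw [this]
  simp

end J

namespace E8

open J FP Oct

theorem bracket_toE8_RD (N : Matrix (Fin 10) (Fin 10) ℂ) {D : Module.End ℂ J} (h : D ∈ so6C) :
    bracket (toE8 N) (RD D) = 0 := by
  rw [bracket_RD]
  ext1
  · refine LinearMap.ext fun R => ?_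
    simp only [toE8, LinearMap.sub_apply, Module.End.mul_apply, Phi_apply, so6C_transpose h,
      transpose_opK]
    have hk := fun x y z a b c p q X => LinearMap.congr_fun (so6C_mul_opK h x y z a b c p q) X
    simp only [Module.End.mul_apply] at hk
    have hc := fun a b c p q => so6C_cross h (so6C_apply_kap h a b c p q)
    have hf : ∀ a b c p q X, form (kap a b c p q) (D X) = 0 := fun a b c p q X => by
      rw [← neg_eq_zero, ← so6C_form h, so6C_apply_kap h, map_zero, LinearMap.zero_apply]
    ext1 <;> simp [hk, hc, hf, so6C_apply_kap h]
  case P | Q => ext1 <;> simp [Phi_apply, toE8, so6C_transpose h, so6C_apply_kap h]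
  all_goals rfl

theorem toE8_mem (N : Matrix (Fin 10) (Fin 10) ℂ) : toE8 N ∈ e8CFixed :=
  ⟨⟨_, opK_mem_e6 _ _ _ _ _ _ _, _, _, _, rfl⟩, sigma_toE8 N, fun _ h => bracket_toE8_RD N h⟩

end E8

/-! ### Invariants of `𝔰𝔬(6)` in `𝔍^C` and its centralizer in `𝔣₄^C` -/

namespace Oct

/-- The basis elements `e₀ = 1, e₁, …, e₇`. -/
def unit (i : Fin 8) : Oct :=
  ⟨if i = 0 then 1 else 0, if i = 1 then 1 else 0, if i = 2 then 1 else 0, if i = 3 then 1 else 0,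
    if i = 4 then 1 else 0, if i = 5 then 1 else 0, if i = 6 then 1 else 0, if i = 7 then 1 else 0⟩

theorem tau_unit (i : Fin 8) : tau (unit i) = unit i := by
  ext1 <;> simp [tau, unit]

theorem re_unit_mul_bar_unit {i j : Fin 8} (h : i ≠ j) : re (unit i * bar (unit j)) = 0 := by
  rw [re_mul_bar]
  fin_cases i <;> fin_cases j <;> simp [unit] <;> exact h rfl

theorem eq_zero_of_forall {x : Oct} (h : ∀ i, re (unit i * bar x) = 0) : x = 0 := by
  have := fun i => (re_mul_bar (unit i) x).symm.trans (h i)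
  ext1
  · simpa [unit] using this 0
  · simpa [unit] using this 1
  · simpa [unit] using this 2
  · simpa [unit] using this 3
  · simpa [unit] using this 4
  · simpa [unit] using this 5
  · simpa [unit] using this 6
  · simpa [unit] using this 7

theorem eq_sum_unit (x : Oct) : x = x.c0 • unit 0 + x.c1 • unit 1 + x.c2 • unit 2 +
    x.c3 • unit 3 + x.c4 • unit 4 + x.c5 • unit 5 + x.c6 • unit 6 + x.c7 • unit 7 := by
  ext1 <;> simp [unit]

/-- The right nucleus of the Cayley algebra consists of the scalars. The condition for `eᵢ, eⱼ`
forces `p` into the quaternion subalgebra that they generate, and the subalgebras for the pairs `(1,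
2)`, `(1, 4)`, `(2, 4)` meet in the scalars. -/
theorem smul_one_of_nucleus {p : Oct} (h : ∀ a x : Oct, a * x * p = a * (x * p)) :
    p = p.c0 • one := by
  have h12 := h (unit 1) (unit 2)
  have h14 := h (unit 1) (unit 4)
  have h24 := h (unit 2) (unit 4)
  simp only [Oct.ext_iff] at h12 h14 h24
  simp [unit] at h12 h14 h24
  ext1 <;> simp [one] <;> grind

end Oct

namespace J

open Oct

/-- The derivation `[Ã₁(a), Ã₁(b)]`. -/
def rot (a b : Oct) : Module.End ℂ J := tildeA1 a * tildeA1 b - tildeA1 b * tildeA1 a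

theorem rot_apply (a b : Oct) (X : J) : rot a b X =
    ⟨0, 1 / 2 * (X.ξ₃ - X.ξ₂) * (re (a * bar b) - re (b * bar a)),
    -(1 / 2) * (X.ξ₃ - X.ξ₂) * (re (a * bar b) - re (b * bar a)),
    re (a * bar X.x₁) • b - re (b * bar X.x₁) • a,
    (1 / 4 : ℂ) • (bar b * (a * X.x₂) - bar a * (b * X.x₂)),
    (1 / 4 : ℂ) • ((X.x₃ * a) * bar b - (X.x₃ * b) * bar a)⟩ := by
  have m : ∀ a b : Oct, tildeA1 a (tildeA1 b X) =
      ⟨0, 1 / 2 * (X.ξ₃ - X.ξ₂) * re (a * bar b), -(1 / 2) * (X.ξ₃ - X.ξ₂) * re (a * bar b),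
        -re (b * bar X.x₁) • a, -(1 / 4 : ℂ) • (bar a * (b * X.x₂)),
        -(1 / 4 : ℂ) • ((X.x₃ * b) * bar a)⟩ := fun a b => by
    rw [tildeA1_apply, tildeA1_apply]
    ext1 <;> dsimp only
    case x₁ => module
    case x₂ => rw [smul_mul_assoc, map_smul, bar_mul, bar_bar, smul_smul]; norm_num
    case x₃ => rw [mul_smul_comm, map_smul, bar_mul, bar_bar, smul_smul]; norm_num
    all_goals rw [map_smul, mul_smul_comm, map_smul, smul_eq_mul]; try ring
  have l : ∀ u v : Oct, -(1 / 4 : ℂ) • u - -(1 / 4 : ℂ) • v = (1 / 4 : ℂ) • (v - u) := fun u v => by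
    module
  rw [rot, LinearMap.sub_apply, Module.End.mul_apply, Module.End.mul_apply, m, m]
  ext1 <;> simp only [sub_ξ₁, sub_ξ₂, sub_ξ₃, sub_x₁, sub_x₂, sub_x₃, l, sub_self]
  case x₁ => module
  all_goals ring

theorem tau_tildeA1 {a : Oct} (h : Oct.tau a = a) (X : J) :
    tildeA1 a (tau X) = tau (tildeA1 a X) := by
  have hr : ∀ x : Oct, star (re x) = re (Oct.tau x) := fun _ => rfl
  rw [tildeA1_apply, tildeA1_apply, tau_apply, tau_apply]
  ext1 <;> simp only [star_zero, star_neg, hr, tau_mul, tau_bar, h, map_smulₛₗ, map_mul, map_neg,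
    map_sub, map_div₀, map_one, map_ofNat, starRingEnd_apply]

/-- On `x₁` this derivation is the rotation of the plane of `eᵢ, eⱼ`, which is orthogonal to `1` and
`e₁`; it is real because the basis is. These rotations are the only elements of `𝔰𝔬(6)` that the
centralizer arguments use. -/
theorem rot_unit_mem_so6 {i j : Fin 8} (hi : 2 ≤ i) (hj : 2 ≤ j) (h : i ≠ j) :
    rot (unit i) (unit j) ∈ so6 := by
  have k : ∀ x, re (unit i * bar x) = 0 → re (unit j * bar x) = 0 →
      rot (unit i) (unit j) (F1 x) = 0 := fun x hi hj => by
    rw [rot_apply]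
    simp [F1, hi, hj]
    rfl
  have l : ∀ a b c, rot (unit i) (unit j) (kap a b c 0 0) = 0 := fun a b c => by
    rw [rot_apply]
    simp [kap, mk_zero, re_unit_mul_bar_unit h, re_unit_mul_bar_unit h.symm]
    rfl
  have h0 : one = unit 0 := by ext1 <;> simp [one, unit]
  have h1 : e1 = unit 1 := by ext1 <;> simp [e1, unit]
  refine ⟨⟨commutator_mem_f4 (tildeA1_mem_f4 _) (tildeA1_mem_f4 _), l _ _ _, l _ _ _, l _ _ _,
    k _ ?_ ?_, k _ ?_ ?_⟩, fun X => ?_⟩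
  · rw [h0]
    exact re_unit_mul_bar_unit (by omega)
  · rw [h0]
    exact re_unit_mul_bar_unit (by omega)
  · rw [h1]
    exact re_unit_mul_bar_unit (by omega)
  · rw [h1]
    exact re_unit_mul_bar_unit (by omega)
  · simp only [rot, LinearMap.sub_apply, Module.End.mul_apply, tau_tildeA1 (tau_unit _), map_sub]

/-- The elements of `𝔍^C` annihilated by `𝔰𝔬(6)` form the subalgebra of the `kap a b c p q`. -/
theorem eq_kap_of_so6 {X : J} (h : ∀ D ∈ so6, D X = 0) :
    X = kap X.ξ₁ X.ξ₂ X.ξ₃ X.x₁.c0 X.x₁.c1 := by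
  -- Three disjoint planes exhaust `e₂, …, e₇`, which disposes of these coordinates of `x₁`; on `x₂`
  -- and `x₃` each of the three rotations is already invertible.
  have h23 := h _ (rot_unit_mem_so6 (i := 2) (j := 3) (by decide) (by decide) (by decide))
  have h45 := h _ (rot_unit_mem_so6 (i := 4) (j := 5) (by decide) (by decide) (by decide))
  have h67 := h _ (rot_unit_mem_so6 (i := 6) (j := 7) (by decide) (by decide) (by decide))
  rw [rot_apply] at h23 h45 h67
  simp only [J.ext_iff, Oct.ext_iff] at h23 h45 h67 ⊢
  simp [unit, re_mul_bar] at h23 h45 h67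
  simp [kap]
  grind

variable {δ : Module.End ℂ J}

/-- The element with `x₂ = x` and all other coordinates `0`. -/
def F2 (x : Oct) : J := ⟨0, 0, 0, 0, x, 0⟩

/-- The element with `x₃ = x` and all other coordinates `0`. -/
def F3 (x : Oct) : J := ⟨0, 0, 0, 0, 0, x⟩

theorem jordan_E1 (X : J) :
    jordan E1 X = ⟨X.ξ₁, 0, 0, 0, (1 / 2 : ℂ) • X.x₂, (1 / 2 : ℂ) • X.x₃⟩ := by
  rw [E1_eq, jordan_kap]
  ext1 <;> simp [mk_zero, bar_bar]

theorem jordan_E2 (X : J) :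
    jordan E2 X = ⟨0, X.ξ₂, 0, (1 / 2 : ℂ) • X.x₁, 0, (1 / 2 : ℂ) • X.x₃⟩ := by
  rw [E2_eq, jordan_kap]
  ext1 <;> simp [mk_zero, bar_bar]

theorem jordan_E3 (X : J) :
    jordan E3 X = ⟨0, 0, X.ξ₃, (1 / 2 : ℂ) • X.x₁, (1 / 2 : ℂ) • X.x₂, 0⟩ := by
  rw [E3_eq, jordan_kap]
  ext1 <;> simp [mk_zero]

theorem f4_jordan {T : J} (h : δ ∈ f4) (hT : δ T = 0) (X : J) :
    jordan T (δ X) = δ (jordan T X) := by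
  rw [h, hT, map_zero, LinearMap.zero_apply, zero_add]

/-- `δ` commutes with `Ẽ₁`, which annihilates `F₁(x)`, so the image has no `x₂`, `x₃` part; its
diagonal vanishes by `so6C_diag`. The next two lemmas use `E₂` and `E₃` in the same way. -/
theorem so6C_F1 (h : δ ∈ so6C) (x : Oct) : δ (F1 x) = F1 (δ (F1 x)).x₁ := by
  obtain ⟨h1, h2, h3⟩ := so6C_diag h (F1 x)
  have := f4_jordan h.1 h.2.1 (F1 x)
  rw [jordan_E1, jordan_E1] at this
  have z : δ ⟨(F1 x).ξ₁, 0, 0, 0, (1 / 2 : ℂ) • (F1 x).x₂, (1 / 2 : ℂ) • (F1 x).x₃⟩ = 0 := by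
    rw [← map_zero δ]
    congr 1
    ext1 <;> simp [F1]
  rw [z, J.ext_iff] at this
  ext1 <;> simp_all [F1]

theorem so6C_F2 (h : δ ∈ so6C) (x : Oct) : δ (F2 x) = F2 (δ (F2 x)).x₂ := by
  obtain ⟨h1, h2, h3⟩ := so6C_diag h (F2 x)
  have := f4_jordan h.1 h.2.2.1 (F2 x)
  rw [jordan_E2, jordan_E2] at this
  have z : δ ⟨0, (F2 x).ξ₂, 0, (1 / 2 : ℂ) • (F2 x).x₁, 0, (1 / 2 : ℂ) • (F2 x).x₃⟩ = 0 := by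
    rw [← map_zero δ]
    congr 1
    ext1 <;> simp [F2]
  rw [z, J.ext_iff] at this
  ext1 <;> simp_all [F2]

theorem so6C_F3 (h : δ ∈ so6C) (x : Oct) : δ (F3 x) = F3 (δ (F3 x)).x₃ := by
  obtain ⟨h1, h2, h3⟩ := so6C_diag h (F3 x)
  have := f4_jordan h.1 h.2.2.2.1 (F3 x)
  rw [jordan_E3, jordan_E3] at this
  have z : δ ⟨0, 0, (F3 x).ξ₃, (1 / 2 : ℂ) • (F3 x).x₁, (1 / 2 : ℂ) • (F3 x).x₂, 0⟩ = 0 := by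
    rw [← map_zero δ]
    congr 1
    ext1 <;> simp [F3]
  rw [z, J.ext_iff] at this
  ext1 <;> simp_all [F3]

theorem form_F1 (x y : Oct) : form (F1 x) (F1 y) = 2 * re (x * bar y) := by
  rw [form_apply]
  simp [F1]

theorem form_F2 (x y : Oct) : form (F2 x) (F2 y) = 2 * re (x * bar y) := by
  rw [form_apply]
  simp [F2]

/-- On `x₁`, `δ` is a skew matrix supported on `e₂, …, e₇`, and a skew `6 × 6` matrix commuting with
all plane rotations is zero. -/
theorem so6C_apply_F1 (h : δ ∈ so6C) (hc : ∀ D ∈ so6, D * δ = δ * D) (x : Oct) :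
    δ (F1 x) = 0 := by
  obtain ⟨y, hy⟩ : ∃ y : Fin 8 → Oct, ∀ i, δ (F1 (unit i)) = F1 (y i) :=
    ⟨fun i => (δ (F1 (unit i))).x₁, fun i => so6C_F1 h _⟩
  have hu : ∀ i : Fin 8, i < 2 → δ (F1 (unit i)) = 0 := fun i hi => by
    have : F1 (unit i) = kap 0 0 0 (if i = 0 then 1 else 0) (if i = 1 then 1 else 0) := by
      ext1 <;> simp only [F1, kap, unit]
      ext1 <;> simp <;> omega
    rw [this, so6C_apply_kap h]
  have key : ∀ i, y i = 0 := fun i => by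
    refine eq_zero_of_forall fun j => ?_
    have skew : re (y i * bar (unit j)) = -re (unit i * bar (y j)) := by
      have := so6C_form h (F1 (unit i)) (F1 (unit j))
      rw [hy, hy, form_F1, form_F1] at this
      linear_combination this / 2
    rw [re_mul_bar_comm]
    by_cases hi : i < 2
    · have : F1 (y i) = 0 := by rw [← hy, hu i hi]
      rw [show y i = 0 from congrArg J.x₁ this, zero_mul, map_zero]
    by_cases hj : j < 2
    · have : F1 (y j) = 0 := by rw [← hy, hu j hj]
      rw [skew, show y j = 0 from congrArg J.x₁ this, map_zero, mul_zero, map_zero, neg_zero]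
    by_cases hij : i = j
    · subst hij
      rw [re_mul_bar_comm (unit i)] at skew
      linear_combination skew / 2
    -- The rotation of the plane `eⱼ, eₖ` kills `eᵢ`, hence also `δ eᵢ`; but it carries the
    -- `eⱼ`-component of `δ eᵢ` to an `eₖ`-component, so the former is zero.
    obtain ⟨k, hk, hki, hkj⟩ :=
      (by decide : ∀ i j : Fin 8, ∃ k : Fin 8, 2 ≤ k ∧ k ≠ i ∧ k ≠ j) i j
    have hr : rot (unit j) (unit k) (F1 (unit i)) = 0 := by
      rw [rot_apply]
      simp [F1, re_unit_mul_bar_unit hki, re_unit_mul_bar_unit (Ne.symm hij)]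
      rfl
    have h0 := LinearMap.congr_fun
      (hc _ (rot_unit_mem_so6 (not_lt.1 hj) hk hkj.symm)) (F1 (unit i))
    rw [Module.End.mul_apply, Module.End.mul_apply, hr, map_zero, hy, rot_apply] at h0
    have h1 : re (unit j * bar (y i)) • unit k - re (unit k * bar (y i)) • unit j = 0 :=
      congrArg J.x₁ h0
    have h2 := congrArg (fun z => re (unit k * bar z)) h1
    have h3 : re (unit k * bar (unit k)) = 1 := by
      rw [re_mul_bar]
      fin_cases k <;> simp [unit]
    simp only [map_sub, map_smul, mul_sub, mul_smul_comm, h3, re_unit_mul_bar_unit hkj, map_zero,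
      mul_zero, sub_zero, smul_eq_mul, _root_.mul_one] at h2
    rw [re_mul_bar_comm, h2]
  have : F1 x = x.c0 • F1 (unit 0) + x.c1 • F1 (unit 1) + x.c2 • F1 (unit 2) +
      x.c3 • F1 (unit 3) + x.c4 • F1 (unit 4) + x.c5 • F1 (unit 5) + x.c6 • F1 (unit 6) +
      x.c7 • F1 (unit 7) := by
    nth_rw 1 [eq_sum_unit x]
    ext1 <;> simp [F1]
  rw [this]
  simp only [map_add, map_smul, hy, key]
  ext1 <;> simp [F1]

/-- The centralizer of `𝔰𝔬(6)` in `𝔰𝔬(6, C)` is trivial. -/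
theorem so6C_centralizer (h : δ ∈ so6C) (hc : ∀ D ∈ so6, D * δ = δ * D) : δ = 0 := by
  have h1 := so6C_apply_F1 h hc
  have h2 := so6C_F2 h
  have h3 := so6C_F3 h
  -- Triality: as `δ` kills every `F₁(a)`, this product ties its action on `x₃` to its action on
  -- `x₂`.
  have hj : ∀ a x, (2 : ℂ) • jordan (F1 a) (F2 x) = F3 (bar (a * x)) := fun a x => by
    rw [jordan_apply]
    ext1 <;> simp [F1, F2, F3, smul_smul]
  have huv : ∀ a x, (δ (F3 (bar (a * x)))).x₃ = bar (a * (δ (F2 x)).x₂) := fun a x => by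
    rw [← hj, map_smul, ← f4_jordan h.1 (h1 a), h2, hj]
    rfl
  -- The octonion `a x` is also the product of `1` and `a x`; comparing the two resulting values on
  -- `x₃` shows that `δ` on `x₂` commutes with left multiplications. It is thus right multiplication
  -- by its value at `1`, and that value lies in the nucleus.
  have hu : ∀ a x, (δ (F2 (a * x))).x₂ = a * (δ (F2 x)).x₂ := fun a x => by
    have e := huv one (a * x)
    rw [Oct.one_mul, Oct.one_mul, huv] at e
    have e' := congrArg bar e
    rw [bar_bar, bar_bar] at e'
    exact e'.symm
  have hp : ∀ a, (δ (F2 a)).x₂ = a * (δ (F2 one)).x₂ := fun a => by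
    rw [← hu, Oct.mul_one]
  have hs := smul_one_of_nucleus (p := (δ (F2 one)).x₂) fun a x => by
    rw [← hp, ← hp x, ← hu]
  -- Only a scalar is left, and `δ` is skew for the form.
  have h0 : (δ (F2 one)).x₂.c0 = 0 := by
    have e := so6C_form h (F2 one) (F2 one)
    rw [h2, form_F2, form_F2, re_mul_bar_comm, re_one_mul_bar] at e
    linear_combination e / 4
  have hz : ∀ a, δ (F2 a) = 0 := fun a => by
    rw [h2, hp, hs, h0, zero_smul, mul_zero]
    rfl
  have hz3 : ∀ a, δ (F3 a) = 0 := fun a => by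
    rw [h3, ← bar_bar a, ← Oct.one_mul (bar a), huv, hz]
    simp [F3]
    rfl
  refine LinearMap.ext fun X => ?_
  have : X = kap X.ξ₁ X.ξ₂ X.ξ₃ 0 0 + F1 X.x₁ + F2 X.x₂ + F3 X.x₃ := by
    ext1 <;> simp [kap, F1, F2, F3, mk_zero]
  rw [this, map_add, map_add, map_add, h1, hz, hz3, so6C_apply_kap h]
  simp

end J

namespace J

open Oct

theorem kap_inj {a b c p q a' b' c' p' q' : ℂ} : kap a b c p q = kap a' b' c' p' q' ↔
    a = a' ∧ b = b' ∧ c = c' ∧ p = p' ∧ q = q' := by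
  refine ⟨fun h => ⟨congrArg J.ξ₁ h, congrArg J.ξ₂ h, congrArg J.ξ₃ h,
    congrArg (fun X => X.x₁.c0) h, congrArg (fun X => X.x₁.c1) h⟩, ?_⟩
  rintro ⟨rfl, rfl, rfl, rfl, rfl⟩
  rfl

theorem jordan_kap_kap (a b c p q a' b' c' p' q' : ℂ) :
    jordan (kap a b c p q) (kap a' b' c' p' q') =
      kap (a * a') (b * b' + p * p' + q * q') (c * c' + p * p' + q * q')
        (1 / 2 * (p * b' + p * c' + (b + c) * p')) (1 / 2 * (q * b' + q * c' + (b + c) * q')) := by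
  rw [jordan_kap_eq, opK_kap]
  congr 1 <;> ring

theorem opK_mem_f4 (x y z : ℂ) : opK x y z 0 0 0 0 0 ∈ f4 := by
  rw [opK, kap_zero, map_zero, add_zero]
  exact add_mem (add_mem (f4.smul_mem _ (tildeA1_mem_f4 _)) (f4.smul_mem _ (tildeA1_mem_f4 _)))
    (f4.smul_mem _ (commutator_mem_f4 (tildeA1_mem_f4 _) (tildeA1_mem_f4 _)))

/-- A derivation that commutes with `𝔰𝔬(6)` acts on the subalgebra of the `kap a b c p q` like one
of the operators `opK x y z 0 0 0 0 0`. -/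
theorem exists_apply_kap_eq_opK {δ : Module.End ℂ J} (h : δ ∈ f4)
    (hc : ∀ D ∈ so6, D * δ = δ * D) :
    ∃ x y z, ∀ a b c p q, δ (kap a b c p q) = opK x y z 0 0 0 0 0 (kap a b c p q) := by
  have hk : ∀ a b c p q, ∃ a' b' c' p' q', δ (kap a b c p q) = kap a' b' c' p' q' :=
    fun a b c p q => ⟨_, _, _, _, _, eq_kap_of_so6 fun D hD => by
      rw [← Module.End.mul_apply, hc D hD, Module.End.mul_apply, so6C_apply_kap hD.1, map_zero]⟩
  have hs := fun a b c p q a' b' c' p' q' => h (kap a b c p q) (kap a' b' c' p' q')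
  simp only [jordan_kap_kap] at hs
  obtain ⟨a₁, b₁, c₁, p₁, q₁, h₁⟩ := hk 1 0 0 0 0
  obtain ⟨a₂, b₂, c₂, p₂, q₂, h₂⟩ := hk 0 1 0 0 0
  obtain ⟨a₃, b₃, c₃, p₃, q₃, h₃⟩ := hk 0 0 1 0 0
  obtain ⟨a₄, b₄, c₄, p₄, q₄, h₄⟩ := hk 0 0 0 1 0
  obtain ⟨a₅, b₅, c₅, p₅, q₅, h₅⟩ := hk 0 0 0 0 1
  have hE : kap a₁ b₁ c₁ p₁ q₁ + kap a₂ b₂ c₂ p₂ q₂ + kap a₃ b₃ c₃ p₃ q₃ = kap 0 0 0 0 0 := by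
    rw [← h₁, ← h₂, ← h₃, ← map_add, ← map_add, kap_add, kap_add, kap_zero, ← f4_apply_E h]
    congr 1
    simp only [add_zero, zero_add]
    rfl
  -- The derivation rule on products of the basis vectors `E₁`, `E₂`, `F₁(1)`, `F₁(e₁)`; together
  -- with `δ E = 0` these relations leave three free parameters.
  have e₁ := hs 1 0 0 0 0 1 0 0 0 0
  have e₂ := hs 0 1 0 0 0 0 1 0 0 0
  have e₃ := hs 0 0 0 1 0 0 0 0 1 0
  have e₄ := hs 0 0 0 0 1 0 0 0 0 1
  have e₅ := hs 1 0 0 0 0 0 0 0 1 0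
  have e₆ := hs 1 0 0 0 0 0 0 0 0 1
  have e₇ := hs 0 1 0 0 0 0 0 0 1 0
  have e₈ := hs 0 1 0 0 0 0 0 0 0 1
  have e₉ := hs 0 0 0 1 0 0 0 0 0 1
  have k₁ : kap 0 0 0 (1 / 2) 0 = (1 / 2 : ℂ) • kap 0 0 0 1 0 := by
    rw [kap_smul]; congr 1 <;> ring
  have k₂ : kap 0 0 0 0 (1 / 2) = (1 / 2 : ℂ) • kap 0 0 0 0 1 := by
    rw [kap_smul]; congr 1 <;> ring
  have k₃ : kap 0 1 1 0 0 = kap 0 1 0 0 0 + kap 0 0 1 0 0 := by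
    rw [kap_add]; congr 1 <;> ring
  simp only [_root_.mul_one, mul_zero, zero_mul, add_zero, zero_add, kap_zero, map_zero, k₁, k₂, k₃,
    map_smul, map_add, h₁, h₂, h₃, h₄, h₅, jordan_kap_kap] at e₁ e₂ e₃ e₄ e₅ e₆ e₇ e₈ e₉
  rw [← kap_zero] at e₅ e₆ e₉
  simp only [kap_add, kap_smul, kap_inj] at e₁ e₂ e₃ e₄ e₅ e₆ e₇ e₈ e₉ hE
  -- `opK x y z 0 0 0 0 0` sends `E₂` to a vector with `x₁ = -(x + y e₁)/2`, and `F₁(1)` to one with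
  -- `e₁`-coordinate `z`.
  refine ⟨-2 * p₂, -2 * q₂, q₄, fun a b c p q => ?_⟩
  have : kap a b c p q = a • kap 1 0 0 0 0 + b • kap 0 1 0 0 0 + c • kap 0 0 1 0 0 +
      p • kap 0 0 0 1 0 + q • kap 0 0 0 0 1 := by
    simp only [kap_smul, kap_add]
    congr 1 <;> ring
  rw [opK_kap]
  nth_rw 1 [this]
  simp only [map_add, map_smul, h₁, h₂, h₃, h₄, h₅]
  simp only [kap_smul, kap_add]
  rw [kap_inj]
  grind

/-- The centralizer of `𝔰𝔬(6)` in `𝔣₄^C`. -/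
theorem f4_centralizer {δ : Module.End ℂ J} (h : δ ∈ f4) (hc : ∀ D ∈ so6, D * δ = δ * D) :
    ∃ x y z, δ = opK x y z 0 0 0 0 0 := by
  obtain ⟨x, y, z, hk⟩ := exists_apply_kap_eq_opK h hc
  -- The difference kills every `kap`, so it lies in `𝔰𝔬(6, C)`, and it still commutes with `𝔰𝔬(6)`.
  refine ⟨x, y, z, sub_eq_zero.1 (so6C_centralizer ?_ fun D hD => ?_)⟩
  · have l : ∀ a b c p q, (δ - opK x y z 0 0 0 0 0) (kap a b c p q) = 0 := fun a b c p q => by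
      rw [LinearMap.sub_apply, hk, sub_self]
    refine ⟨sub_mem h (opK_mem_f4 x y z), ?_, ?_, ?_, ?_, ?_⟩
    · rw [E1_eq, l]
    · rw [E2_eq, l]
    · rw [E3_eq, l]
    · rw [F1_one_eq, l]
    · rw [F1_e1_eq, l]
  · rw [mul_sub, sub_mul, hc D hD, so6C_mul_opK hD.1]

end J

/-! ### From the centralizer of `𝔰𝔬(6)` to matrices -/

namespace E8

open J FP Oct

theorem exists_eq_kap_of_so6 {X : J} (h : ∀ D ∈ so6, D X = 0) : ∃ a b c p q, X = kap a b c p q :=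
  ⟨_, _, _, _, _, eq_kap_of_so6 h⟩

theorem exists_eq_kap_of_bracket_RD {R : E8} (h : R ∈ e8C)
    (hc : ∀ D ∈ so6, bracket R (RD D) = 0) :
    ∃ x y z b c p q a₁ b₁ c₁ p₁ q₁ a₂ b₂ c₂ p₂ q₂ ν a₃ b₃ c₃ p₃ q₃ a₄ b₄ c₄ p₄ q₄ ξ η
      a₅ b₅ c₅ p₅ q₅ a₆ b₆ c₆ p₆ q₆ ξ' η' r s t,
    R = ⟨Phi (opK x y z (-b - c) b c p q) (kap a₁ b₁ c₁ p₁ q₁) (kap a₂ b₂ c₂ p₂ q₂) ν,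
      ⟨kap a₃ b₃ c₃ p₃ q₃, kap a₄ b₄ c₄ p₄ q₄, ξ, η⟩,
      ⟨kap a₅ b₅ c₅ p₅ q₅, kap a₆ b₆ c₆ p₆ q₆, ξ', η'⟩, r, s, t⟩ := by
  obtain ⟨φ, hφ, A, B, ν, e⟩ := h
  obtain ⟨δ, hδ, _, ⟨T, hT, rfl⟩, rfl⟩ := Submodule.mem_sup.1 hφ
  rcases R with ⟨Φ, ⟨P, P', ξ, η⟩, ⟨Q, Q', ξ', η'⟩, r, s, t⟩
  obtain rfl : Φ = _ := e
  have hD : ∀ D ∈ so6, D * (δ + jordan T) = (δ + jordan T) * D ∧ D A = 0 ∧ D B = 0 ∧ D P = 0 ∧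
      D P' = 0 ∧ D Q = 0 ∧ D Q' = 0 := fun D hD => by
    have k := hc D hD
    rw [bracket_RD] at k
    have kΦ := fun S => LinearMap.congr_fun (congrArg E8.Φ k) S
    have kP := congrArg E8.P k
    have kQ := congrArg E8.Q k
    -- The arguments `(0, 0, 0, 1)`, `(0, 0, 1, 0)` and `(X, 0, 0, 0)` isolate `A`, `B` and `φ` in
    -- the commutator with `Φ(D, 0, 0, 0)`.
    have kA := congrArg FP.X (kΦ ⟨0, 0, 0, 1⟩)
    have kB := congrArg FP.Y (kΦ ⟨0, 0, 1, 0⟩)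
    have kX := fun X => congrArg FP.X (kΦ ⟨X, 0, 0, 0⟩)
    have kP1 := congrArg FP.X kP
    have kP2 := congrArg FP.Y kP
    have kQ1 := congrArg FP.X kQ
    have kQ2 := congrArg FP.Y kQ
    clear k kΦ kP kQ hc hφ
    simp [Phi_apply, so6C_transpose hD.1] at kA kB kX kP1 kP2 kQ1 kQ2
    refine ⟨LinearMap.ext fun X => ?_, ?_, ?_, ?_, ?_, ?_, ?_⟩
    · simpa using (sub_eq_zero.1 (kX X)).symm
    all_goals assumption
  -- Applying `[D, δ + T̃] = 0` to `E` gives `D T = 0`, since derivations kill `E` and `T ∘ E = T`.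
  -- Once `T` is invariant, `T̃` commutes with `D`, hence so does `δ`.
  obtain ⟨a, b, c, p, q, rfl⟩ := exists_eq_kap_of_so6 (X := T) fun D h => by
    have := LinearMap.congr_fun (hD D h).1 E
    simpa [jordan_E, f4_apply_E hδ, f4_apply_E h.1.1] using this
  obtain ⟨x, y, z, rfl⟩ := f4_centralizer hδ fun D h => by
    have := (hD D h).1
    rwa [mul_add, add_mul, jordan_kap_eq, so6C_mul_opK h.1, add_left_inj] at this
  obtain ⟨a₁, b₁, c₁, p₁, q₁, rfl⟩ := exists_eq_kap_of_so6 fun D h => (hD D h).2.1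
  obtain ⟨a₂, b₂, c₂, p₂, q₂, rfl⟩ := exists_eq_kap_of_so6 fun D h => (hD D h).2.2.1
  obtain ⟨a₃, b₃, c₃, p₃, q₃, rfl⟩ := exists_eq_kap_of_so6 fun D h => (hD D h).2.2.2.1
  obtain ⟨a₄, b₄, c₄, p₄, q₄, rfl⟩ := exists_eq_kap_of_so6 fun D h => (hD D h).2.2.2.2.1
  obtain ⟨a₅, b₅, c₅, p₅, q₅, rfl⟩ := exists_eq_kap_of_so6 fun D h => (hD D h).2.2.2.2.2.1
  obtain ⟨a₆, b₆, c₆, p₆, q₆, rfl⟩ := exists_eq_kap_of_so6 fun D h => (hD D h).2.2.2.2.2.2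
  have ht : a + b + c = 0 := hT
  refine ⟨x, y, z, b, c, p, q, a₁, b₁, c₁, p₁, q₁, a₂, b₂, c₂, p₂, q₂, ν, a₃, b₃, c₃, p₃, q₃,
    a₄, b₄, c₄, p₄, q₄, ξ, η, a₅, b₅, c₅, p₅, q₅, a₆, b₆, c₆, p₆, q₆, ξ', η', r, s, t, ?_⟩
  rw [jordan_kap_eq, opK_add, show a = -b - c by linear_combination ht]
  simp only [add_zero, zero_add]

end E8

namespace E8

open J FP Oct

theorem exists_toE8_eq (x y z b c p q a₁ b₁ c₁ p₁ q₁ a₂ b₂ c₂ p₂ q₂ ν a₃ b₃ c₃ p₃ q₃ a₄ b₄ c₄ p₄ q₄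
    ξ η a₅ b₅ c₅ p₅ q₅ a₆ b₆ c₆ p₆ q₆ ξ' η' r s t : ℂ) : ∃ N,
    toE8 N = ⟨Phi (opK x y z (-b - c) b c p q) (kap a₁ b₁ c₁ p₁ q₁) (kap a₂ b₂ c₂ p₂ q₂) ν,
      ⟨kap a₃ b₃ c₃ p₃ q₃, kap a₄ b₄ c₄ p₄ q₄, ξ, η⟩,
      ⟨kap a₅ b₅ c₅ p₅ q₅, kap a₆ b₆ c₆ p₆ q₆, ξ', η'⟩, r, s, t⟩ := by
  -- The solution of the linear system, which splits into small blocks; the recurring `2 / 3 * ν -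
  -- (b + c)` is the value of `N 4 5 - N 6 7`. The diagonal and the lower triangle are arbitrary, as
  -- `toE8` does not read them.
  obtain ⟨N, hN⟩ : ∃ N : Matrix (Fin 10) (Fin 10) ℂ, N = !![0, (c - b) / 2,
      (-b₁ + c₁ - b₂ + c₂) / 2, (-b₁ + c₁ + b₂ - c₂) / 2, (-b₃ + c₃ - b₆ + c₆) /
        4, (-b₃ + c₃ + b₆ - c₆) / 4, (-b₄ + c₄ + b₅ - c₅) / 4, (-b₄ + c₄ - b₅ + c₅) / 4, -x, -y;
      0, 0, (-b₁ - c₁ + b₂ + c₂) / 2, (-b₁ - c₁ - b₂ - c₂) / 2, (-b₃ - c₃ + b₆ + c₆) / 4, (-b₃ -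
        c₃ - b₆ - c₆) / 4, (b₄ + c₄ + b₅ + c₅) / 4, (b₄ + c₄ - b₅ - c₅) / 4, -p, -q;
      0, 0, 0, (2 / 3 * ν - (b + c)) + 3 / 2 * (b + c), (a₄ - η + a₅ - ξ') / 4, (a₄ - η - a₅ +
        ξ') / 4, (a₃ - ξ - a₆ + η') / 4, (a₃ - ξ + a₆ - η') / 4, -p₁ - p₂, -q₁ - q₂;
      0, 0, 0, 0, (a₄ + η - a₅ - ξ') / 4, (a₄ + η + a₅ + ξ') / 4, (-a₃ - ξ - a₆ - η') / 4, (-a₃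
        - ξ + a₆ + η') / 4, -p₁ + p₂, -q₁ + q₂;
      0, 0, 0, 0, 0, (2 / 3 * ν - (b + c)) / 2 - r, (a₁ - a₂ - s + t) / 2, (a₁ + a₂ - s - t) /
        2, -(p₃ + p₆) / 2, -(q₃ + q₆) / 2;
      0, 0, 0, 0, 0, 0, (-a₁ - a₂ - s - t) / 2, (-a₁ + a₂ - s + t) / 2, (p₆ - p₃) / 2, (q₆ - q₃)
        / 2;
      0, 0, 0, 0, 0, 0, 0, -r - (2 / 3 * ν - (b + c)) / 2, (p₅ - p₄) / 2, (q₅ - q₄) / 2;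
      0, 0, 0, 0, 0, 0, 0, 0, -(p₄ + p₅) / 2, -(q₄ + q₅) / 2;
      0, 0, 0, 0, 0, 0, 0, 0, 0, -z;
      0, 0, 0, 0, 0, 0, 0, 0, 0, 0] := ⟨_, rfl⟩
  refine ⟨N, ?_⟩
  obtain ⟨h01, h02, h03, h04, h05, h06, h07, h08, h09, h12, h13, h14, h15, h16, h17, h18, h19,
      h23, h24,
      h25, h26, h27, h28, h29, h34, h35, h36, h37, h38, h39, h45, h46, h47, h48, h49, h56, h57,
      h58, h59, h67, h68, h69, h78, h79, h89⟩ : N 0 1 = (c - b) / 2 ∧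
          N 0 2 = (-b₁ + c₁ - b₂ + c₂) / 2 ∧ N 0 3 = (-b₁ + c₁ + b₂ - c₂) / 2 ∧ N 0 4
      = (-b₃ + c₃ - b₆ + c₆) / 4 ∧ N 0 5 = (-b₃ + c₃ + b₆ - c₆) / 4 ∧ N 0 6 = (-b₄ + c₄ + b₅ - c₅)
      / 4 ∧ N 0 7 = (-b₄ + c₄ - b₅ + c₅) / 4 ∧ N 0 8 = -x ∧ N 0 9 = -y ∧ N 1 2 = (-b₁ - c₁ + b₂ +
      c₂) / 2 ∧ N 1 3 = (-b₁ - c₁ - b₂ - c₂) / 2 ∧ N 1 4 = (-b₃ - c₃ + b₆ + c₆) / 4 ∧ N 1 5 = (-b₃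
      - c₃ - b₆ - c₆) / 4 ∧ N 1 6 = (b₄ + c₄ + b₅ + c₅) / 4 ∧ N 1 7 = (b₄ + c₄ - b₅ - c₅) / 4 ∧ N
      1 8 = -p ∧ N 1 9 = -q ∧ N 2 3 = (2 / 3 * ν - (b + c)) + 3 / 2 * (b + c) ∧ N 2 4 = (a₄ - η +
      a₅ - ξ') / 4 ∧ N 2 5 = (a₄ - η - a₅ + ξ') / 4 ∧ N 2 6 = (a₃ - ξ - a₆ + η') / 4 ∧ N 2 7 = (a₃
      - ξ + a₆ - η') / 4 ∧ N 2 8 = -p₁ - p₂ ∧ N 2 9 = -q₁ - q₂ ∧ N 3 4 = (a₄ + η - a₅ - ξ') / 4 ∧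
      N 3 5 = (a₄ + η + a₅ + ξ') / 4 ∧ N 3 6 = (-a₃ - ξ - a₆ - η') / 4 ∧ N 3 7 = (-a₃ - ξ + a₆ +
      η') / 4 ∧ N 3 8 = -p₁ + p₂ ∧ N 3 9 = -q₁ + q₂ ∧ N 4 5 = (2 / 3 * ν - (b + c)) / 2 - r ∧ N 4
      6 = (a₁ - a₂ - s + t) / 2 ∧ N 4 7 = (a₁ + a₂ - s - t) / 2 ∧ N 4 8 = -(p₃ + p₆) / 2 ∧ N 4 9 =
      -(q₃ + q₆) / 2 ∧ N 5 6 = (-a₁ - a₂ - s - t) / 2 ∧ N 5 7 = (-a₁ + a₂ - s + t) / 2 ∧ N 5 8 =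
      (p₆ - p₃) / 2 ∧ N 5 9 = (q₆ - q₃) / 2 ∧ N 6 7 = -r - (2 / 3 * ν - (b + c)) / 2 ∧ N 6 8 = (p₅
      - p₄) / 2 ∧ N 6 9 = (q₅ - q₄) / 2 ∧ N 7 8 = -(p₄ + p₅) / 2 ∧ N 7 9 = -(q₄ + q₅) / 2 ∧ N 8 9
      = -z := by
    subst hN
    exact ⟨rfl, rfl, rfl, rfl, rfl, rfl, rfl, rfl, rfl, rfl, rfl, rfl, rfl, rfl, rfl, rfl, rfl,
        rfl, rfl,
      rfl, rfl, rfl, rfl, rfl, rfl, rfl, rfl, rfl, rfl, rfl, rfl, rfl, rfl, rfl, rfl, rfl, rfl,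
      rfl, rfl, rfl, rfl, rfl, rfl, rfl, rfl⟩
  clear hN
  ext1
  · simp only [toE8, h01, h02, h03, h04, h05, h06, h07, h08, h09, h12, h13, h14, h15, h16, h17,
      h18, h19, h23, h24,
      h25, h26, h27, h28, h29, h34, h35, h36, h37, h38, h39, h45, h46, h47, h48, h49, h56, h57,
      h58, h59, h67, h68, h69, h78, h79, h89]
    congr 1
    · congr 1 <;> ring
    · congr 1 <;> ring
    · congr 1 <;> ring
    · ring
  case P | Q =>
    simp only [toE8, h01, h02, h03, h04, h05, h06, h07, h08, h09, h12, h13, h14, h15, h16, h17,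
        h18, h19, h23, h24,
      h25, h26, h27, h28, h29, h34, h35, h36, h37, h38, h39, h45, h46, h47, h48, h49, h56, h57,
      h58, h59, h67, h68, h69, h78, h79, h89]
    congr 1
    · congr 1 <;> ring
    · congr 1 <;> ring
    · ring
    · ring
  all_goals simp only [toE8, h01, h02, h03, h04, h05, h06, h07, h08, h09, h12, h13, h14, h15, h16,
      h17, h18, h19, h23, h24,
      h25, h26, h27, h28, h29, h34, h35, h36, h37, h38, h39, h45, h46, h47, h48, h49, h56, h57,
      h58, h59, h67, h68, h69, h78, h79, h89]; ring

theorem apply_eq_zero_of_toE8_eq_zero {N : Matrix (Fin 10) (Fin 10) ℂ} (h : toE8 N = 0)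
    (i j : Fin 10) (hij : i < j) : N i j = 0 := by
  have hΦ := fun S => LinearMap.congr_fun (congrArg E8.Φ h) S
  have k := fun a b c p q a' b' c' p' q' ξ η =>
    hΦ ⟨kap a b c p q, kap a' b' c' p' q', ξ, η⟩
  have hP := congrArg E8.P h
  have hQ := congrArg E8.Q h
  have hr : _ = (0 : ℂ) := congrArg E8.r h
  have hs : _ = (0 : ℂ) := congrArg E8.s h
  have ht : _ = (0 : ℂ) := congrArg E8.t h
  simp only [toE8, zero_Φ, zero_P, zero_Q, LinearMap.zero_apply, fp_zero_eq, PhiK_kap,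
    FP.mk.injEq, kap_inj] at k hP hQ hr hs ht
  -- Test vectors that recover the parameters of `Φ`: `η = 1` and `ξ = 1` give `A`, `B` and `ν`,
  -- while `X = E₂, E₃, F₁(1)` give the parameters of `φ`.
  have k₁ := k 0 0 0 0 0 0 0 0 0 0 0 1
  have k₂ := k 0 0 0 0 0 0 0 0 0 0 1 0
  have k₃ := k 0 1 0 0 0 0 0 0 0 0 0 0
  have k₄ := k 0 0 1 0 0 0 0 0 0 0 0 0
  have k₅ := k 0 0 0 1 0 0 0 0 0 0 0 0
  clear k hΦ h
  simp only [mul_zero, zero_mul, add_zero, zero_add, sub_zero, _root_.mul_one] at k₁ k₂ k₃ k₄ k₅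
  fin_cases i <;> fin_cases j <;>
    first
    | exact absurd hij (by decide)
    | clear hij
      simp only [Fin.zero_eta, Fin.mk_one, Fin.reduceFinMk]
      grind

end E8

/-! ### The isomorphisms with `𝔰𝔬(10)` and the complexification -/

namespace E8

open J FP Oct

theorem toE8_congr {N N' : Matrix (Fin 10) (Fin 10) ℂ} (h : ∀ i j, i < j → N i j = N' i j) :
    toE8 N = toE8 N' := by
  simp only [toE8, h, Fin.reduceLT]

theorem exists_toE8_eq_of_bracket_RD {R : E8} (h : R ∈ e8C)
    (hc : ∀ D ∈ so6, bracket R (RD D) = 0) : ∃ N, toE8 N = R := by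
  obtain ⟨x, y, z, b, c, p, q, a₁, b₁, c₁, p₁, q₁, a₂, b₂, c₂, p₂, q₂, ν, a₃, b₃, c₃, p₃, q₃,
    a₄, b₄, c₄, p₄, q₄, ξ, η, a₅, b₅, c₅, p₅, q₅, a₆, b₆, c₆, p₆, q₆, ξ', η', r, s, t, rfl⟩ :=
    exists_eq_kap_of_bracket_RD h hc
  exact exists_toE8_eq ..

theorem wt_mul_wt (i : Fin 10) : wt i * wt i = sgn i := by
  fin_cases i <;> simp [wt, sgn]

theorem sgn_mul_sgn (i : Fin 10) : sgn i * sgn i = 1 := by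
  fin_cases i <;> simp [sgn]

theorem sgn_mul_star_wt (i : Fin 10) : sgn i * star (wt i) = wt i := by
  fin_cases i <;> simp [wt, sgn]

theorem wt_ne_zero (i : Fin 10) : wt i ≠ 0 := by
  fin_cases i <;> simp [wt]

/-- The linear map that sends the matrix `G_{ij}` to `R_{ij}`. -/
def ofMatrix (M : Matrix (Fin 10) (Fin 10) ℂ) : E8 := toE8 (Matrix.of fun i j => wt i * wt j * M i
    j)

theorem ofMatrix_add (M M' : Matrix (Fin 10) (Fin 10) ℂ) :
    ofMatrix (M + M') = ofMatrix M + ofMatrix M' := by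
  rw [ofMatrix, ofMatrix, ofMatrix, ← toE8_add]
  congr 1
  ext i j
  simp [mul_add]

theorem ofMatrix_smul (r : ℂ) (M : Matrix (Fin 10) (Fin 10) ℂ) :
    ofMatrix (r • M) = r • ofMatrix M := by
  rw [ofMatrix, ofMatrix, ← toE8_smul]
  congr 1
  ext i j
  simp [mul_left_comm]

theorem mem_so_iff {k : Type*} [CommRing k] {M : Matrix (Fin 10) (Fin 10) k} :
    M ∈ LieAlgebra.Orthogonal.so (Fin 10) k ↔ ∀ i j, M j i = -M i j := by
  rw [LieAlgebra.Orthogonal.mem_so, ← Matrix.ext_iff]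
  rfl

theorem apply_self_of_mem_so {M : Matrix (Fin 10) (Fin 10) ℂ}
    (h : M ∈ LieAlgebra.Orthogonal.so (Fin 10) ℂ) (i : Fin 10) : M i i = 0 :=
  self_eq_neg.1 (mem_so_iff.1 h i i)

/-- With `W = diag(wt)` and `S = diag(sgn)` one has `W S W = 1`, so `(W M W) S (W M' W) = W (M M')
W`: the signs of `bracket_toE8` are absorbed by the weights. -/
theorem bracket_ofMatrix {M M' : Matrix (Fin 10) (Fin 10) ℂ}
    (h : M ∈ LieAlgebra.Orthogonal.so (Fin 10) ℂ) (h' : M' ∈ LieAlgebra.Orthogonal.so (Fin 10) ℂ) :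
    bracket (ofMatrix M) (ofMatrix M') = ofMatrix (M * M' - M' * M) := by
  have k : ∀ M : Matrix (Fin 10) (Fin 10) ℂ, Matrix.of (fun i j => wt i * wt j * M i j) =
      Matrix.diagonal wt * M * Matrix.diagonal wt := fun M => by
    ext i j
    rw [Matrix.mul_diagonal, Matrix.diagonal_mul, Matrix.of_apply]
    ring
  have hs : Matrix.diagonal wt * Matrix.diagonal sgn * Matrix.diagonal wt = 1 := by
    rw [Matrix.diagonal_mul_diagonal, Matrix.diagonal_mul_diagonal, ← Matrix.diagonal_one]
    congr 1
    ext i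
    rw [mul_right_comm, wt_mul_wt, sgn_mul_sgn]
  have l : ∀ M M' : Matrix (Fin 10) (Fin 10) ℂ,
      Matrix.diagonal wt * M * Matrix.diagonal wt * Matrix.diagonal sgn *
        (Matrix.diagonal wt * M' * Matrix.diagonal wt) =
      Matrix.diagonal wt * (M * M') * Matrix.diagonal wt := fun M M' => by
    calc _ = Matrix.diagonal wt * M * (Matrix.diagonal wt * Matrix.diagonal sgn *
          Matrix.diagonal wt) * M' * Matrix.diagonal wt := by simp only [Matrix.mul_assoc]
      _ = _ := by rw [hs]; simp only [Matrix.mul_assoc, Matrix.one_mul]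
  rw [ofMatrix, ofMatrix, ofMatrix, bracket_toE8, k, k, k, l, l, ← Matrix.sub_mul, ← Matrix.mul_sub]
  · intro i j _
    rw [Matrix.of_apply, Matrix.of_apply, mem_so_iff.1 h j i]
    ring
  · intro i j _
    rw [Matrix.of_apply, Matrix.of_apply, mem_so_iff.1 h' j i]
    ring
  · intro i
    rw [Matrix.of_apply, apply_self_of_mem_so h, mul_zero]
  · intro i
    rw [Matrix.of_apply, apply_self_of_mem_so h', mul_zero]

theorem eq_zero_of_ofMatrix_eq_zero {M : Matrix (Fin 10) (Fin 10) ℂ}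
    (h : M ∈ LieAlgebra.Orthogonal.so (Fin 10) ℂ) (h0 : ofMatrix M = 0) : M = 0 := by
  have k : ∀ i j, i < j → M i j = 0 := fun i j hij =>
    (mul_eq_zero.1 (apply_eq_zero_of_toE8_eq_zero h0 i j hij)).resolve_left
      (mul_ne_zero (wt_ne_zero i) (wt_ne_zero j))
  ext i j
  obtain hij | rfl | hij := lt_trichotomy i j
  · exact k i j hij
  · exact apply_self_of_mem_so h i
  · rw [mem_so_iff.1 h j i, k j i hij, neg_zero]
    rfl

theorem ofMatrix_injOn : Set.InjOn ofMatrix (LieAlgebra.Orthogonal.so (Fin 10) ℂ) :=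
  fun M h M' h' e => by
    refine sub_eq_zero.1 (eq_zero_of_ofMatrix_eq_zero (sub_mem h h') ?_)
    rw [sub_eq_add_neg, ← neg_one_smul ℂ M', ofMatrix_add, ofMatrix_smul, e, neg_one_smul,
      add_neg_cancel]

theorem exists_ofMatrix_eq {R : E8} (h : R ∈ e8C) (hc : ∀ D ∈ so6, bracket R (RD D) = 0) :
    ∃ M ∈ LieAlgebra.Orthogonal.so (Fin 10) ℂ, ofMatrix M = R := by
  obtain ⟨N, rfl⟩ := exists_toE8_eq_of_bracket_RD h hc
  -- The upper triangle of `N` is extended skew-symmetrically and the weights are divided out.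
  refine ⟨Matrix.of fun i j => (wt i)⁻¹ * (wt j)⁻¹ *
    if i < j then N i j else if j < i then -N j i else 0, mem_so_iff.2 fun i j => ?_,
    toE8_congr fun i j hij => ?_⟩
  · rw [Matrix.of_apply, Matrix.of_apply]
    obtain hij | rfl | hij := lt_trichotomy i j
    · rw [if_neg hij.not_gt, if_pos hij, if_pos hij]
      ring
    · simp
    · rw [if_pos hij, if_neg hij.not_gt, if_pos hij]
      ring
  · have hi := wt_ne_zero i
    have hj := wt_ne_zero j
    rw [Matrix.of_apply, Matrix.of_apply, if_pos hij]
    field_simp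

theorem ofMatrix_mem (M : Matrix (Fin 10) (Fin 10) ℂ) : ofMatrix M ∈ e8CFixed := toE8_mem _

/-- The sign `wᵢ²` compensates the conjugation of the weight `wᵢ`, so only the conjugation of the
entries of `M` survives. -/
theorem tau_lamOmega_ofMatrix (M : Matrix (Fin 10) (Fin 10) ℂ) :
    tau (lamOmega (ofMatrix M)) = ofMatrix (M.map star) := by
  rw [ofMatrix, ofMatrix, tau_lamOmega_toE8]
  congr 1
  ext i j
  rw [Matrix.of_apply, Matrix.of_apply, Matrix.of_apply, Matrix.map_apply, star_mul', star_mul']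
  linear_combination (star (M i j)) * (sgn j * star (wt j)) * sgn_mul_star_wt i +
    star (M i j) * wt i * sgn_mul_star_wt j

theorem ofMatrix_map_ofReal_add (M M' : Matrix (Fin 10) (Fin 10) ℝ) :
    ofMatrix ((M + M').map Complex.ofReal) =
      ofMatrix (M.map Complex.ofReal) + ofMatrix (M'.map Complex.ofReal) := by
  rw [← ofMatrix_add]
  congr 1
  ext i j
  exact Complex.ofReal_add _ _

theorem ofMatrix_map_ofReal_smul (r : ℝ) (M : Matrix (Fin 10) (Fin 10) ℝ) :
    ofMatrix ((r • M).map Complex.ofReal) = r • ofMatrix (M.map Complex.ofReal) := by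
  have : (r • M).map Complex.ofReal = (r : ℂ) • M.map Complex.ofReal := by
    ext i j
    exact Complex.ofReal_mul _ _
  rw [this, ofMatrix_smul]
  exact Complex.coe_smul r _

theorem map_ofReal_mem_so {M : Matrix (Fin 10) (Fin 10) ℝ}
    (h : M ∈ LieAlgebra.Orthogonal.so (Fin 10) ℝ) :
    M.map Complex.ofReal ∈ LieAlgebra.Orthogonal.so (Fin 10) ℂ :=
  mem_so_iff.2 fun i j => by
    rw [Matrix.map_apply, Matrix.map_apply, mem_so_iff.1 h i j, Complex.ofReal_neg]

theorem ofMatrix_map_ofReal_mem (M : Matrix (Fin 10) (Fin 10) ℝ) :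
    ofMatrix (M.map Complex.ofReal) ∈ e8Fixed := by
  obtain ⟨h₁, h₂, h₃⟩ := ofMatrix_mem (M.map Complex.ofReal)
  refine ⟨⟨h₁, ?_⟩, h₂, fun D hD => h₃ D hD.1⟩
  rw [tau_lamOmega_ofMatrix]
  congr 1
  ext i j
  exact Complex.conj_ofReal _

theorem exists_ofMatrix_map_ofReal_eq {R : E8} (h : R ∈ e8Fixed) :
    ∃ M ∈ LieAlgebra.Orthogonal.so (Fin 10) ℝ, ofMatrix (M.map Complex.ofReal) = R := by
  obtain ⟨⟨h₁, h₂⟩, -, h₃⟩ := h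
  obtain ⟨M, hM, rfl⟩ := exists_ofMatrix_eq h₁ h₃
  rw [tau_lamOmega_ofMatrix] at h₂
  have hs : M.map star ∈ LieAlgebra.Orthogonal.so (Fin 10) ℂ := mem_so_iff.2 fun i j => by
    rw [Matrix.map_apply, Matrix.map_apply, mem_so_iff.1 hM i j, star_neg]
  -- Injectivity turns invariance under `τ λ_ω` into the equality of `M` with its conjugate, so `M`
  -- is real.
  have e := ofMatrix_injOn hs hM h₂
  refine ⟨M.map Complex.re, mem_so_iff.2 fun i j => ?_, congrArg _ ?_⟩
  · rw [Matrix.map_apply, Matrix.map_apply, mem_so_iff.1 hM i j, Complex.neg_re]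
  · ext i j
    exact Complex.conj_eq_iff_re.1 (congrFun (congrFun e i) j)

/-- The left side only requires commuting with the real `𝔰𝔬(6)`, the right side with `𝔰𝔬(6, C)`; the
gap is closed by passing through matrices. -/
theorem e8Fixed_subset : ∀ R ∈ e8Fixed, R ∈ e8CFixed := fun R h => by
  obtain ⟨M, -, rfl⟩ := exists_ofMatrix_map_ofReal_eq h
  exact ofMatrix_mem _

/-- The isomorphism of `𝔰𝔬(10, C)` with `(𝔢₈^C)^{σ'₄, 𝔰𝔬(6, C)}`. -/
def soEquivC : LieAlgebra.Orthogonal.so (Fin 10) ℂ ≃ₗ[ℂ] e8CFixed :=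
  LinearEquiv.ofBijective
    { toFun M := ⟨ofMatrix M.1, ofMatrix_mem _⟩
      map_add' M M' := Subtype.ext (ofMatrix_add M.1 M'.1)
      map_smul' r M := Subtype.ext (ofMatrix_smul r M.1) }
    ⟨fun M M' e => Subtype.ext (ofMatrix_injOn M.2 M'.2 (congrArg Subtype.val e)), fun R => by
      obtain ⟨M, hM, e⟩ := exists_ofMatrix_eq R.2.1 fun D hD => R.2.2.2 D hD.1
      exact ⟨⟨M, hM⟩, Subtype.ext e⟩⟩

/-- The isomorphism of `𝔰𝔬(10)` with `(𝔢₈)^{σ'₄, 𝔰𝔬(6)}`. -/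
def soEquiv : LieAlgebra.Orthogonal.so (Fin 10) ℝ ≃ₗ[ℝ] e8Fixed :=
  LinearEquiv.ofBijective
    { toFun M := ⟨ofMatrix (M.1.map Complex.ofReal), ofMatrix_map_ofReal_mem _⟩
      map_add' M M' := by
        apply Subtype.ext
        rw [Submodule.coe_add]
        exact ofMatrix_map_ofReal_add M.1 M'.1
      map_smul' r M := by
        apply Subtype.ext
        rw [RingHom.id_apply, Submodule.coe_smul]
        exact ofMatrix_map_ofReal_smul r M.1 }
    ⟨fun M M' e => Subtype.ext <| Matrix.map_injective Complex.ofReal_injective <| by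
      have e' : ofMatrix (M.1.map Complex.ofReal) = ofMatrix (M'.1.map Complex.ofReal) :=
        congrArg Subtype.val e
      exact ofMatrix_injOn (map_ofReal_mem_so M.2) (map_ofReal_mem_so M'.2) e',
    fun R => by
      obtain ⟨M, hM, e⟩ := exists_ofMatrix_map_ofReal_eq R.2
      exact ⟨⟨M, hM⟩, Subtype.ext e⟩⟩

theorem existsUnique_of_mem {R : E8} (h : R ∈ e8CFixed) :
    ∃! p : e8Fixed × e8Fixed, R = (p.1 : E8) + Complex.I • (p.2 : E8) := by
  obtain ⟨M, -, rfl⟩ := exists_ofMatrix_eq h.1 fun D hD => h.2.2 D hD.1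
  refine existsUnique_of_exists_of_unique
    ⟨(⟨_, ofMatrix_map_ofReal_mem (M.map Complex.re)⟩,
      ⟨_, ofMatrix_map_ofReal_mem (M.map Complex.im)⟩), ?_⟩ fun p p' e e' => ?_
  · rw [← ofMatrix_smul, ← ofMatrix_add]
    congr 1
    ext i j
    simp [mul_comm Complex.I, Complex.re_add_im]
  -- The antilinear map `τ λ_ω` fixes both components, so it sends `R' + i R''` to `R' - i R''`; the
  -- sum of the two equations determines `R'`, and then `R''`.
  · have k : ∀ p : e8Fixed × e8Fixed, ofMatrix M = (p.1 : E8) + Complex.I • (p.2 : E8) →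
        tau (lamOmega (ofMatrix M)) = p.1 - Complex.I • (p.2 : E8) := fun p e => by
      rw [e, tau_lamOmega_add, tau_lamOmega_smulC, p.1.2.1.2, p.2.2.1.2, Complex.star_def,
        Complex.conj_I, neg_smul, sub_eq_add_neg]
    have l := e.symm.trans e'
    have l' := (k p e).symm.trans (k p' e')
    have h₁ : (p.1 : E8) = p'.1 := by
      have e := congrArg₂ (· + ·) l l'
      simp only [add_add_sub_cancel, ← two_smul ℂ] at e
      exact smul_right_injective E8 two_ne_zero e
    have h₂ : (p.2 : E8) = p'.2 := by
      rw [h₁, add_right_inj] at l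
      exact smul_right_injective E8 Complex.I_ne_zero l
    exact Prod.ext (Subtype.ext h₁) (Subtype.ext h₂)

end E8

end

theorem proposition6p2 :
    (∃ f : LieAlgebra.Orthogonal.so (Fin 10) ℝ ≃ₗ[ℝ] E8.e8Fixed,
      (∀ x y, (f ⁅x, y⁆ : E8) = E8.bracket (f x) (f y)) ∧
      ∀ i j : Fin 10, i < j → (f (soG ℝ i j) : E8) = E8.R i j) ∧
    (∃ F : LieAlgebra.Orthogonal.so (Fin 10) ℂ ≃ₗ[ℂ] E8.e8CFixed,
      (∀ x y, (F ⁅x, y⁆ : E8) = E8.bracket (F x) (F y)) ∧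
      ∀ i j : Fin 10, i < j → (F (soG ℂ i j) : E8) = E8.R i j) ∧
    (∀ R : E8, R ∈ E8.e8CFixed ↔
      ∃! p : E8.e8Fixed × E8.e8Fixed, R = (p.1 : E8) + Complex.I • (p.2 : E8)) := by
  refine ⟨⟨E8.soEquiv, fun x y => ?_, fun i j hij => ?_⟩,
    ⟨E8.soEquivC, fun x y => ?_, fun i j hij => ?_⟩, fun R => ⟨E8.existsUnique_of_mem, ?_⟩⟩
  · refine Eq.trans (congrArg E8.ofMatrix ?_)
      (E8.bracket_ofMatrix (E8.map_ofReal_mem_so x.2) (E8.map_ofReal_mem_so y.2)).symm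
    -- Entrywise inclusion of `ℝ` in `ℂ` is a ring homomorphism and so respects matrix commutators.
    have h : ∀ M M' : Matrix (Fin 10) (Fin 10) ℝ,
        (M * M' - M' * M).map Complex.ofRealHom = M.map Complex.ofRealHom * M'.map
            Complex.ofRealHom -
          M'.map Complex.ofRealHom * M.map Complex.ofRealHom := fun M M' => by
      rw [Matrix.map_sub _ (map_sub _), Matrix.map_mul, Matrix.map_mul]
    exact h x.1 y.1
  · refine Eq.trans (congrArg E8.ofMatrix ?_) (E8.toE8_soG i j hij)
    ext a b
    simp [soG, Matrix.single_apply, apply_ite Complex.ofReal]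
  · exact (E8.bracket_ofMatrix x.2 y.2).symm
  · exact E8.toE8_soG i j hij
  · rintro ⟨p, rfl, -⟩
    exact add_mem (E8.e8Fixed_subset _ p.1.2)
      (Submodule.smul_mem _ _ (E8.e8Fixed_subset _ p.2.2))
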